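/- **Setting.** Let $Z(t)$ be an ergodic continuous-time Markov chain on a countable set $\mathcal Z$ with rate matrix $Q=[\alpha_{ii'}]$, exit rates $\alpha_{i\bullet}=\sum_{i'\ne i}\alpha_{ii'}$ with $\sup_i\alpha_{i\bullet}<\infty$, and stationary distribution $\pi$; write $\mathbb E[f(i)]=\sum_i\pi_i f(i)$. There are $n\ge 1$ servers, each with an infinite buffer. While $Z(t)=i$, jobs arrive at rate $\lambda_i\geq 0$ and server $j$ works at rate $\mu_{ij}\geq 0$ (exponential inter-arrival and service times); an arriving job joins a shortest queue, ties being broken uniformly at random. Let $q_j(t)$ be the number of jobs at server $j$, so that $(Z(t),\boldsymbol q(t))$ is a Markov chain on $\mathcal Z\times\mathbb Z_+^n$. Put $\mu_{i\Sigma}=\sum_j\mu_{ij}$, $\mu_{i\min}=\min_j\mu_{ij}$, $\mu_\Sigma=\mathbb E[\mu_{i\Sigma}]$, $\lambda=\mathbb E[\lambda_i]$ and $\epsilon=1-\lambda/\mu_\Sigma$. Heavy traffic means $\epsilon\downarrow 0$ with $Q$ and $[\mu_{ij}]$ fixed: for some $\epsilon_0>0$ we are given, for each $\epsilon\in(0,\epsilon_0)$,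 arrival rates $\lambda_i=\lambda_i^{(\epsilon)}$ that are affine in $\epsilon$ for each $i$ and satisfy $\lambda=(1-\epsilon)\mu_\Sigma$ with $\mu_\Sigma>0$; all $\lambda_i^{(\epsilon)}$ and $\mu_{ij}$ are bounded by constants. A solution of the Poisson equation for $f:\mathcal Z\to\mathbb R$ is a function $V_f:\mathcal Z\to\mathbb R$ such that, with absolutely convergent sums, $\alpha_{i\bullet}V_f(i)=f(i)-\mathbb E[f]+\sum_{i'\neq i}\alpha_{ii'}V_f(i')$ for all $i$. **Theorem.** Assume the SSC load condition: $\lambda_i^{(\epsilon)}>\mu_{i\Sigma}-n\mu_{i\min}$ for all $i\in\mathcal Z$ and $\epsilon\in(0,\epsilon_0)$. For each $\epsilon\in(0,\epsilon_0)$, let $V_h,V_k,V_\ell$ be solutions of the Poisson equation for $$h(i)=\mu_{i\Sigma}-\lambda_i,\qquad k(i)=(\mu_{i\Sigma}-\lambda_i)V_h(i),\qquad \ell(i)=\mu_{i\Sigma}$$ ($h$, $k$, $V_h$, $V_k$ depend on $\epsilon$; $V_\ell$ does not), where the additive constant in $V_h$ is chosen so that $\mathbb E[V_h]$ stays bounded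 as $\epsilon$ varies. Suppose that $\mathbb E|V_h|^{1+\eta}<\infty$, $\mathbb E|V_k|^{1+\zeta}<\infty$ and $\mathbb E|V_\ell|^{1+\beta}<\infty$ for all $\epsilon\in(0,\epsilon_0)$, for some constants $\eta,\zeta,\beta>0$. Then for every $\epsilon\in(0,\epsilon_0)$ the chain $(Z(t),\boldsymbol q(t))$ has a stationary distribution; let $\widetilde{\boldsymbol q}$ denote the queue lengths under it. The limit $k^*=\lim_{\epsilon\downarrow0}\mathbb E[k(i)]$ exists, $1+k^*/\mu_\Sigma>0$, and for all $j\in\{1,\dots,n\}$ and all $s>0$, as $\epsilon\downarrow0$, $$\mathbb E\big[e^{-s\epsilon\widetilde q_j}\big]=\frac1{1+\frac sn\big(1+\frac{k^*}{\mu_\Sigma}\big)}+O\Big(\epsilon^{1-\frac1{1+\min\{1,\eta\}}}\Big),$$ where the implied constant may depend on everything except $\epsilon$. Moreover, with $\Upsilon$ exponentially distributed with mean $\frac1n\big(1+\frac{k^*}{\mu_\Sigma}\big)$, each $\epsilon\widetilde q_j$ converges in distribution to $\Upsilon$, and $\epsilon\widetilde{\boldsymbol q}$ converges in distribution to $\Upsilon\boldsymbol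 1$. -/

import Mathlib

open MeasureTheory ProbabilityTheory Filter Set
open scoped Topology

namespace MMJSQ

/-! ### Continuous-time Markov chains on a countable state space, through their rates -/

section CTMC

variable {S : Type*}

/-- The total rate at which a chain with transition rates `G` leaves state `x`. Only off-diagonal
entries of `G` are used. -/
noncomputable def exitRate (G : S → S → ℝ) (x : S) : ℝ :=
  ∑' y : {y : S // y ≠ x}, G x y

/-- `G` is a (conservative) transition rate matrix. -/
structure IsRateMatrix (G : S → S → ℝ) : Prop where
  nonneg : ∀ x y, x ≠ y → 0 ≤ G x y
  summable : ∀ x, Summable fun y : {y : S // y ≠ x} => G x y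
  diag : ∀ x, G x x = -exitRate G x

/-- Irreducibility: every state can be reached from every state by jumps of positive rate. -/
def IsIrreducible (G : S → S → ℝ) : Prop :=
  ∀ x y, Relation.ReflTransGen (fun a b => a ≠ b ∧ 0 < G a b) x y

/-- `ν` is a stationary distribution of the chain with transition rates `G`: it solves the global
balance equations, flow into `x` = flow out of `x`. (For rates with bounded exit rates these are
exactly the invariant laws of the chain.) -/
def IsStationary [MeasurableSpace S] (G : S → S → ℝ) (ν : Measure S) : Prop :=
  ∀ x, HasSum (fun y : {y : S // y ≠ x} => ν.real {(y : S)} * G y x) (ν.real {x} * exitRate G x)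

/-- `V` solves the Poisson equation for `f` with respect to the rate matrix `Q` and its stationary
distribution `p`: `V i = (f i - E f) / a i + ∑_{i' ≠ i} (Q i i' / a i) V i'`, where `a i` is the
exit rate of `i`. It is multiplied by `a i`, so that it makes sense for a one-state chain too. -/
structure IsPoissonSolution [MeasurableSpace S] (Q : S → S → ℝ) (p : Measure S)
    (f V : S → ℝ) : Prop where
  integrable : Integrable f p
  summable : ∀ i, Summable fun i' : {i' : S // i' ≠ i} => Q i i' * V i'
  eqn : ∀ i, exitRate Q i * V i
    = (f i - ∫ i', f i' ∂p) + ∑' i' : {i' : S // i' ≠ i}, Q i i' * V i'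

end CTMC

/-! ### The Markov-modulated JSQ system

`Z` is the state space of the modulating chain, `Q` its rate matrix, `lam i` the arrival rate and
`mu i j` the service rate of server `j` in modulating state `i`. A state of the system is a pair
`(i, q)` of a modulating state and a vector of queue lengths. -/

section JSQ

variable {Z : Type*} {n : ℕ}

/-- The servers with a shortest queue. -/
def shortest (q : Fin n → ℕ) : Finset (Fin n) :=
  Finset.univ.filter fun j => ∀ l, q j ≤ q l

open Classical in
/-- The transition rates of the JSQ system from `x = (i, q)` to `y = (i', q')` (for `x ≠ y`; the
diagonal is never used):
* the modulating chain moves, `q' = q`, at rate `Q i i'`;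
* an arrival joins a shortest queue `j`, `q' = q + e_j`; the total rate `lam i` is split
  uniformly among the shortest queues (ties are broken uniformly at random);
* server `j` completes a job, `q = q' + e_j` (so that `q_j > 0`), at rate `mu i j`. -/
noncomputable def jsqRate (Q : Z → Z → ℝ) (lam : Z → ℝ) (mu : Z → Fin n → ℝ)
    (x y : Z × (Fin n → ℕ)) : ℝ :=
  (if y.2 = x.2 then Q x.1 y.1 else 0)
  + (if y.1 = x.1 then
      (∑ j ∈ shortest x.2,
        if y.2 = x.2 + Pi.single j 1 then lam x.1 / ((shortest x.2).card : ℝ) else 0)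
      + ∑ j, (if x.2 = y.2 + Pi.single j 1 then mu x.1 j else 0)
    else 0)

/-- Total service rate `μ_{iΣ}` in modulating state `i`. -/
noncomputable def muTot (mu : Z → Fin n → ℝ) (i : Z) : ℝ := ∑ j, mu i j

/-- Smallest service rate `μ_{i,min}` in modulating state `i`. -/
noncomputable def muMin (mu : Z → Fin n → ℝ) (i : Z) : ℝ := ⨅ j, mu i j

/-- Long-run average total service rate `μ_Σ = ∑_j E[μ_{ij}]`. -/
noncomputable def muSigma [MeasurableSpace Z] (p : Measure Z) (mu : Z → Fin n → ℝ) : ℝ :=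
  ∑ j, ∫ i, mu i j ∂p

/-- Mean load `ρ = λ / μ_Σ`, where `λ = E[λ_i]`. -/
noncomputable def load [MeasurableSpace Z] (p : Measure Z) (lam : Z → ℝ)
    (mu : Z → Fin n → ℝ) : ℝ :=
  (∫ i, lam i ∂p) / muSigma p mu

/-- The SSC load condition. -/
def SSCLoad (lam : Z → ℝ) (mu : Z → Fin n → ℝ) : Prop :=
  ∀ i, muTot mu i - n * muMin mu i < lam i

/-- The standing model: an ergodic modulating chain with rate matrix `Q`, bounded exit rates and
stationary distribution `p`; bounded service rates `mu`; and, for `ε ∈ (0, ε₀)`, bounded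
arrival rates `lam ε`, affine in `ε`, for which the load is `1 - ε`. `Q` and `mu` do not depend
on `ε`. -/
structure IsHeavyTrafficFamily [MeasurableSpace Z] (Q : Z → Z → ℝ) (p : Measure Z)
    (mu : Z → Fin n → ℝ) (ε₀ : ℝ) (lam : ℝ → Z → ℝ) : Prop where
  rateMatrix : IsRateMatrix Q
  exit_bdd : ∃ C, ∀ i, exitRate Q i ≤ C
  irreducible : IsIrreducible Q
  stationary : IsStationary Q p
  mu_nonneg : ∀ i j, 0 ≤ mu i j
  mu_bdd : ∃ muMax, ∀ i j, mu i j < muMax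
  lam_nonneg : ∀ ε ∈ Ioo 0 ε₀, ∀ i, 0 ≤ lam ε i
  lam_bdd : ∃ lamMax, ∀ ε ∈ Ioo 0 ε₀, ∀ i, lam ε i < lamMax
  lam_affine : ∃ c d : Z → ℝ, ∀ ε ∈ Ioo 0 ε₀, ∀ i, lam ε i = c i + d i * ε
  load_eq : ∀ ε ∈ Ioo 0 ε₀, 1 - load p (lam ε) mu = ε

end JSQ

/-- The exponential distribution with mean `m`. -/
noncomputable def expLaw (m : ℝ) (hm : 0 < m) : ProbabilityMeasure ℝ :=
  ⟨expMeasure m⁻¹, isProbabilityMeasure_expMeasure (inv_pos.mpr hm)⟩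

end MMJSQ

set_option linter.unusedSectionVars false

/-! The engine is one identity: under a stationary law the generator of an integrable function has
mean zero (`IsStationary.integral_gen`). Test functions of the form (function of the modulating
state) × (function of the queues) turn it into moment bounds and then into Laplace transforms. No
sample paths occur; only balance equations are used.

Heart of the proof (`abs_laplace_sub_le`, `heavy_traffic_algebra`). Let w = exp(-θ Σq) with θ = sε,
W = E[w], h = μ_Σ - λ in the current modulating state, m the mean total service rate, and u the
capacity of the idle servers. Testing with w gives E[wh] + (1 - e^{-θ}) E[wλ] = E[wu]. Here E[u] =
εm, and u ≠ 0 forces an empty queue, so that Σq is then at most n times the distance of q from the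
diagonal; hence E[wu] = εm up to θ E[u·n·`perp`]. Testing with w V_h gives E[wh] = εmW + (e^θ -
1)(E[w h V_h] + smaller terms). Testing with w V_k and with w V_ℓ replaces E[w h V_h] by kW, with k
= E[h V_h], and E[wμ] by mW. Dividing by εm leaves W(1 + s(1 + k/m)) ≈ 1. The dominant errors,
E[u|V_h|] and E[u·n·`perp`], pair a bounded variable of mean εm with one having a moment of order 1
+ a, a = min(1, η); `integral_mul_le_rpow` makes them O(ε^{1 - 1/(1+a)}).

State space collapse (`integral_perp_rpow_le`). The squared distance from the diagonal drifts down
at a rate proportional to the SSC margin. This margin is positive in every modulating state but may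
have infimum zero. The remedy is a corrector H on the modulating space: subtracting the mean-zero
generator of H(i)g(q) replaces the margin by margin + QH. With H a multiple of the difference of two
solutions V_h, this sum is bounded below by a positive constant, uniformly in ε.

Uniformity in ε (`TwoPointData`). The hypotheses give moments for each ε separately. As λ is affine
in ε and the Poisson equation is linear, solutions at e and 2e yield solutions for every smaller ε,
and for ε = 0, with weights t and 1 - t, t = 2 - ε/e in [1, 2]. The product h V_h is quadratic in t;
its cross term is recovered by polarization from the solution at 3e/2 (`exists_pair_polarized`). The
limit k* is the value at t = 2, where h has mean zero; it is an asymptotic variance and so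
nonnegative (`PoissonPair.integral_mul_nonneg`).

Existence (`exists_isStationary_jsqRate`). Time averages of the uniformized chain, started empty
with modulating law `p`, are almost stationary. The drift of Σq keeps E[u] above the mean slack,
while a drift bound for the imbalance shows that much of u is carried by a fixed finite set of
states. Hence a limit point keeps positive mass and can be normalized.

Convergence in distribution follows from a continuity theorem for Laplace transforms on the
half-line (`tendsto_of_tendsto_integral_exp`), and joint convergence from collapse. -/

namespace MMJSQ

/-! ### Balance equations and generators with bounded rates -/

section Generator

variable {S : Type*}

open Classical in
/-- The rates with the diagonal replaced by zero. -/
noncomputable def offDiag (G : S → S → ℝ) (x y : S) : ℝ := if y = x then 0 else G x y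

/-- The generator of the chain with rates `G`. The diagonal of `G` plays no role. -/
noncomputable def gen (G : S → S → ℝ) (f : S → ℝ) (x : S) : ℝ := ∑' y, G x y * (f y - f x)

/-- Nonnegative off-diagonal rates with exit rates bounded by `C`. -/
structure BoundedRates (G : S → S → ℝ) (C : ℝ) : Prop where
  nonneg : ∀ x y, x ≠ y → 0 ≤ G x y
  summable : ∀ x, Summable fun y : {y : S // y ≠ x} => G x y
  exit_le : ∀ x, exitRate G x ≤ C

/-- The model sums over the subtype `y ≠ x`. Zeroing the diagonal turns these into sums over all of
`S`, where Fubini and `tsum` algebra apply directly. -/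
lemma hasSum_ne_iff (x : S) (f g : S → ℝ) (a : ℝ) (hx : g x = 0) (h : ∀ y, y ≠ x → g y = f y) :
    HasSum (fun y : {y : S // y ≠ x} => f y) a ↔ HasSum g a := by
  have h1 : HasSum (fun y : {y : S // y ≠ x} => f y) a ↔
      HasSum (fun y : ({y : S | y ≠ x} : Set S) => g y) a := by
    have : (fun y : {y : S // y ≠ x} => f y) = fun y : {y : S // y ≠ x} => g y := by
      funext y; exact (h y y.2).symm
    rw [this]; rfl
  rw [h1]
  refine hasSum_subtype_iff_of_support_subset (f := g) (s := {y : S | y ≠ x}) ?_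
  intro y hy
  simp only [Function.mem_support] at hy
  intro hyx
  exact hy (hyx ▸ hx)

lemma offDiag_self (G : S → S → ℝ) (x : S) : offDiag G x x = 0 := by simp [offDiag]

lemma offDiag_of_ne (G : S → S → ℝ) {x y : S} (h : y ≠ x) : offDiag G x y = G x y := by
  simp [offDiag, h]

lemma offDiag_mul_sub (G : S → S → ℝ) (f : S → ℝ) (x y : S) :
    offDiag G x y * (f y - f x) = G x y * (f y - f x) := by
  by_cases h : y = x
  · subst h; simp
  · rw [offDiag_of_ne G h]

variable {G : S → S → ℝ} {C : ℝ}

lemma BoundedRates.offDiag_nonneg (hG : BoundedRates G C) (x y : S) : 0 ≤ offDiag G x y := by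
  by_cases h : y = x
  · subst h; rw [offDiag_self]
  · rw [offDiag_of_ne G h]; exact hG.nonneg x y (Ne.symm h)

lemma BoundedRates.hasSum_offDiag (hG : BoundedRates G C) (x : S) :
    HasSum (offDiag G x) (exitRate G x) :=
  (hasSum_ne_iff x (G x) _ _ (offDiag_self G x) fun _ h => offDiag_of_ne G h).1
    (hG.summable x).hasSum

lemma BoundedRates.exitRate_nonneg (hG : BoundedRates G C) (x : S) : 0 ≤ exitRate G x :=
  (hG.hasSum_offDiag x).nonneg fun y => hG.offDiag_nonneg x y

/-- `a` solves the balance equations for the rates `G`. -/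
def Balance (G : S → S → ℝ) (a : S → ℝ) : Prop :=
  ∀ y, HasSum (fun x => a x * offDiag G x y) (a y * exitRate G y)

/-- Working with functions instead of measures admits signed solutions, which the uniqueness
argument needs. -/
lemma isStationary_iff_balance [MeasurableSpace S] (G : S → S → ℝ) (ν : Measure S) :
    IsStationary G ν ↔ Balance G fun x => ν.real {x} :=
  forall_congr' fun y => hasSum_ne_iff y (fun x => ν.real {x} * G x y) _ _
    (by simp [offDiag_self]) fun x h => by rw [offDiag_of_ne G (Ne.symm h)]

lemma summable_gen (hG : BoundedRates G C) {f : S → ℝ} {x : S}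
    (hs : Summable fun y => offDiag G x y * f y) :
    Summable fun y => offDiag G x y * (f y - f x) := by
  simpa only [mul_sub] using hs.sub ((hG.hasSum_offDiag x).summable.mul_right (f x))

lemma gen_eq_offDiag (G : S → S → ℝ) (f : S → ℝ) (x : S) :
    gen G f x = ∑' y, offDiag G x y * (f y - f x) :=
  tsum_congr fun y => (offDiag_mul_sub G f x y).symm

lemma gen_indicator (hG : BoundedRates G C) (z x : S) :
    gen G (({z} : Set S).indicator 1) x
      = offDiag G x z - ({z} : Set S).indicator (exitRate G) x := by
  classical
  rw [gen_eq_offDiag]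
  simp_rw [mul_sub]
  have h1 : HasSum (fun y => offDiag G x y * ({z} : Set S).indicator 1 y) (offDiag G x z) := by
    have h := hasSum_single (f := fun y => offDiag G x y * ({z} : Set S).indicator 1 y) z
      fun y hy => by simp [hy]
    simpa using h
  rw [(h1.sub ((hG.hasSum_offDiag x).mul_right _)).tsum_eq]
  by_cases hx : x = z
  · subst hx; simp
  · simp [hx]

/-- Jensen's inequality for the generator, in terms of a subgradient `T` of `Ξ`. -/
lemma subgradient_mul_gen_le (hG : BoundedRates G C) {V : S → ℝ} {x : S}
    (hs : Summable fun y => offDiag G x y * V y) {Ξ T : ℝ → ℝ} {L : ℝ}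
    (hL : ∀ a b, |Ξ b - Ξ a| ≤ L * |b - a|) (hc : ∀ a b, T a * (b - a) ≤ Ξ b - Ξ a) :
    T (V x) * gen G V x ≤ gen G (fun y => Ξ (V y)) x := by
  have h1 := summable_gen hG hs
  have h2 : Summable fun y => offDiag G x y * (Ξ (V y) - Ξ (V x)) := by
    refine Summable.of_norm_bounded (g := fun y => L * |offDiag G x y * (V y - V x)|)
      (h1.abs.mul_left L) fun y => ?_
    rw [Real.norm_eq_abs, abs_mul, abs_mul, abs_of_nonneg (hG.offDiag_nonneg x y)]
    nlinarith [hL (V x) (V y), hG.offDiag_nonneg x y]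
  rw [gen_eq_offDiag, gen_eq_offDiag, ← tsum_mul_left]
  refine (h1.mul_left _).tsum_le_tsum (fun y => ?_) h2
  nlinarith [hc (V x) (V y), hG.offDiag_nonneg x y]

lemma BoundedRates.summable_mul (hG : BoundedRates G C) {f : S → ℝ} {B : ℝ}
    (hf : ∀ x, |f x| ≤ B) (x : S) : Summable fun y => offDiag G x y * f y := by
  refine Summable.of_norm_bounded ((hG.hasSum_offDiag x).summable.mul_right B) fun y => ?_
  rw [Real.norm_eq_abs, abs_mul, abs_of_nonneg (hG.offDiag_nonneg x y)]
  exact mul_le_mul_of_nonneg_left (hf y) (hG.offDiag_nonneg x y)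

lemma BoundedRates.abs_gen_le (hG : BoundedRates G C) {f : S → ℝ} {B : ℝ}
    (hf : ∀ x, |f x| ≤ B) (x : S) : |gen G f x| ≤ C * (2 * B) := by
  have hB : 0 ≤ B := (abs_nonneg _).trans (hf x)
  rw [gen_eq_offDiag]
  have h := tsum_of_norm_bounded (f := fun y => offDiag G x y * (f y - f x))
    ((hG.hasSum_offDiag x).mul_right (2 * B)) fun y => by
      rw [Real.norm_eq_abs, abs_mul, abs_of_nonneg (hG.offDiag_nonneg x y)]
      refine mul_le_mul_of_nonneg_left ?_ (hG.offDiag_nonneg x y)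
      have := abs_sub (f y) (f x)
      linarith [hf x, hf y]
  exact (Real.norm_eq_abs _ ▸ h).trans (mul_le_mul_of_nonneg_right (hG.exit_le x) (by positivity))

lemma BoundedRates.summable_flow (hG : BoundedRates G C) {a : S → ℝ} (ha0 : ∀ x, 0 ≤ a x)
    (has : Summable a) : Summable (fun q : S × S => a q.1 * offDiag G q.1 q.2) := by
  have row : ∀ x, HasSum (fun y => a x * offDiag G x y) (a x * exitRate G x) :=
    fun x => (hG.hasSum_offDiag x).mul_left _
  have hse : Summable fun x => a x * exitRate G x :=
    Summable.of_nonneg_of_le (fun x => mul_nonneg (ha0 x) (hG.exitRate_nonneg x))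
      (fun x => mul_le_mul_of_nonneg_left (hG.exit_le x) (ha0 x)) (has.mul_right C)
  rw [summable_prod_of_nonneg fun q => mul_nonneg (ha0 _) (hG.offDiag_nonneg _ _)]
  exact ⟨fun y => (row y).summable, hse.congr fun y => (row y).tsum_eq.symm⟩

/-- Incoming and outgoing flows agree when weighted by a function. -/
lemma Balance.flow (hG : BoundedRates G C) {a : S → ℝ} (ha0 : ∀ x, 0 ≤ a x)
    (hb : Balance G a) {f : S → ℝ} (hf : Summable fun x => a x * |f x|) :
    Summable (fun q : S × S => a q.1 * offDiag G q.1 q.2 * f q.2) ∧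
    Summable (fun q : S × S => a q.1 * offDiag G q.1 q.2 * f q.1) ∧
    ∑' q : S × S, a q.1 * offDiag G q.1 q.2 * f q.2
      = ∑' q : S × S, a q.1 * offDiag G q.1 q.2 * f q.1 := by
  have hC : ∀ x, a x * exitRate G x * |f x| ≤ C * (a x * |f x|) := fun x => by
    have := mul_le_mul_of_nonneg_right (hG.exit_le x) (mul_nonneg (ha0 x) (abs_nonneg (f x)))
    linarith
  have hs : Summable fun x => a x * exitRate G x * |f x| :=
    Summable.of_nonneg_of_le
      (fun x => mul_nonneg (mul_nonneg (ha0 x) (hG.exitRate_nonneg x)) (abs_nonneg _)) hC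
      (hf.mul_left C)
  have row : ∀ x, HasSum (fun y => a x * offDiag G x y * f x) (a x * exitRate G x * f x) :=
    fun x => ((hG.hasSum_offDiag x).mul_left (a x)).mul_right (f x)
  have col : ∀ y, HasSum (fun x => a x * offDiag G x y * f y) (a y * exitRate G y * f y) :=
    fun y => (hb y).mul_right (f y)
  have rowabs : ∀ x, HasSum (fun y => a x * offDiag G x y * |f x|) (a x * exitRate G x * |f x|) :=
    fun x => ((hG.hasSum_offDiag x).mul_left (a x)).mul_right _
  have colabs : ∀ y, HasSum (fun x => a x * offDiag G x y * |f y|) (a y * exitRate G y * |f y|) :=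
    fun y => (hb y).mul_right _
  have hn : ∀ x y, 0 ≤ a x * offDiag G x y := fun x y => mul_nonneg (ha0 x) (hG.offDiag_nonneg x y)
  have habs : ∀ x y z, ‖a x * offDiag G x y * f z‖ = a x * offDiag G x y * |f z| := fun x y z => by
    rw [Real.norm_eq_abs, abs_mul, abs_of_nonneg (hn x y)]
  -- Balance evaluates the absolute column sums and the definition of the exit rate the row sums;
  -- both give `hs`. Fubini then compares the two orders of summation.
  have s1 : Summable (fun q : S × S => a q.2 * offDiag G q.2 q.1 * f q.1) := by
    apply Summable.of_norm
    simp_rw [habs]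
    rw [summable_prod_of_nonneg fun q => mul_nonneg (hn _ _) (abs_nonneg _)]
    exact ⟨fun y => (colabs y).summable, hs.congr fun y => (colabs y).tsum_eq.symm⟩
  have s2 : Summable (fun q : S × S => a q.1 * offDiag G q.1 q.2 * f q.1) := by
    apply Summable.of_norm
    simp_rw [habs]
    rw [summable_prod_of_nonneg fun q => mul_nonneg (hn _ _) (abs_nonneg _)]
    exact ⟨fun y => (rowabs y).summable, hs.congr fun y => (rowabs y).tsum_eq.symm⟩
  have s1' : Summable (fun q : S × S => a q.1 * offDiag G q.1 q.2 * f q.2) :=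
    (Equiv.prodComm S S).summable_iff.1 s1
  refine ⟨s1', s2, ?_⟩
  rw [← (Equiv.prodComm S S).tsum_eq (fun q : S × S => a q.1 * offDiag G q.1 q.2 * f q.2),
    s2.tsum_prod]
  have : ∑' q : S × S, (fun q : S × S => a q.1 * offDiag G q.1 q.2 * f q.2) (Equiv.prodComm S S q)
      = ∑' q : S × S, a q.2 * offDiag G q.2 q.1 * f q.1 := rfl
  rw [this, s1.tsum_prod]
  exact tsum_congr fun x => by rw [(row x).tsum_eq, (col x).tsum_eq]

/-- Weighted inflow minus weighted outflow. Both are absolutely summable by `Balance.flow`, so `f`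
may be unbounded as long as it is integrable. -/
lemma Balance.tsum_gen (hG : BoundedRates G C) {a : S → ℝ} (ha0 : ∀ x, 0 ≤ a x)
    (hb : Balance G a) {f : S → ℝ} (hf : Summable fun x => a x * |f x|) :
    Summable (fun x => a x * gen G f x) ∧ ∑' x, a x * gen G f x = 0 := by
  obtain ⟨h1, h2, h3⟩ := hb.flow hG ha0 hf
  have h4 := h1.sub h2
  have h5 : ∀ x, ∑' y, (a x * offDiag G x y * f y - a x * offDiag G x y * f x)
      = a x * gen G f x := fun x => by
    rw [gen, ← tsum_mul_left]
    refine tsum_congr fun y => ?_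
    rw [← offDiag_mul_sub]; ring
  refine ⟨(h4.prod).congr fun x => (h5 x), ?_⟩
  rw [← tsum_congr h5, ← h4.tsum_prod, h1.tsum_sub h2, h3, sub_self]

/-- Balance solutions that are nonnegative are positive everywhere or vanish everywhere. -/
lemma Balance.pos_of_irreducible (hG : BoundedRates G C) (hirr : IsIrreducible G) {a : S → ℝ}
    (ha0 : ∀ x, 0 ≤ a x) (hb : Balance G a) {x : S} (hx : 0 < a x) (y : S) : 0 < a y := by
  induction hirr x y with
  | refl => exact hx
  | @tail u v _ huv ih =>
    -- A vanishing outflow at `v` forces every inflow term to vanish, but the edge from `u` carries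
    -- positive flow.
    by_contra hv
    have hv0 : a v = 0 := le_antisymm (not_lt.1 hv) (ha0 v)
    have h := hb v
    rw [hv0, zero_mul] at h
    have := (hasSum_zero_iff_of_nonneg
      (fun z => mul_nonneg (ha0 z) (hG.offDiag_nonneg z v))).1 h
    have h2 := congrFun this u
    rw [offDiag_of_ne G huv.1.symm] at h2
    have := mul_pos ih huv.2
    simp at h2
    rcases h2 with h2 | h2
    · exact ih.ne' h2
    · exact huv.2.ne' h2

/-- The positive part of a signed summable balance solution is a balance solution. -/
lemma Balance.abs (hG : BoundedRates G C) {a : S → ℝ} (hs : Summable a) (hb : Balance G a) :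
    Balance G fun x => |a x| := by
  have hsa : Summable fun x => |a x| := hs.abs
  have hn := hG.offDiag_nonneg
  have row : ∀ x, HasSum (fun y => |a x| * offDiag G x y) (|a x| * exitRate G x) :=
    fun x => (hG.hasSum_offDiag x).mul_left _
  have hse : Summable fun x => |a x| * exitRate G x :=
    Summable.of_nonneg_of_le (fun x => mul_nonneg (abs_nonneg _) (hG.exitRate_nonneg x))
      (fun x => mul_le_mul_of_nonneg_left (hG.exit_le x) (abs_nonneg _)) (hsa.mul_right C)
  have s2 : Summable (fun q : S × S => |a q.1| * offDiag G q.1 q.2) :=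
    hG.summable_flow (fun _ => abs_nonneg _) hsa
  have s1 : Summable (fun q : S × S => |a q.2| * offDiag G q.2 q.1) :=
    (Equiv.prodComm S S).summable_iff.2 s2
  have hcol : ∀ y, Summable fun x => |a x| * offDiag G x y := fun y => s1.prod_factor y
  -- The triangle inequality holds at each state, while both sides have the same total by Fubini
  -- (`htot`). So no inequality can be strict.
  have hle : ∀ y, |a y| * exitRate G y ≤ ∑' x, |a x| * offDiag G x y := fun y => by
    rw [← abs_of_nonneg (hG.exitRate_nonneg y), ← abs_mul, ← (hb y).tsum_eq]
    have : Summable fun x => ‖a x * offDiag G x y‖ := by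
      refine (hcol y).congr fun x => ?_
      rw [Real.norm_eq_abs, abs_mul, abs_of_nonneg (hn x y)]
    refine (norm_tsum_le_tsum_norm this).trans (le_of_eq (tsum_congr fun x => ?_))
    rw [Real.norm_eq_abs, abs_mul, abs_of_nonneg (hn x y)]
  have htot : ∑' y, ∑' x, |a x| * offDiag G x y = ∑' y, |a y| * exitRate G y := by
    rw [← tsum_congr fun x => (row x).tsum_eq, ← s2.tsum_prod,
      ← (Equiv.prodComm S S).tsum_eq (fun q : S × S => |a q.1| * offDiag G q.1 q.2)]
    exact (s1.tsum_prod).symm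
  intro y
  have heq : |a y| * exitRate G y = ∑' x, |a x| * offDiag G x y := by
    by_contra hne
    have hlt := lt_of_le_of_ne (hle y) hne
    have := Summable.tsum_lt_tsum hle hlt hse s1.prod
    exact absurd htot this.ne'
  rw [heq]
  exact (hcol y).hasSum

/-- Uniqueness of the solution of the balance equations for irreducible rates. -/
lemma Balance.unique (hG : BoundedRates G C) (hirr : IsIrreducible G) {a b : S → ℝ}
    (ha : Summable a) (hb : Summable b) (hab : ∑' x, a x = ∑' x, b x)
    (hA : Balance G a) (hB : Balance G b) : a = b := by
  have hs : Summable fun x => a x - b x := ha.sub hb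
  have hbal : Balance G fun x => a x - b x := fun y => by
    simpa only [sub_mul] using (hA y).sub (hB y)
  have habs := hbal.abs hG hs
  have hsum0 : ∑' x, (a x - b x) = 0 := by rw [ha.tsum_sub hb, hab, sub_self]
  -- Twice the positive part of `c` is a nonnegative balance solution: positive at one state, it is
  -- positive everywhere. Then `c > 0` everywhere, against its zero sum.
  have key : ∀ c : S → ℝ, Summable c → ∑' x, c x = 0 → Balance G (fun x => |c x| + c x) →
      ∀ x, c x ≤ 0 := by
    intro c hc hc0 hbc x
    by_contra! hx
    have hpos := hbc.pos_of_irreducible hG hirr (fun x => by linarith [neg_abs_le (c x)])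
      (x := x) (by positivity)
    have hcpos : ∀ y, 0 < c y := fun y => by
      have := hpos y
      by_contra! h
      rw [abs_of_nonpos h] at this
      linarith
    have := hc.tsum_pos (fun y => (hcpos y).le) x (hcpos x)
    exact this.ne' hc0
  have h1 := key _ hs hsum0 fun y => by simpa only [add_mul] using (habs y).add (hbal y)
  have h2 := key (fun x => -(a x - b x)) hs.neg (by rw [tsum_neg, hsum0, neg_zero]) fun y => by
    simpa only [abs_neg, ← sub_eq_add_neg, sub_mul _ (a _ - b _)] using (habs y).sub (hbal y)
  funext x
  have := h1 x
  have := h2 x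
  linarith

end Generator

/-! ### Stationary laws as functionals that annihilate the generator -/

section StationaryIntegral

variable {S : Type*} [Countable S] [MeasurableSpace S] [MeasurableSingletonClass S]
  {G : S → S → ℝ} {C : ℝ}

lemma integrable_iff_summable_norm {ν : Measure S} [IsFiniteMeasure ν] {f : S → ℝ} :
    Integrable f ν ↔ Summable fun x => ν.real {x} * |f x| := by
  have := integrable_sum_dirac_iff (f := f) (x := fun x : S => x) (c := fun x => ν {x})
    fun x => measure_ne_top ν {x}
  rwa [Measure.sum_smul_dirac ν] at this

lemma integrable_iff_summable {ν : Measure S} [IsFiniteMeasure ν] {f : S → ℝ} :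
    Integrable f ν ↔ Summable fun x => ν.real {x} * f x := by
  rw [integrable_iff_summable_norm, ← summable_abs_iff (f := fun x => ν.real {x} * f x)]
  refine summable_congr fun x => ?_
  rw [abs_mul, abs_of_nonneg measureReal_nonneg]

lemma integral_eq_tsum_real {ν : Measure S} [IsFiniteMeasure ν] {f : S → ℝ}
    (hf : Integrable f ν) : ∫ x, f x ∂ν = ∑' x, ν.real {x} * f x := by
  rw [integral_countable hf]; simp

lemma summable_real_singleton (ν : Measure S) [IsFiniteMeasure ν] :
    Summable fun x => ν.real {x} := by
  simpa using integrable_iff_summable.1 (integrable_const (μ := ν) (1 : ℝ))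

/-- The generator of an integrable function has mean zero under a stationary distribution. -/
lemma IsStationary.integral_gen {ν : Measure S} [IsFiniteMeasure ν] (hG : BoundedRates G C)
    (hν : IsStationary G ν) {f : S → ℝ} (hf : Integrable f ν) :
    Integrable (gen G f) ν ∧ ∫ x, gen G f x ∂ν = 0 := by
  obtain ⟨h1, h2⟩ := ((isStationary_iff_balance G ν).1 hν).tsum_gen hG
    (fun _ => measureReal_nonneg) (integrable_iff_summable_norm.1 hf)
  have hi : Integrable (gen G f) ν := integrable_iff_summable.2 h1
  exact ⟨hi, by rw [integral_eq_tsum_real hi, h2]⟩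

lemma IsStationary.pos (hG : BoundedRates G C) (hirr : IsIrreducible G) {ν : Measure S}
    [IsProbabilityMeasure ν] (hν : IsStationary G ν) (x : S) : 0 < ν.real {x} := by
  have hsum : ∑' x, ν.real {x} = 1 := by
    simpa using (integral_eq_tsum_real (integrable_const (μ := ν) (1 : ℝ))).symm
  obtain ⟨y, hy⟩ : ∃ y, 0 < ν.real {y} := by
    by_contra! h
    have : ∀ y, ν.real {y} = 0 := fun y => le_antisymm (h y) measureReal_nonneg
    simp [this] at hsum
  exact ((isStationary_iff_balance G ν).1 hν).pos_of_irreducible hG hirr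
    (fun _ => measureReal_nonneg) hy x

/-- Integrable harmonic functions of an irreducible positive recurrent chain are constant. -/
lemma eq_of_gen_eq_zero (hG : BoundedRates G C) (hirr : IsIrreducible G) {ν : Measure S}
    [IsProbabilityMeasure ν] (hν : IsStationary G ν) {H : S → ℝ} (hH : Integrable H ν)
    (hs : ∀ x, Summable fun y => offDiag G x y * H y) (h0 : ∀ x, gen G H x = 0) (x y : S) :
    H y = H x := by
  -- By Jensen, `|H - H x|` has nonnegative generator. Its mean is zero and every state is charged,
  -- so it vanishes identically. Hence `H` cannot change along an edge leaving a state where it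
  -- equals `H x`.
  have hint : Integrable (fun z => |H z - H x|) ν := (hH.sub (integrable_const (H x))).abs
  obtain ⟨hg, hg0⟩ := hν.integral_gen hG hint
  have hL : ∀ a b, |(|b - H x|) - (|a - H x|)| ≤ 1 * |b - a| := fun a b => by
    simpa using abs_abs_sub_abs_le_abs_sub (b - H x) (a - H x)
  have hnn : ∀ z, 0 ≤ gen G (fun z => |H z - H x|) z := fun z => by
    have := subgradient_mul_gen_le hG (hs z) (Ξ := fun b => |b - H x|)
      (T := fun a => if H x ≤ a then 1 else -1) hL fun a b => by
        split_ifs with h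
        · rw [abs_of_nonneg (sub_nonneg.2 h)]; linarith [le_abs_self (b - H x)]
        · rw [abs_of_neg (sub_neg.2 (not_le.1 h))]; linarith [neg_abs_le (b - H x)]
    rwa [h0, mul_zero] at this
  have hz : ∀ z, gen G (fun z => |H z - H x|) z = 0 := by
    intro z
    have h1 := integral_eq_tsum_real hg
    have h2 := integrable_iff_summable.1 hg
    rw [hg0] at h1
    have h3 := h2.hasSum
    rw [← h1, hasSum_zero_iff_of_nonneg fun z => mul_nonneg measureReal_nonneg (hnn z)] at h3
    exact (mul_eq_zero.1 (congrFun h3 z)).resolve_left (hν.pos hG hirr z).ne'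
  induction hirr x y with
  | refl => rfl
  | @tail u v _ huv ih =>
    have h1 := hz u
    rw [gen_eq_offDiag, ih, sub_self, abs_zero] at h1
    simp only [sub_zero] at h1
    have hsum : Summable fun y => offDiag G u y * |H y - H x| := by
      have := (summable_gen hG (hs u)).abs
      refine this.congr fun y => ?_
      rw [abs_mul, abs_of_nonneg (hG.offDiag_nonneg u y), ih]
    have h2 := hsum.hasSum
    rw [h1, hasSum_zero_iff_of_nonneg
      fun y => mul_nonneg (hG.offDiag_nonneg u y) (abs_nonneg _)] at h2
    have h3 := congrFun h2 v
    rw [offDiag_of_ne G huv.1.symm] at h3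
    have := (mul_eq_zero.1 h3).resolve_left huv.2.ne'
    exact sub_eq_zero.1 (abs_eq_zero.1 this)

lemma integral_gen_indicator (hG : BoundedRates G C) (ν : Measure S) [IsFiniteMeasure ν] (z : S) :
    Summable (fun x => ν.real {x} * offDiag G x z) ∧
    ∫ x, gen G (({z} : Set S).indicator 1) x ∂ν
      = ∑' x, ν.real {x} * offDiag G x z - ν.real {z} * exitRate G z := by
  have hle : ∀ x, offDiag G x z ≤ C := fun x =>
    (le_hasSum (hG.hasSum_offDiag x) z fun y _ => hG.offDiag_nonneg x y).trans (hG.exit_le x)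
  have h1 : Summable fun x => ν.real {x} * offDiag G x z :=
    Summable.of_nonneg_of_le (fun x => mul_nonneg measureReal_nonneg (hG.offDiag_nonneg x z))
      (fun x => mul_le_mul_of_nonneg_left (hle x) measureReal_nonneg)
      ((summable_real_singleton ν).mul_right C)
  have h2 : HasSum (fun x => ν.real {x} * ({z} : Set S).indicator (exitRate G) x)
      (ν.real {z} * exitRate G z) := by
    have h := hasSum_single (f := fun x => ν.real {x} * ({z} : Set S).indicator (exitRate G) x) z
      fun y hy => by simp [hy]
    simpa only [indicator_of_mem (mem_singleton z)] using h
  have h3 := h1.hasSum.sub h2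
  have h4 : (fun x => ν.real {x} * offDiag G x z
      - ν.real {x} * ({z} : Set S).indicator (exitRate G) x)
      = fun x => ν.real {x} * gen G (({z} : Set S).indicator 1) x := by
    funext x; rw [gen_indicator hG]; ring
  rw [h4] at h3
  exact ⟨h1, by rw [integral_eq_tsum_real (integrable_iff_summable.2 h3.summable), h3.tsum_eq]⟩

/-- A finite measure against which the generator kills indicators is stationary. -/
lemma isStationary_of_integral_gen_indicator (hG : BoundedRates G C) {ν : Measure S}
    [IsFiniteMeasure ν]
    (h : ∀ z, ∫ x, gen G (({z} : Set S).indicator 1) x ∂ν = 0) : IsStationary G ν := by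
  rw [isStationary_iff_balance]
  intro z
  obtain ⟨h1, h2⟩ := integral_gen_indicator hG ν z
  rw [h z] at h2
  rw [← sub_eq_zero.1 h2.symm]
  exact h1.hasSum

end StationaryIntegral

/-! ### Stationary laws as limits of averages of the uniformized chain -/

section Existence

variable {S : Type*} [Countable S] [MeasurableSpace S] [MeasurableSingletonClass S]
  {G : S → S → ℝ} {C : ℝ}

lemma exists_probabilityMeasure_of_hasSum {a : S → ℝ} (ha : ∀ x, 0 ≤ a x) (hs : HasSum a 1) :
    ∃ ν : ProbabilityMeasure S, ∀ x, (ν : Measure S).real {x} = a x := by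
  classical
  let ν : Measure S := Measure.sum fun x => ENNReal.ofReal (a x) • Measure.dirac x
  have hν : ∀ x, ν {x} = ENNReal.ofReal (a x) := fun x => by
    rw [Measure.sum_apply _ (measurableSet_singleton x), tsum_eq_single x]
    · simp
    · intro y hy
      simp [hy]
  have hp : IsProbabilityMeasure ν := ⟨by
    rw [Measure.sum_apply _ MeasurableSet.univ]
    simp only [Measure.smul_apply, measure_univ, smul_eq_mul, mul_one]
    rw [← ENNReal.ofReal_tsum_of_nonneg ha hs.summable, hs.tsum_eq, ENNReal.ofReal_one]⟩
  refine ⟨⟨ν, hp⟩, fun x => ?_⟩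
  change (ν {x}).toReal = _
  rw [hν, ENNReal.toReal_ofReal (ha x)]

lemma integrable_of_bounded {ν : Measure S} [IsFiniteMeasure ν] {f : S → ℝ} {B : ℝ}
    (hf : ∀ x, |f x| ≤ B) : Integrable f ν :=
  Integrable.of_bound (Measurable.of_discrete.aestronglyMeasurable) B (ae_of_all _ hf)

set_option maxHeartbeats 400000 in
/-- One step of the uniformized chain. -/
lemma exists_step (hG : BoundedRates G C) {Λ : ℝ} (hΛ : 0 < Λ) (hC : C ≤ Λ)
    (ν : ProbabilityMeasure S) :
    ∃ ν' : ProbabilityMeasure S, ∀ (f : S → ℝ) (B : ℝ), (∀ x, |f x| ≤ B) →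
      ∫ x, f x ∂(ν' : Measure S)
        = ∫ x, f x ∂(ν : Measure S) + Λ⁻¹ * ∫ x, gen G f x ∂(ν : Measure S) := by
  obtain ⟨a, ha⟩ : ∃ a : S → ℝ, ∀ x, a x = (ν : Measure S).real {x} := ⟨_, fun _ => rfl⟩
  have ha0 : ∀ x, 0 ≤ a x := fun x => ha x ▸ measureReal_nonneg
  have has : Summable a := (summable_real_singleton (ν : Measure S)).congr fun x => (ha x).symm
  have hint : ∀ {f : S → ℝ}, Integrable f (ν : Measure S) →
      HasSum (fun x => a x * f x) (∫ x, f x ∂(ν : Measure S)) := fun {f} hf => by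
    simp_rw [ha]
    rw [integral_eq_tsum_real hf]
    exact (integrable_iff_summable.1 hf).hasSum
  have hcol : ∀ (f : S → ℝ) (B : ℝ), (∀ x, |f x| ≤ B) →
      Summable (fun q : S × S => a q.1 * offDiag G q.1 q.2 * f q.2) := by
    intro f B hf
    have h1 := hG.summable_flow ha0 has
    refine Summable.of_norm_bounded (h1.mul_right B) fun q => ?_
    have h0 := mul_nonneg (ha0 q.1) (hG.offDiag_nonneg q.1 q.2)
    rw [Real.norm_eq_abs, abs_mul, abs_of_nonneg h0]
    exact mul_le_mul_of_nonneg_left (hf _) h0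
  -- The law after one step of the kernel I + Λ⁻¹G. It is nonnegative because `C ≤ Λ`, and `key`
  -- with `f = 1` shows that its mass is one.
  set b : S → ℝ := fun y => a y * (1 - Λ⁻¹ * exitRate G y) + Λ⁻¹ * ∑' x, a x * offDiag G x y
    with hb
  have key : ∀ (f : S → ℝ) (B : ℝ), (∀ x, |f x| ≤ B) →
      HasSum (fun y => b y * f y)
        (∫ x, f x ∂(ν : Measure S) + Λ⁻¹ * ∫ x, gen G f x ∂(ν : Measure S)) := by
    intro f B hf
    have hsw := hcol f B hf
    have hfi : Integrable f (ν : Measure S) := integrable_of_bounded hf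
    have hgi : Integrable (gen G f) (ν : Measure S) := integrable_of_bounded (hG.abs_gen_le hf)
    have hefi : Integrable (fun x => exitRate G x * f x) (ν : Measure S) :=
      integrable_of_bounded (B := C * B) fun x => by
        rw [abs_mul, abs_of_nonneg (hG.exitRate_nonneg x)]
        exact mul_le_mul (hG.exit_le x) (hf x) (abs_nonneg _)
          ((hG.exitRate_nonneg x).trans (hG.exit_le x))
    have hsw' : Summable (fun q : S × S => a q.2 * offDiag G q.2 q.1 * f q.1) :=
      (Equiv.prodComm S S).summable_iff.2 hsw
    have e1 : ∑' y, ∑' x, a x * offDiag G x y * f y = ∑' x, ∑' y, a x * offDiag G x y * f y := by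
      rw [← hsw.tsum_prod, ← (Equiv.prodComm S S).tsum_eq
        (fun q : S × S => a q.1 * offDiag G q.1 q.2 * f q.2)]
      exact (hsw'.tsum_prod).symm
    have e2 : HasSum (fun x => ∑' y, a x * offDiag G x y * f y)
        (∫ x, (gen G f x + exitRate G x * f x) ∂(ν : Measure S)) := by
      have : (fun x => ∑' y, a x * offDiag G x y * f y)
          = fun x => a x * (gen G f x + exitRate G x * f x) := by
        funext x
        rw [gen_eq_offDiag, ← (hG.hasSum_offDiag x).tsum_eq, ← tsum_mul_right,
          ← (summable_gen hG (hG.summable_mul hf x)).tsum_add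
            ((hG.hasSum_offDiag x).summable.mul_right _), ← tsum_mul_left]
        exact tsum_congr fun y => by ring
      rw [this]
      exact hint (hgi.add hefi)
    have e3 : HasSum (fun y => ∑' x, a x * offDiag G x y * f y)
        (∫ x, (gen G f x + exitRate G x * f x) ∂(ν : Measure S)) := by
      rw [← e2.tsum_eq, ← e1]; exact hsw'.prod.hasSum
    have e4 : HasSum (fun y => a y * f y) (∫ x, f x ∂(ν : Measure S)) := hint hfi
    have e5 : HasSum (fun y => a y * (exitRate G y * f y))
        (∫ x, exitRate G x * f x ∂(ν : Measure S)) := hint hefi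
    convert! (e4.sub (e5.mul_left Λ⁻¹)).add (e3.mul_left Λ⁻¹) using 1
    · funext y
      rw [tsum_mul_right]; ring
    · rw [integral_add hgi hefi]; ring
  have hb0 : ∀ y, 0 ≤ b y := fun y => by
    have h1 : Λ⁻¹ * exitRate G y ≤ 1 := by
      rw [inv_mul_le_iff₀ hΛ, mul_one]; exact (hG.exit_le y).trans hC
    have h2 : 0 ≤ ∑' x, a x * offDiag G x y :=
      tsum_nonneg fun x => mul_nonneg (ha0 x) (hG.offDiag_nonneg x y)
    have := ha0 y
    have : 0 ≤ 1 - Λ⁻¹ * exitRate G y := by linarith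
    positivity
  have hb1 : HasSum b 1 := by
    have := key (fun _ => 1) 1 (by simp)
    simpa [gen] using this
  obtain ⟨ν', hν'⟩ := exists_probabilityMeasure_of_hasSum hb0 hb1
  refine ⟨ν', fun f B hf => ?_⟩
  rw [integral_eq_tsum_real (integrable_of_bounded hf), ← (key f B hf).tsum_eq]
  simp_rw [hν']

/-- Cesàro averages of the laws of the uniformized chain started from `ν₀`. -/
lemma exists_cesaro (hG : BoundedRates G C) (ν₀ : ProbabilityMeasure S) :
    ∃ (Λ : ℝ) (μ ν : ℕ → ProbabilityMeasure S), 0 < Λ ∧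
      (∀ (T : ℕ) (f : S → ℝ) (B : ℝ), (∀ x, |f x| ≤ B) →
        ∫ x, gen G f x ∂(ν T : Measure S) = Λ / (T + 1) *
          (∫ x, f x ∂(μ T : Measure S) - ∫ x, f x ∂(ν₀ : Measure S))) ∧
      ∀ 𝓕 : Set (S → ℝ), (∀ f ∈ 𝓕, ∃ B, ∀ x, |f x| ≤ B) → (∀ f ∈ 𝓕, gen G f ∈ 𝓕) →
        (∀ f ∈ 𝓕, ∫ x, gen G f x ∂(ν₀ : Measure S) = 0) →
        ∀ f ∈ 𝓕, ∀ T, ∫ x, f x ∂(ν T : Measure S) = ∫ x, f x ∂(ν₀ : Measure S) := by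
  set Λ := max C 1 with hΛdef
  have hΛ : 0 < Λ := lt_of_lt_of_le one_pos (le_max_right _ _)
  choose st hst using exists_step hG hΛ (le_max_left C 1)
  let ρ : ℕ → ProbabilityMeasure S := fun t => st^[t] ν₀
  have hρ : ∀ (t : ℕ) (f : S → ℝ) (B : ℝ), (∀ x, |f x| ≤ B) →
      ∫ x, f x ∂(ρ (t + 1) : Measure S)
        = ∫ x, f x ∂(ρ t : Measure S) + Λ⁻¹ * ∫ x, gen G f x ∂(ρ t : Measure S) := by
    intro t f B hf
    have : ρ (t + 1) = st (ρ t) := Function.iterate_succ_apply' st t ν₀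
    rw [this, hst _ f B hf]
  have hρ0 : ρ 0 = ν₀ := rfl
  let c : ℕ → Measure S := fun T =>
    ENNReal.ofReal ((T + 1 : ℝ)⁻¹) • ∑ t ∈ Finset.range (T + 1), (ρ t : Measure S)
  have hc : ∀ T (f : S → ℝ) (B : ℝ), (∀ x, |f x| ≤ B) → ∫ x, f x ∂(c T)
      = (T + 1 : ℝ)⁻¹ * ∑ t ∈ Finset.range (T + 1), ∫ x, f x ∂(ρ t : Measure S) := by
    intro T f B hf
    rw [integral_smul_measure, integral_finsetSum_measure fun t _ => integrable_of_bounded hf,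
      ENNReal.toReal_ofReal (by positivity), smul_eq_mul]
  have hcp : ∀ T, IsProbabilityMeasure (c T) := fun T => ⟨by
    simp only [c, Measure.smul_apply, Measure.finsetSum_apply, measure_univ, Finset.sum_const,
      Finset.card_range, smul_eq_mul, nsmul_eq_mul, mul_one]
    rw [← ENNReal.ofReal_natCast, ← ENNReal.ofReal_mul (by positivity), Nat.cast_add_one,
      inv_mul_cancel₀ (by positivity), ENNReal.ofReal_one]⟩
  refine ⟨Λ, fun T => ρ (T + 1), fun T => ⟨c T, hcp T⟩, hΛ, fun T f B hf => ?_, ?_⟩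
  · change ∫ x, gen G f x ∂(c T) = _
    rw [hc T _ _ (hG.abs_gen_le hf)]
    -- One-step increments of the mean of `f` are Λ⁻¹ times means of the generator, so the sum
    -- telescopes.
    have : ∀ N, ∑ t ∈ Finset.range N, ∫ x, gen G f x ∂(ρ t : Measure S)
        = Λ * (∫ x, f x ∂(ρ N : Measure S) - ∫ x, f x ∂(ν₀ : Measure S)) := by
      intro N
      induction N with
      | zero => simp [hρ0]
      | succ N ih =>
        rw [Finset.sum_range_succ, ih, hρ N f B hf]
        field_simp
        ring
    rw [this]
    ring
  -- A class stable under the generator, with mean-zero generators at the start, keeps its means at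
  -- all times. It is applied to functions of the modulating state, to preserve the first marginal
  -- exactly.
  · intro 𝓕 hbd hgen h0 f hf T
    have : ∀ t, ∀ f ∈ 𝓕, ∫ x, f x ∂(ρ t : Measure S) = ∫ x, f x ∂(ν₀ : Measure S) := by
      intro t
      induction t with
      | zero => intro f _; rfl
      | succ t ih =>
        intro f hf
        obtain ⟨B, hB⟩ := hbd f hf
        rw [hρ t f B hB, ih f hf, ih _ (hgen f hf), h0 f hf]
        ring
    obtain ⟨B, hB⟩ := hbd f hf
    change ∫ x, f x ∂(c T) = _
    rw [hc T f B hB, Finset.sum_congr rfl fun t _ => this t f hf]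
    simp only [Finset.sum_const, Finset.card_range, nsmul_eq_mul]
    push_cast
    field_simp

/-- Almost stationary measures that do not lose all their mass yield a stationary
distribution. -/
lemma exists_isStationary_of_approx (hG : BoundedRates G C) (ν : ℕ → ProbabilityMeasure S)
    {c : ℕ → ℝ} (hc : Tendsto c atTop (𝓝 0))
    (hgen : ∀ T z, |∫ x, gen G (({z} : Set S).indicator 1) x ∂(ν T : Measure S)| ≤ c T)
    (F : Finset S) {κ : ℝ} (hκ : 0 < κ)
    (hF : ∀ᶠ T in atTop, κ ≤ ∑ x ∈ F, (ν T : Measure S).real {x}) :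
    ∃ ν : ProbabilityMeasure S, IsStationary G (ν : Measure S) := by
  -- An ultrafilter makes all point masses converge at once and replaces a diagonal extraction.
  let 𝒰 : Ultrafilter ℕ := Filter.hyperfilter ℕ
  have h𝒰 : (𝒰 : Filter ℕ) ≤ atTop := Nat.hyperfilter_le_atTop
  have hlim : ∀ x, ∃ b ∈ Icc (0 : ℝ) 1,
      Tendsto (fun T => (ν T : Measure S).real {x}) 𝒰 (𝓝 b) := by
    intro x
    obtain ⟨b, hb, h⟩ := (isCompact_Icc (a := (0 : ℝ)) (b := 1)).ultrafilter_le_nhds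
      (𝒰.map fun T => (ν T : Measure S).real {x}) (by
        rw [le_principal_iff, Ultrafilter.mem_coe, Ultrafilter.mem_map]
        exact Filter.univ_mem' fun T => ⟨measureReal_nonneg, measureReal_le_one⟩)
    exact ⟨b, hb, h⟩
  choose b hb hbt using hlim
  have hsumF : ∀ s : Finset S, ∑ x ∈ s, b x ≤ 1 := by
    intro s
    refine le_of_tendsto (tendsto_finsetSum s fun x _ => hbt x) (Eventually.of_forall fun T => ?_)
    have h1 := (summable_real_singleton (ν T : Measure S)).sum_le_tsum s
      fun x _ => measureReal_nonneg
    refine h1.trans (le_of_eq ?_)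
    simpa using (integral_eq_tsum_real (integrable_const (μ := (ν T : Measure S)) (1 : ℝ))).symm
  have hbs : Summable b := summable_of_sum_le (fun x => (hb x).1) hsumF
  have hκb : κ ≤ ∑ x ∈ F, b x :=
    ge_of_tendsto (tendsto_finsetSum F fun x _ => hbt x) (h𝒰 hF)
  have hpos : 0 < ∑' x, b x :=
    (hκ.trans_le hκb).trans_le (hbs.sum_le_tsum F fun x _ => (hb x).1)
  -- Mass may escape to infinity, so only finite partial inflows pass to the limit, and only as an
  -- inequality. Equality returns because total inflow equals total outflow (`htot`).
  have hflow : ∀ (s : Finset S) z, ∑ x ∈ s, b x * offDiag G x z ≤ b z * exitRate G z := by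
    intro s z
    have h1 : Tendsto (fun T => (ν T : Measure S).real {z} * exitRate G z + c T) 𝒰
        (𝓝 (b z * exitRate G z + 0)) := ((hbt z).mul_const _).add (hc.mono_left h𝒰)
    rw [add_zero] at h1
    refine le_of_tendsto_of_tendsto (tendsto_finsetSum s fun x _ => (hbt x).mul_const _) h1
      (Eventually.of_forall fun T => ?_)
    obtain ⟨h2, h3⟩ := integral_gen_indicator hG (ν T : Measure S) z
    have h4 := (abs_le.1 (hgen T z)).2
    have h5 := h2.sum_le_tsum s fun x _ => mul_nonneg measureReal_nonneg (hG.offDiag_nonneg x z)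
    rw [h3] at h4
    simp only
    linarith
  have hn : ∀ x z, 0 ≤ b x * offDiag G x z := fun x z =>
    mul_nonneg (hb x).1 (hG.offDiag_nonneg x z)
  have hcol : ∀ z, Summable fun x => b x * offDiag G x z := fun z =>
    summable_of_sum_le (fun x => hn x z) fun s => hflow s z
  have hle : ∀ z, ∑' x, b x * offDiag G x z ≤ b z * exitRate G z := fun z =>
    (hcol z).tsum_le_of_sum_le fun s => hflow s z
  have row : ∀ x, HasSum (fun y => b x * offDiag G x y) (b x * exitRate G x) :=
    fun x => (hG.hasSum_offDiag x).mul_left _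
  have hse : Summable fun x => b x * exitRate G x :=
    Summable.of_nonneg_of_le (fun x => mul_nonneg (hb x).1 (hG.exitRate_nonneg x))
      (fun x => mul_le_mul_of_nonneg_left (hG.exit_le x) (hb x).1) (hbs.mul_right C)
  have s2 : Summable (fun q : S × S => b q.1 * offDiag G q.1 q.2) :=
    hG.summable_flow (fun x => (hb x).1) hbs
  have s1 : Summable (fun q : S × S => b q.2 * offDiag G q.2 q.1) :=
    (Equiv.prodComm S S).summable_iff.2 s2
  have htot : ∑' y, ∑' x, b x * offDiag G x y = ∑' y, b y * exitRate G y := by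
    rw [← tsum_congr fun x => (row x).tsum_eq, ← s2.tsum_prod,
      ← (Equiv.prodComm S S).tsum_eq (fun q : S × S => b q.1 * offDiag G q.1 q.2)]
    exact (s1.tsum_prod).symm
  have hbal : Balance G b := by
    intro z
    have heq : ∑' x, b x * offDiag G x z = b z * exitRate G z := by
      by_contra hne
      exact (Summable.tsum_lt_tsum hle (lt_of_le_of_ne (hle z) hne) s1.prod hse).ne htot
    rw [← heq]
    exact (hcol z).hasSum
  obtain ⟨μ, hμ⟩ := exists_probabilityMeasure_of_hasSum (a := fun x => (∑' x, b x)⁻¹ * b x)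
    (fun x => mul_nonneg (inv_nonneg.2 hpos.le) (hb x).1)
    (by simpa [inv_mul_cancel₀ hpos.ne'] using hbs.hasSum.mul_left (∑' x, b x)⁻¹)
  refine ⟨μ, (isStationary_iff_balance _ _).2 fun z => ?_⟩
  simp_rw [hμ, mul_assoc]
  exact (hbal z).mul_left _

end Existence

/-! ### The generator of the JSQ system -/

section JSQGenerator

variable {Z : Type*} {n : ℕ} {Q : Z → Z → ℝ} {lam : Z → ℝ} {mu : Z → Fin n → ℝ} {K : ℝ}

/-- The part of the generator of the JSQ system that comes from arrivals and services, applied to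
a function `F` of the new queue lengths. -/
noncomputable def jump (lam : Z → ℝ) (mu : Z → Fin n → ℝ) (i : Z) (q : Fin n → ℕ)
    (F : (Fin n → ℕ) → ℝ) : ℝ :=
  (∑ j ∈ shortest q, lam i / ((shortest q).card : ℝ) * F (q + Pi.single j 1))
    + ∑ j, if q j = 0 then 0 else mu i j * F (q - Pi.single j 1)

/-- Queue length vectors that differ by one job. -/
def Nbr (q q' : Fin n → ℕ) : Prop := ∃ j, q' = q + Pi.single j 1 ∨ q = q' + Pi.single j 1

lemma Nbr.symm {q q' : Fin n → ℕ} (h : Nbr q q') : Nbr q' q := by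
  obtain ⟨j, h | h⟩ := h
  · exact ⟨j, Or.inr h⟩
  · exact ⟨j, Or.inl h⟩

lemma sub_single_add {q : Fin n → ℕ} {j : Fin n} (h : q j ≠ 0) :
    q - Pi.single j 1 + Pi.single j 1 = q := by
  funext l
  by_cases hl : l = j
  · subst hl; simp; omega
  · simp [hl]

lemma nbr_add (q : Fin n → ℕ) (j : Fin n) : Nbr q (q + Pi.single j 1) := ⟨j, Or.inl rfl⟩

lemma nbr_sub {q : Fin n → ℕ} {j : Fin n} (h : q j ≠ 0) : Nbr q (q - Pi.single j 1) :=
  ⟨j, Or.inr (sub_single_add h).symm⟩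

lemma Nbr.ne {q q' : Fin n → ℕ} (h : Nbr q q') : q' ≠ q := by
  rintro rfl
  obtain ⟨j, h | h⟩ := h <;> simpa using congrFun h j

lemma shortest_nonempty (hn : 1 ≤ n) (q : Fin n → ℕ) : (shortest q).Nonempty := by
  have : Nonempty (Fin n) := ⟨⟨0, hn⟩⟩
  obtain ⟨j, hj⟩ := Finite.exists_min q
  exact ⟨j, by simpa [shortest] using hj⟩

/-- Standing bounds on the parameters of the JSQ system. -/
structure JSQBounds (Q : Z → Z → ℝ) (lam : Z → ℝ) (mu : Z → Fin n → ℝ) (K : ℝ) : Prop where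
  servers : 1 ≤ n
  rates : BoundedRates Q K
  lam_nonneg : ∀ i, 0 ≤ lam i
  lam_le : ∀ i, lam i ≤ K
  mu_nonneg : ∀ i j, 0 ≤ mu i j
  muTot_le : ∀ i, muTot mu i ≤ K

lemma jump_add (i : Z) (q : Fin n → ℕ) (F F' : (Fin n → ℕ) → ℝ) :
    jump lam mu i q (fun q' => F q' + F' q') = jump lam mu i q F + jump lam mu i q F' := by
  simp only [jump, mul_add, Finset.sum_add_distrib]
  have : ∀ j, (if q j = 0 then 0 else mu i j * F (q - Pi.single j 1)
      + mu i j * F' (q - Pi.single j 1)) = (if q j = 0 then 0 else mu i j * F (q - Pi.single j 1))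
      + if q j = 0 then 0 else mu i j * F' (q - Pi.single j 1) := fun j => by split_ifs <;> simp
  rw [Finset.sum_congr rfl fun j _ => this j, Finset.sum_add_distrib]
  ring

lemma jump_const_mul (i : Z) (q : Fin n → ℕ) (c : ℝ) (F : (Fin n → ℕ) → ℝ) :
    jump lam mu i q (fun q' => c * F q') = c * jump lam mu i q F := by
  simp only [jump, mul_add, Finset.mul_sum]
  congr 1
  · exact Finset.sum_congr rfl fun j _ => by ring
  · exact Finset.sum_congr rfl fun j _ => by split_ifs <;> ring

lemma jump_mono (h : JSQBounds Q lam mu K) (i : Z) (q : Fin n → ℕ) {F F' : (Fin n → ℕ) → ℝ}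
    (hF : ∀ q', Nbr q q' → F q' ≤ F' q') : jump lam mu i q F ≤ jump lam mu i q F' := by
  refine add_le_add (Finset.sum_le_sum fun j _ => ?_) (Finset.sum_le_sum fun j _ => ?_)
  · exact mul_le_mul_of_nonneg_left (hF _ (nbr_add q j))
      (div_nonneg (h.lam_nonneg i) (Nat.cast_nonneg _))
  · split_ifs with hj
    · exact le_rfl
    · exact mul_le_mul_of_nonneg_left (hF _ (nbr_sub hj)) (h.mu_nonneg i j)

lemma sum_shortest_const (h : JSQBounds Q lam mu K) (i : Z) (q : Fin n → ℕ) (c : ℝ) :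
    ∑ _j ∈ shortest q, lam i / ((shortest q).card : ℝ) * c = lam i * c := by
  have : ((shortest q).card : ℝ) ≠ 0 := by
    exact_mod_cast (Finset.card_pos.2 (shortest_nonempty h.servers q)).ne'
  rw [Finset.sum_const, nsmul_eq_mul]
  field_simp

lemma jump_const_le (h : JSQBounds Q lam mu K) (i : Z) (q : Fin n → ℕ) {c : ℝ} (hc : 0 ≤ c) :
    jump lam mu i q (fun _ => c) ≤ 2 * K * c := by
  have h1 : ∑ j, (if q j = 0 then 0 else mu i j * c) ≤ muTot mu i * c := by
    rw [muTot, Finset.sum_mul]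
    refine Finset.sum_le_sum fun j _ => ?_
    have := mul_nonneg (h.mu_nonneg i j) hc
    split_ifs
    · exact this
    · exact le_rfl
  rw [jump, sum_shortest_const h]
  have h2 := mul_le_mul_of_nonneg_right (h.lam_le i) hc
  have h3 := mul_le_mul_of_nonneg_right (h.muTot_le i) hc
  linarith

lemma jump_le_of_le (h : JSQBounds Q lam mu K) (i : Z) (q : Fin n → ℕ) {F : (Fin n → ℕ) → ℝ}
    {c : ℝ} (hc : 0 ≤ c) (hF : ∀ q', Nbr q q' → F q' ≤ c) : jump lam mu i q F ≤ 2 * K * c :=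
  (jump_mono h i q hF).trans (jump_const_le h i q hc)

lemma abs_jump_le (h : JSQBounds Q lam mu K) (i : Z) (q : Fin n → ℕ) {F : (Fin n → ℕ) → ℝ}
    {c : ℝ} (hc : 0 ≤ c) (hF : ∀ q', Nbr q q' → |F q'| ≤ c) :
    |jump lam mu i q F| ≤ 2 * K * c := by
  refine abs_le'.2 ⟨jump_le_of_le h i q hc fun q' hq => (le_abs_self _).trans (hF q' hq), ?_⟩
  have := jump_const_mul (lam := lam) (mu := mu) i q (-1) F
  rw [neg_one_mul] at this
  rw [← this]
  refine jump_le_of_le h i q hc fun q' hq => ?_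
  rw [neg_one_mul]
  exact (neg_le_abs _).trans (hF q' hq)

/-- Sums over the transitions of the JSQ system. -/
lemma hasSum_jsqRate_mul (i : Z) (q : Fin n → ℕ)
    (D : Z × (Fin n → ℕ) → ℝ) {A : ℝ} (hA : HasSum (fun i' => Q i i' * D (i', q)) A) :
    HasSum (fun y => jsqRate Q lam mu (i, q) y * D y)
      (A + jump lam mu i q fun q' => D (i, q')) := by
  classical
  have hinj : Function.Injective fun i' : Z => (i', q) := fun a b hab => (Prod.mk.inj hab).1
  have h1 : HasSum (fun y : Z × (Fin n → ℕ) => (if y.2 = q then Q i y.1 else 0) * D y) A := by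
    rw [← hinj.hasSum_iff]
    · simpa [Function.comp_def] using hA
    · rintro ⟨a, b⟩ hab
      have : b ≠ q := fun hb => hab ⟨a, by rw [hb]⟩
      simp [this]
  have h2 : ∀ j (c : ℝ), HasSum (fun y : Z × (Fin n → ℕ) =>
      (if y.1 = i then (if y.2 = q + Pi.single j 1 then c else 0) else 0) * D y)
      (c * D (i, q + Pi.single j 1)) := by
    intro j c
    have := hasSum_single (f := fun y : Z × (Fin n → ℕ) =>
      (if y.1 = i then (if y.2 = q + Pi.single j 1 then c else 0) else 0) * D y)
      (i, q + Pi.single j 1) fun y hy => by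
        by_cases h1 : y.1 = i
        · by_cases h2 : y.2 = q + Pi.single j 1
          · exact absurd (Prod.ext h1 h2) hy
          · simp [h2]
        · simp [h1]
    simpa using this
  have h3 : ∀ j, HasSum (fun y : Z × (Fin n → ℕ) =>
      (if y.1 = i then (if q = y.2 + Pi.single j 1 then mu i j else 0) else 0) * D y)
      (if q j = 0 then 0 else mu i j * D (i, q - Pi.single j 1)) := by
    intro j
    by_cases hj : q j = 0
    · have : ∀ r : Fin n → ℕ, q ≠ r + Pi.single j 1 := fun r hr => by
        have := congrFun hr j
        simp at this
        omega
      simp [this, hj]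
    · have := hasSum_single (f := fun y : Z × (Fin n → ℕ) =>
        (if y.1 = i then (if q = y.2 + Pi.single j 1 then mu i j else 0) else 0) * D y)
        (i, q - Pi.single j 1) fun y hy => by
          by_cases h1 : y.1 = i
          · by_cases h2 : q = y.2 + Pi.single j 1
            · refine absurd (Prod.ext h1 ?_) hy
              funext l
              simp [h2]
            · simp [h2]
          · simp [h1]
      simpa [hj, sub_single_add hj] using this
  have h4 := hasSum_sum (s := shortest q) fun j _ => h2 j (lam i / ((shortest q).card : ℝ))
  have h5 := hasSum_sum (s := Finset.univ) fun j _ => h3 j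
  convert! h1.add (h4.add h5) using 1
  funext y
  rw [jsqRate, ← Finset.sum_mul, ← Finset.sum_mul, ← add_mul, ← add_mul]
  congr 2
  by_cases hy : y.1 = i <;> simp [hy]

lemma jsqRate_nonneg (h : JSQBounds Q lam mu K) (x y : Z × (Fin n → ℕ)) (hxy : x ≠ y) :
    0 ≤ jsqRate Q lam mu x y := by
  refine add_nonneg ?_ ?_
  · split_ifs with hy
    · exact h.rates.nonneg _ _ fun h1 => hxy (Prod.ext h1 hy.symm)
    · exact le_rfl
  · split_ifs with hy
    · refine add_nonneg (Finset.sum_nonneg fun j _ => ?_) (Finset.sum_nonneg fun j _ => ?_)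
      · split_ifs
        · exact div_nonneg (h.lam_nonneg _) (Nat.cast_nonneg _)
        · exact le_rfl
      · split_ifs
        · exact h.mu_nonneg _ _
        · exact le_rfl
    · exact le_rfl

/-- Modulation, arrivals and services each contribute a total rate of at most `K`. -/
lemma boundedRates_jsqRate (h : JSQBounds Q lam mu K) :
    BoundedRates (jsqRate Q lam mu) (3 * K) := by
  classical
  have key : ∀ x : Z × (Fin n → ℕ), ∃ c ≤ 3 * K,
      HasSum (fun y : {y // y ≠ x} => jsqRate Q lam mu x y) c := by
    rintro ⟨i, q⟩
    refine ⟨exitRate Q i + jump lam mu i q fun _ => 1, ?_, ?_⟩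
    · have h1 := h.rates.exit_le i
      have h2 := jump_const_le h i q zero_le_one
      linarith
    · have h1 := hasSum_jsqRate_mul (Q := Q) (lam := lam) (mu := mu) i q
        (fun y => if y = (i, q) then 0 else 1) (A := exitRate Q i) (by
          convert! h.rates.hasSum_offDiag i using 1
          funext i'
          simp [offDiag])
      have h2 : (jump lam mu i q fun q' => if (i, q') = (i, q) then (0 : ℝ) else 1)
          = jump lam mu i q fun _ => 1 := by
        apply le_antisymm <;> refine jump_mono h i q fun q' hq => ?_ <;> simp [hq.ne]
      rw [h2] at h1
      refine (hasSum_ne_iff (i, q) (jsqRate Q lam mu (i, q)) _ _ ?_ fun y hy => ?_).2 h1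
      · simp
      · simp [hy]
  refine ⟨jsqRate_nonneg h, fun x => ?_, fun x => ?_⟩
  · obtain ⟨c, -, hc⟩ := key x; exact hc.summable
  · obtain ⟨c, hcK, hc⟩ := key x
    rw [exitRate, hc.tsum_eq]; exact hcK

/-- The generator of the JSQ system on a product function. -/
lemma gen_jsqRate_mul (h : JSQBounds Q lam mu K) (v : Z → ℝ) (g : (Fin n → ℕ) → ℝ) (i : Z)
    (q : Fin n → ℕ) (hs : Summable fun i' => offDiag Q i i' * v i') :
    gen (jsqRate Q lam mu) (fun x => v x.1 * g x.2) (i, q)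
      = g q * gen Q v i + v i * jump lam mu i q fun q' => g q' - g q := by
  have h1 : HasSum (fun i' => Q i i' * (v i' * g q - v i * g q)) (g q * gen Q v i) := by
    rw [gen_eq_offDiag]
    convert! (summable_gen h.rates hs).hasSum.mul_left (g q) using 1
    funext i'
    rw [offDiag_mul_sub]; ring
  have h2 := hasSum_jsqRate_mul (lam := lam) (mu := mu) i q
    (fun y => v y.1 * g y.2 - v i * g q) h1
  rw [gen, h2.tsum_eq, ← jump_const_mul]
  simp only [mul_sub]

end JSQGenerator

/-! ### Balance identities for the JSQ system -/

section JSQStationary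

variable {Z : Type*} [Countable Z] [MeasurableSpace Z] [MeasurableSingletonClass Z] {n : ℕ}
  {Q : Z → Z → ℝ} {lam : Z → ℝ} {mu : Z → Fin n → ℝ} {K : ℝ} {p : Measure Z}
  [IsProbabilityMeasure p]

/-- On functions of the modulating state alone the JSQ generator is that of `Q`, so the marginal
solves the balance equations for `Q` and uniqueness applies. This makes moments under `p` available
under every stationary law of the system. -/
lemma map_fst_eq (h : JSQBounds Q lam mu K) (hirr : IsIrreducible Q) (hp : IsStationary Q p)
    {ν : Measure (Z × (Fin n → ℕ))} [IsProbabilityMeasure ν]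
    (hν : IsStationary (jsqRate Q lam mu) ν) : ν.map Prod.fst = p := by
  have : IsProbabilityMeasure (ν.map Prod.fst) :=
    Measure.isProbabilityMeasure_map measurable_fst.aemeasurable
  have hs : IsStationary Q (ν.map Prod.fst) := by
    refine isStationary_of_integral_gen_indicator h.rates fun z => ?_
    set v : Z → ℝ := ({z} : Set Z).indicator 1 with hv
    have hvb : ∀ i, |v i| ≤ 1 := fun i => by
      by_cases hi : i = z <;> simp [hv, hi]
    rw [integral_map measurable_fst.aemeasurable Measurable.of_discrete.aestronglyMeasurable]
    have h1 := (hν.integral_gen (boundedRates_jsqRate h)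
      (f := fun x => v x.1 * (fun _ => (1 : ℝ)) x.2)
      (integrable_of_bounded (B := 1) fun x => by simpa using hvb x.1)).2
    rw [← h1]
    refine integral_congr_ae (ae_of_all _ fun x => ?_)
    have := gen_jsqRate_mul h v (fun _ => 1) x.1 x.2 (h.rates.summable_mul hvb x.1)
    simp only [sub_self, one_mul] at this
    have h0 : jump lam mu x.1 x.2 (fun _ => (0 : ℝ)) = 0 := by simp [jump]
    rw [h0, mul_zero, add_zero] at this
    exact this.symm
  have hmass : ∀ ρ : Measure Z, IsProbabilityMeasure ρ → ∑' x, ρ.real {x} = 1 := fun ρ _ => by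
    simpa using (integral_eq_tsum_real (integrable_const (μ := ρ) (1 : ℝ))).symm
  have := Balance.unique h.rates hirr (summable_real_singleton _) (summable_real_singleton _)
    ((hmass _ inferInstance).trans (hmass _ inferInstance).symm)
    ((isStationary_iff_balance _ _).1 hs) ((isStationary_iff_balance _ _).1 hp)
  refine Measure.ext_of_singleton fun x => ?_
  have h2 := congrFun this x
  exact (measureReal_eq_measureReal_iff).1 h2

lemma integrable_fst {ν : Measure (Z × (Fin n → ℕ))} (hm : ν.map Prod.fst = p) {v : Z → ℝ}
    (hv : Integrable v p) : Integrable (fun x => v x.1) ν := by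
  rw [← hm] at hv
  exact hv.comp_measurable measurable_fst

lemma integral_fst {ν : Measure (Z × (Fin n → ℕ))} (hm : ν.map Prod.fst = p) (v : Z → ℝ) :
    ∫ x, v x.1 ∂ν = ∫ i, v i ∂p := by
  rw [← hm, integral_map measurable_fst.aemeasurable Measurable.of_discrete.aestronglyMeasurable]

/-- The balance identity for the product of an integrable and a bounded function. -/
lemma integral_gen_mul (h : JSQBounds Q lam mu K) {ν : Measure (Z × (Fin n → ℕ))}
    [IsProbabilityMeasure ν] (hm : ν.map Prod.fst = p) (hν : IsStationary (jsqRate Q lam mu) ν)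
    {v : Z → ℝ} (hv : Integrable v p) (hs : ∀ i, Summable fun i' => offDiag Q i i' * v i')
    {g : (Fin n → ℕ) → ℝ} {B : ℝ} (hg : ∀ q, |g q| ≤ B) :
    Integrable (fun x : Z × (Fin n → ℕ) =>
      g x.2 * gen Q v x.1 + v x.1 * jump lam mu x.1 x.2 fun q' => g q' - g x.2) ν ∧
    ∫ x : Z × (Fin n → ℕ),
      (g x.2 * gen Q v x.1 + v x.1 * jump lam mu x.1 x.2 fun q' => g q' - g x.2) ∂ν = 0 := by
  have hi : Integrable (fun x : Z × (Fin n → ℕ) => v x.1 * g x.2) ν :=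
    (integrable_fst hm hv).mul_bdd (c := B) Measurable.of_discrete.aestronglyMeasurable
      (ae_of_all _ fun x => hg x.2)
  have := hν.integral_gen (boundedRates_jsqRate h) hi
  have he : gen (jsqRate Q lam mu) (fun x => v x.1 * g x.2) = fun x : Z × (Fin n → ℕ) =>
      g x.2 * gen Q v x.1 + v x.1 * jump lam mu x.1 x.2 fun q' => g q' - g x.2 :=
    funext fun x => gen_jsqRate_mul h v g x.1 x.2 (hs x.1)
  rwa [he] at this

lemma abs_min_sub_min_le (a b c : ℝ) : |min a c - min b c| ≤ |a - b| := by
  have := abs_min_sub_min_le_max a c b c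
  simpa using this

lemma tendsto_min_natCast (a : ℝ) : Tendsto (fun M : ℕ => min a (M : ℝ)) atTop (𝓝 a) := by
  refine tendsto_const_nhds.congr' ?_
  filter_upwards [eventually_ge_atTop ⌈a⌉₊] with M hM
  exact (min_eq_left ((Nat.le_ceil a).trans (by exact_mod_cast hM))).symm

/-- Truncation of a function of the queue lengths with bounded increments. -/
lemma tendsto_integral_jump_min (h : JSQBounds Q lam mu K) (ν : Measure (Z × (Fin n → ℕ)))
    [IsProbabilityMeasure ν] {g : (Fin n → ℕ) → ℝ} {B : ℝ}
    (hg : ∀ q q', Nbr q q' → |g q' - g q| ≤ B) :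
    Tendsto (fun M : ℕ => ∫ x : Z × (Fin n → ℕ),
        jump lam mu x.1 x.2 (fun q' => min (g q') M - min (g x.2) M) ∂ν) atTop
      (𝓝 (∫ x : Z × (Fin n → ℕ), jump lam mu x.1 x.2 (fun q' => g q' - g x.2) ∂ν)) := by
  refine tendsto_integral_of_dominated_convergence (fun _ => 2 * K * max B 0)
    (fun M => Measurable.of_discrete.aestronglyMeasurable) (integrable_const _)
    (fun M => ae_of_all _ fun x => ?_) (ae_of_all _ fun x => ?_)
  · exact abs_jump_le h _ _ (le_max_right _ _) fun q' hq =>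
      (abs_min_sub_min_le _ _ _).trans ((hg _ _ hq).trans (le_max_left _ _))
  · refine Tendsto.add (tendsto_finsetSum _ fun j _ => ?_) (tendsto_finsetSum _ fun j _ => ?_)
    · exact ((tendsto_min_natCast _).sub (tendsto_min_natCast _)).const_mul _
    · split_ifs
      · exact tendsto_const_nhds
      · exact ((tendsto_min_natCast _).sub (tendsto_min_natCast _)).const_mul _

/-- The balance identity for functions of the queue lengths with bounded increments. -/
lemma integral_jump_eq_zero (h : JSQBounds Q lam mu K) {ν : Measure (Z × (Fin n → ℕ))}
    [IsProbabilityMeasure ν] (hm : ν.map Prod.fst = p) (hν : IsStationary (jsqRate Q lam mu) ν)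
    {g : (Fin n → ℕ) → ℝ} (hg0 : ∀ q, 0 ≤ g q) {B : ℝ}
    (hg : ∀ q q', Nbr q q' → |g q' - g q| ≤ B) :
    ∫ x : Z × (Fin n → ℕ), jump lam mu x.1 x.2 (fun q' => g q' - g x.2) ∂ν = 0 := by
  -- `g` is not known to be integrable. The identity holds for the bounded truncations `min g M`,
  -- whose increments are bounded uniformly in `M`, so dominated convergence applies.
  refine tendsto_nhds_unique (tendsto_integral_jump_min h ν hg) ?_
  refine tendsto_const_nhds.congr fun M => ?_
  have := (integral_gen_mul h hm hν (v := fun _ => 1) (integrable_const _)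
    (fun i => h.rates.summable_mul (B := 1) (by simp) i) (g := fun q => min (g q) M) (B := M)
    fun q => by
      rw [abs_of_nonneg (le_min (hg0 q) (Nat.cast_nonneg M))]
      exact min_le_right _ _).2
  simpa [gen] using this.symm

end JSQStationary

/-! ### Geometry of queue lengths around the diagonal -/

section QueueLengths

variable {n : ℕ}

/-- Total queue length. -/
noncomputable def qSum (q : Fin n → ℕ) : ℝ := ∑ j, (q j : ℝ)

/-- Average queue length. -/
noncomputable def qAvg (q : Fin n → ℕ) : ℝ := qSum q / n

/-- Shortest queue length. -/
noncomputable def qMin (q : Fin n → ℕ) : ℝ := ⨅ j, (q j : ℝ)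

/-- Difference between the average and the shortest queue length. -/
noncomputable def qGap (q : Fin n → ℕ) : ℝ := qAvg q - qMin q

/-- Squared distance of the queue lengths from the diagonal. -/
noncomputable def perpSq (q : Fin n → ℕ) : ℝ := ∑ j, ((q j : ℝ) - qAvg q) ^ 2

/-- Smoothed distance of the queue lengths from the diagonal. -/
noncomputable def perp (q : Fin n → ℕ) : ℝ := √(1 + perpSq q)

lemma qSum_nonneg (q : Fin n → ℕ) : 0 ≤ qSum q := Finset.sum_nonneg fun _ _ => Nat.cast_nonneg _

lemma qSum_eq_mul_qAvg (hn : 1 ≤ n) (q : Fin n → ℕ) : qSum q = n * qAvg q := by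
  have : (n : ℝ) ≠ 0 := by positivity
  rw [qAvg]; field_simp

lemma qSum_add_single (q : Fin n → ℕ) (j : Fin n) : qSum (q + Pi.single j 1) = qSum q + 1 := by
  simp only [qSum, Pi.add_apply, Nat.cast_add, Finset.sum_add_distrib]
  congr 1
  simp [Pi.single_apply]

lemma qSum_sub_single {q : Fin n → ℕ} {j : Fin n} (h : q j ≠ 0) :
    qSum (q - Pi.single j 1) = qSum q - 1 := by
  have := qSum_add_single (q - Pi.single j 1) j
  rw [sub_single_add h] at this
  linarith

lemma abs_qSum_sub_le {q q' : Fin n → ℕ} (h : Nbr q q') : |qSum q' - qSum q| ≤ 1 := by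
  obtain ⟨j, rfl | rfl⟩ := h <;> rw [qSum_add_single] <;> simp

lemma perpSq_eq (hn : 1 ≤ n) (q : Fin n → ℕ) :
    perpSq q = ∑ j, (q j : ℝ) ^ 2 - qSum q ^ 2 / n := by
  have : (n : ℝ) ≠ 0 := by positivity
  simp only [perpSq, sub_sq, Finset.sum_add_distrib, Finset.sum_sub_distrib, Finset.sum_const,
    Finset.card_univ, Fintype.card_fin, nsmul_eq_mul]
  rw [← Finset.sum_mul, ← Finset.mul_sum]
  change _ - 2 * qSum q * _ + _ = _
  rw [qAvg]
  field_simp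
  ring

lemma perpSq_nonneg (q : Fin n → ℕ) : 0 ≤ perpSq q := Finset.sum_nonneg fun _ _ => sq_nonneg _

lemma perpSq_add_single (hn : 1 ≤ n) (q : Fin n → ℕ) (j : Fin n) :
    perpSq (q + Pi.single j 1) = perpSq q + 2 * ((q j : ℝ) - qAvg q) + (1 - 1 / n) := by
  have : (n : ℝ) ≠ 0 := by positivity
  have h1 : ∑ l, (((q + Pi.single j 1 : Fin n → ℕ) l : ℕ) : ℝ) ^ 2
      = ∑ l, (q l : ℝ) ^ 2 + 2 * q j + 1 := by
    have : ∀ l, (((q + Pi.single j 1 : Fin n → ℕ) l : ℕ) : ℝ) ^ 2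
        = (q l : ℝ) ^ 2 + if l = j then 2 * (q j : ℝ) + 1 else 0 := fun l => by
      by_cases hl : l = j
      · subst hl; simp; ring
      · simp [hl]
    rw [Finset.sum_congr rfl fun l _ => this l, Finset.sum_add_distrib]
    simp [add_assoc]
  rw [perpSq_eq hn, perpSq_eq hn, h1, qSum_add_single, qAvg]
  field_simp
  ring

lemma perpSq_sub_single (hn : 1 ≤ n) {q : Fin n → ℕ} {j : Fin n} (h : q j ≠ 0) :
    perpSq (q - Pi.single j 1) = perpSq q - 2 * ((q j : ℝ) - qAvg q) + (1 - 1 / n) := by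
  have hn0 : (n : ℝ) ≠ 0 := by positivity
  have h1 := perpSq_add_single hn (q - Pi.single j 1) j
  rw [sub_single_add h] at h1
  have h2 : (((q - Pi.single j 1 : Fin n → ℕ) j : ℕ) : ℝ) = q j - 1 := by
    simp [Nat.cast_sub (Nat.one_le_iff_ne_zero.2 h)]
  rw [h2, qAvg, qSum_sub_single h] at h1
  rw [h1, qAvg]
  field_simp
  ring

lemma one_le_perp (q : Fin n → ℕ) : 1 ≤ perp q := by
  rw [perp, Real.one_le_sqrt]; linarith [perpSq_nonneg q]

lemma perp_pos (q : Fin n → ℕ) : 0 < perp q := one_pos.trans_le (one_le_perp q)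

lemma perp_sq (q : Fin n → ℕ) : perp q ^ 2 = 1 + perpSq q :=
  Real.sq_sqrt (by linarith [perpSq_nonneg q])

lemma abs_sub_qAvg_le (q : Fin n → ℕ) (j : Fin n) : |(q j : ℝ) - qAvg q| ≤ perp q := by
  rw [perp]
  refine Real.abs_le_sqrt ?_
  have : ((q j : ℝ) - qAvg q) ^ 2 ≤ perpSq q :=
    Finset.single_le_sum (f := fun j => ((q j : ℝ) - qAvg q) ^ 2) (fun _ _ => sq_nonneg _)
      (Finset.mem_univ j)
  linarith

lemma qMin_le (q : Fin n → ℕ) (j : Fin n) : qMin q ≤ q j :=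
  ciInf_le (Set.finite_range _).bddBelow j

lemma exists_eq_qMin (hn : 1 ≤ n) (q : Fin n → ℕ) : ∃ j, (q j : ℝ) = qMin q :=
  have : Nonempty (Fin n) := ⟨⟨0, hn⟩⟩
  exists_eq_ciInf_of_finite

lemma qMin_nonneg (q : Fin n → ℕ) : 0 ≤ qMin q := Real.iInf_nonneg fun _ => Nat.cast_nonneg _

lemma eq_qMin_of_mem_shortest (hn : 1 ≤ n) {q : Fin n → ℕ} {j : Fin n} (h : j ∈ shortest q) :
    (q j : ℝ) = qMin q := by
  obtain ⟨l, hl⟩ := exists_eq_qMin hn q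
  refine le_antisymm ?_ (qMin_le q j)
  rw [← hl]
  exact_mod_cast (Finset.mem_filter.1 h).2 l

lemma qGap_le_perp (hn : 1 ≤ n) (q : Fin n → ℕ) : qGap q ≤ perp q := by
  obtain ⟨l, hl⟩ := exists_eq_qMin hn q
  have := neg_abs_le ((q l : ℝ) - qAvg q)
  have := abs_sub_qAvg_le q l
  rw [qGap, ← hl]
  linarith

lemma qGap_nonneg (hn : 1 ≤ n) (q : Fin n → ℕ) : 0 ≤ qGap q := by
  have hn0 : (0 : ℝ) < n := by positivity
  have : n * qMin q ≤ qSum q := by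
    have := Finset.card_nsmul_le_sum Finset.univ (fun j => (q j : ℝ)) (qMin q)
      fun j _ => qMin_le q j
    simpa [qSum] using this
  rw [qSum_eq_mul_qAvg hn] at this
  rw [qGap]
  linarith [le_of_mul_le_mul_left this hn0]

/-- The excesses over the minimum are nonnegative with sum `n * qGap q`, the ℓ² norm is at most the
ℓ¹ norm, and the mean minimizes the sum of squared deviations. Together with `qGap_le_perp` this
makes `qGap`, which governs the drift, comparable to `perp`. -/
lemma perp_le (hn : 1 ≤ n) (q : Fin n → ℕ) : perp q ≤ n * qGap q + 1 := by
  have hn0 : (n : ℝ) ≠ 0 := by positivity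
  have hg := qGap_nonneg hn q
  have h1 : ∑ j, ((q j : ℝ) - qMin q) = n * qGap q := by
    rw [Finset.sum_sub_distrib]
    change qSum q - _ = _
    rw [qSum_eq_mul_qAvg hn, qGap]
    simp
    ring
  have h2 : ∑ j, ((q j : ℝ) - qMin q) ^ 2 ≤ (n * qGap q) ^ 2 := by
    rw [← h1]
    exact Finset.sum_sq_le_sq_sum_of_nonneg fun j _ => sub_nonneg.2 (qMin_le q j)
  have h3 : perpSq q ≤ ∑ j, ((q j : ℝ) - qMin q) ^ 2 := by
    have : ∑ j, ((q j : ℝ) - qMin q) ^ 2 = perpSq q + n * qGap q ^ 2 := by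
      have : ∀ j, ((q j : ℝ) - qMin q) ^ 2
          = ((q j : ℝ) - qAvg q) ^ 2 + 2 * qGap q * ((q j : ℝ) - qAvg q) + qGap q ^ 2 :=
        fun j => by rw [qGap]; ring
      rw [Finset.sum_congr rfl fun j _ => this j, Finset.sum_add_distrib, Finset.sum_add_distrib,
        ← Finset.mul_sum, Finset.sum_sub_distrib]
      change perpSq q + _ * (qSum q - _) + _ = _
      rw [qSum_eq_mul_qAvg hn]
      simp
    rw [this]
    linarith [mul_nonneg (Nat.cast_nonneg (α := ℝ) n) (sq_nonneg (qGap q))]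
  rw [perp, Real.sqrt_le_left (by positivity)]
  nlinarith [mul_nonneg (Nat.cast_nonneg (α := ℝ) n) hg]

lemma perp_le_perp_add_one (hn : 1 ≤ n) {q q' : Fin n → ℕ} (h : Nbr q q') :
    perp q' ≤ perp q + 1 := by
  have h0 := perp_pos q
  have hn' : (0 : ℝ) ≤ 1 / n := by positivity
  have key : perpSq q' ≤ perpSq q + 2 * perp q + 1 := by
    obtain ⟨j, rfl | rfl⟩ := h
    · rw [perpSq_add_single hn]
      linarith [le_abs_self ((q j : ℝ) - qAvg q), abs_sub_qAvg_le q j]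
    · have hj : (q' + Pi.single j 1 : Fin n → ℕ) j ≠ 0 := by simp
      have := perpSq_sub_single hn hj
      have e : q' + Pi.single j 1 - Pi.single j 1 = q' := by
        funext l; simp
      rw [e] at this
      rw [this]
      linarith [neg_abs_le ((((q' + Pi.single j 1 : Fin n → ℕ) j : ℕ) : ℝ)
          - qAvg (q' + Pi.single j 1)),
        abs_sub_qAvg_le (q' + Pi.single j 1) j]
  rw [perp, Real.sqrt_le_left (by positivity)]
  nlinarith [perp_sq q]

lemma abs_perp_sub_le (hn : 1 ≤ n) {q q' : Fin n → ℕ} (h : Nbr q q') :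
    |perp q' - perp q| ≤ 1 := by
  rw [abs_le]
  constructor <;> linarith [perp_le_perp_add_one hn h, perp_le_perp_add_one hn h.symm]

/-- The two sides differ by `(perp q' - perp q) ^ 2`. This converts the drift of the squared
distance into that of the distance. -/
lemma perp_mul_sub_le (q q' : Fin n → ℕ) :
    2 * perp q * (perp q' - perp q) ≤ perpSq q' - perpSq q := by
  nlinarith [perp_sq q, perp_sq q', sq_nonneg (perp q' - perp q)]

lemma qMin_le_of_le {q q' : Fin n → ℕ} (hn : 1 ≤ n) {c : ℝ} (h : ∀ j, (q j : ℝ) ≤ q' j + c) :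
    qMin q ≤ qMin q' + c := by
  obtain ⟨l, hl⟩ := exists_eq_qMin hn q'
  rw [← hl]
  exact (qMin_le q l).trans (h l)

lemma qGap_le_qGap_add_two (hn : 1 ≤ n) {q q' : Fin n → ℕ} (h : Nbr q q') :
    qGap q' ≤ qGap q + 2 := by
  have h1 : (1 : ℝ) ≤ n := by exact_mod_cast hn
  have h2 : qAvg q' ≤ qAvg q + 1 := by
    have := (abs_le.1 (abs_qSum_sub_le h)).2
    rw [qAvg, qAvg, div_le_iff₀ (by positivity), add_mul, div_mul_cancel₀ _ (by positivity)]
    linarith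
  have h3 : qMin q ≤ qMin q' + 1 := by
    refine qMin_le_of_le hn fun l => ?_
    obtain ⟨j, rfl | rfl⟩ := h
    · simp only [Pi.add_apply, Nat.cast_add]
      linarith [Nat.cast_nonneg (α := ℝ) ((Pi.single j 1 : Fin n → ℕ) l)]
    · simp only [Pi.add_apply, Nat.cast_add]
      have : (Pi.single j 1 : Fin n → ℕ) l ≤ 1 := by
        by_cases hl : l = j <;> simp [hl]
      have : (((Pi.single j 1 : Fin n → ℕ) l : ℕ) : ℝ) ≤ 1 := by exact_mod_cast this
      linarith
  rw [qGap, qGap]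
  linarith

lemma abs_qGap_sub_le (hn : 1 ≤ n) {q q' : Fin n → ℕ} (h : Nbr q q') :
    |qGap q' - qGap q| ≤ 2 := by
  rw [abs_le]
  constructor <;> linarith [qGap_le_qGap_add_two hn h, qGap_le_qGap_add_two hn h.symm]

end QueueLengths

/-! ### Drift of the total length, its exponential and the imbalance -/

section Drift

variable {Z : Type*} {n : ℕ} {Q : Z → Z → ℝ} {lam : Z → ℝ} {mu : Z → Fin n → ℝ} {K : ℝ}

/-- Service capacity of the idle servers. -/
noncomputable def unused (mu : Z → Fin n → ℝ) (i : Z) (q : Fin n → ℕ) : ℝ :=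
  ∑ j, if q j = 0 then mu i j else 0

/-- The margin in the SSC load condition. -/
noncomputable def sscGap (lam : Z → ℝ) (mu : Z → Fin n → ℝ) (i : Z) : ℝ :=
  lam i - (muTot mu i - n * muMin mu i)

lemma unused_nonneg (h : JSQBounds Q lam mu K) (i : Z) (q : Fin n → ℕ) : 0 ≤ unused mu i q :=
  Finset.sum_nonneg fun j _ => by split_ifs; exacts [h.mu_nonneg i j, le_rfl]

lemma unused_le (h : JSQBounds Q lam mu K) (i : Z) (q : Fin n → ℕ) : unused mu i q ≤ K := by
  refine le_trans (Finset.sum_le_sum fun j _ => ?_) (h.muTot_le i)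
  split_ifs
  exacts [le_rfl, h.mu_nonneg i j]

lemma unused_eq_zero {i : Z} {q : Fin n → ℕ} (h : 0 < qMin q) : unused mu i q = 0 :=
  Finset.sum_eq_zero fun j _ => by
    rw [if_neg]
    intro hj
    have := qMin_le q j
    rw [hj] at this
    simp at this
    linarith

/-- When capacity is lost, the total queue length is controlled by the imbalance. -/
lemma unused_mul_qSum (h : JSQBounds Q lam mu K) (i : Z) (q : Fin n → ℕ) :
    unused mu i q * qSum q = unused mu i q * (n * qGap q) := by
  -- With a queue empty, `qGap` is the average length; with none empty, no capacity is lost.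
  rcases (qMin_nonneg q).eq_or_lt with h0 | h0
  · rw [qGap, ← h0, sub_zero, qSum_eq_mul_qAvg h.servers]
  · rw [unused_eq_zero h0]; simp

lemma sum_served (i : Z) (q : Fin n → ℕ) (c : ℝ) :
    ∑ j, (if q j = 0 then 0 else mu i j * c) = (muTot mu i - unused mu i q) * c := by
  rw [muTot, unused, ← Finset.sum_sub_distrib, Finset.sum_mul]
  refine Finset.sum_congr rfl fun j _ => ?_
  split_ifs <;> simp

lemma jump_qSum (h : JSQBounds Q lam mu K) (i : Z) (q : Fin n → ℕ) :
    jump lam mu i q (fun q' => qSum q' - qSum q) = lam i - muTot mu i + unused mu i q := by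
  have h1 : ∀ j, (if q j = 0 then 0 else mu i j * (qSum (q - Pi.single j 1) - qSum q))
      = if q j = 0 then 0 else mu i j * (-1) := fun j => by
    split_ifs with hj
    · rfl
    · rw [qSum_sub_single hj]; ring
  have h2 : ∀ j, qSum (q + Pi.single j 1) - qSum q = 1 := fun j => by rw [qSum_add_single]; ring
  rw [jump, Finset.sum_congr rfl fun j _ => h1 j]
  simp only [h2]
  rw [sum_shortest_const h, sum_served]
  ring

/-- An arrival multiplies the exponential by e^{-θ}, a departure by e^θ. Writing e^{-θ} - 1 = -(e^θ
- 1)e^{-θ} extracts the common small factor e^θ - 1 and leaves a factor bounded uniformly in θ ≥ 0.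
-/
lemma jump_exp (h : JSQBounds Q lam mu K) (i : Z) (q : Fin n → ℕ) (θ : ℝ) :
    jump lam mu i q (fun q' => Real.exp (-θ * qSum q') - Real.exp (-θ * qSum q))
      = (Real.exp θ - 1) * (Real.exp (-θ * qSum q) *
        (muTot mu i - lam i + (1 - Real.exp (-θ)) * lam i - unused mu i q)) := by
  have h1 : ∀ j, (if q j = 0 then 0 else mu i j *
      (Real.exp (-θ * qSum (q - Pi.single j 1)) - Real.exp (-θ * qSum q)))
      = if q j = 0 then 0 else mu i j * (Real.exp (-θ * qSum q) * (Real.exp θ - 1)) := fun j => by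
    split_ifs with hj
    · rfl
    · rw [qSum_sub_single hj,
        show -θ * (qSum q - 1) = -θ * qSum q + θ by ring, Real.exp_add]
      ring
  have h2 : ∀ j, Real.exp (-θ * qSum (q + Pi.single j 1)) - Real.exp (-θ * qSum q)
      = Real.exp (-θ * qSum q) * (Real.exp (-θ) - 1) := fun j => by
    rw [qSum_add_single, mul_add, Real.exp_add, mul_one]; ring
  rw [jump, Finset.sum_congr rfl fun j _ => h1 j]
  simp only [h2]
  rw [sum_shortest_const h, sum_served]
  have h3 : Real.exp θ * Real.exp (-θ) = 1 := by rw [← Real.exp_add]; simp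
  linear_combination lam i * Real.exp (-θ * qSum q) * h3

/-- Drift of the squared distance from the diagonal. -/
lemma jump_perpSq_le (h : JSQBounds Q lam mu K) (i : Z) (q : Fin n → ℕ) :
    jump lam mu i q (fun q' => perpSq q' - perpSq q) ≤ -2 * sscGap lam mu i * qGap q + 2 * K := by
  have hn := h.servers
  have hn1 : (0 : ℝ) ≤ 1 / n := by positivity
  have h1 : ∑ j ∈ shortest q, lam i / ((shortest q).card : ℝ)
      * (perpSq (q + Pi.single j 1) - perpSq q) = lam i * (-2 * qGap q + (1 - 1 / n)) := by
    rw [← sum_shortest_const h i q]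
    refine Finset.sum_congr rfl fun j hj => ?_
    rw [perpSq_add_single hn, eq_qMin_of_mem_shortest hn hj, qGap]
    ring
  have hmin : ∀ j, muMin mu i ≤ mu i j := fun j => ciInf_le (Set.finite_range _).bddBelow j
  -- Each service rate splits into the minimal rate, whose contribution cancels because the
  -- deviations sum to zero, and an excess, for which the deviation is at least `-qGap q`. For an
  -- idle server the bound persists since its deviation is nonpositive.
  have h2 : ∀ j, (if q j = 0 then 0 else mu i j * (perpSq (q - Pi.single j 1) - perpSq q))
      ≤ 2 * ((mu i j - muMin mu i) * qGap q) - 2 * (muMin mu i * ((q j : ℝ) - qAvg q))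
        + mu i j := by
    intro j
    have hd : -qGap q ≤ (q j : ℝ) - qAvg q := by rw [qGap]; linarith [qMin_le q j]
    have hm := h.mu_nonneg i j
    have h3 := mul_le_mul_of_nonneg_left hd (sub_nonneg.2 (hmin j))
    split_ifs with hj
    · have : (q j : ℝ) - qAvg q ≤ 0 := by
        rw [hj, qAvg]
        simp only [Nat.cast_zero, zero_sub, Left.neg_nonpos_iff]
        exact div_nonneg (qSum_nonneg q) (Nat.cast_nonneg _)
      nlinarith
    · rw [perpSq_sub_single hn hj]
      nlinarith
  have h3 := Finset.sum_le_sum (s := Finset.univ) fun j _ => h2 j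
  rw [Finset.sum_add_distrib, Finset.sum_sub_distrib, ← Finset.mul_sum, ← Finset.mul_sum,
    ← Finset.sum_mul, ← Finset.mul_sum, Finset.sum_sub_distrib, Finset.sum_sub_distrib] at h3
  have h4 : ∑ j, (q j : ℝ) = n * qAvg q := qSum_eq_mul_qAvg hn q
  rw [h4] at h3
  simp only [Finset.sum_const, Finset.card_univ, Fintype.card_fin, nsmul_eq_mul, sub_self,
    mul_zero, sub_zero] at h3
  change _ ≤ 2 * ((muTot mu i - _) * _) + muTot mu i at h3
  rw [jump, h1, sscGap]
  have := h.lam_le i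
  have := h.muTot_le i
  have := mul_nonneg (h.lam_nonneg i) hn1
  linarith

/-- Antiderivatives of monotone functions are convex. -/
lemma integral_sub_le_of_monotone {φ : ℝ → ℝ} (hφ : Monotone φ) (a b : ℝ) :
    φ a * (b - a) ≤ (∫ x in (0 : ℝ)..b, φ x) - ∫ x in (0 : ℝ)..a, φ x := by
  rw [intervalIntegral.integral_interval_sub_left hφ.intervalIntegrable hφ.intervalIntegrable]
  rcases le_total a b with hab | hab
  · have := intervalIntegral.integral_mono_on (f := fun _ => φ a) hab
      (intervalIntegrable_const) (hφ.intervalIntegrable (μ := volume)) fun x hx => hφ hx.1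
    rw [intervalIntegral.integral_const, smul_eq_mul] at this
    linarith
  · have := intervalIntegral.integral_mono_on (g := fun _ => φ a) hab
      (hφ.intervalIntegrable (μ := volume)) (intervalIntegrable_const) fun x hx => hφ hx.2
    rw [intervalIntegral.integral_const, smul_eq_mul] at this
    rw [intervalIntegral.integral_symm]
    linarith

/-- Drift of a convex function of the distance from the diagonal. -/
lemma jump_integral_perp_le (h : JSQBounds Q lam mu K) (i : Z) (q : Fin n → ℕ) {φ : ℝ → ℝ}
    (hφ : Monotone φ) (h0 : 0 ≤ φ (perp q)) {r : ℝ}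
    (hr : ∀ q', Nbr q q' → |φ (perp q') - φ (perp q)| ≤ r) (hr0 : 0 ≤ r) :
    jump lam mu i q (fun q' => (∫ x in (0 : ℝ)..perp q', φ x) - ∫ x in (0 : ℝ)..perp q, φ x)
      ≤ -sscGap lam mu i * (φ (perp q) / perp q * qGap q) + K * (φ (perp q) / perp q)
        + 2 * K * r := by
  set ρ := φ (perp q) / perp q with hρ
  have hN := perp_pos q
  have hρ0 : 0 ≤ ρ := div_nonneg h0 hN.le
  -- Convexity is applied with slope `φ` at the new point; moving the slope back to `perp q` costs
  -- at most `r`, and `perp_mul_sub_le` then brings in `perpSq`.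
  have h1 : ∀ q', Nbr q q' →
      (∫ x in (0 : ℝ)..perp q', φ x) - (∫ x in (0 : ℝ)..perp q, φ x)
        ≤ ρ / 2 * (perpSq q' - perpSq q) + r := by
    intro q' hq
    have e1 := integral_sub_le_of_monotone hφ (perp q') (perp q)
    have e2 := hr q' hq
    have e3 := abs_perp_sub_le h.servers hq
    have e4 : (φ (perp q') - φ (perp q)) * (perp q' - perp q) ≤ r := by
      refine (le_abs_self _).trans ?_
      rw [abs_mul]
      nlinarith [abs_nonneg (φ (perp q') - φ (perp q))]
    have e5 := mul_le_mul_of_nonneg_left (perp_mul_sub_le q q') (by positivity : 0 ≤ ρ / 2)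
    have e6 : ρ / 2 * (2 * perp q * (perp q' - perp q)) = φ (perp q) * (perp q' - perp q) := by
      rw [hρ]; field_simp
    linarith
  refine (jump_mono h i q h1).trans ?_
  rw [jump_add, jump_const_mul]
  have h2 := jump_const_le h i q hr0
  have h3 := mul_le_mul_of_nonneg_left (jump_perpSq_le h i q) (by positivity : 0 ≤ ρ / 2)
  linarith

end Drift

/-! ### Existence of a stationary law for the JSQ system -/

section JSQExistence

variable {Z : Type*} [Countable Z] [MeasurableSpace Z] [MeasurableSingletonClass Z] {n : ℕ}
  {Q : Z → Z → ℝ} {lam : Z → ℝ} {mu : Z → Fin n → ℝ} {K : ℝ} {p : Measure Z}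
  [IsProbabilityMeasure p]

lemma gen_jsqRate_fst (h : JSQBounds Q lam mu K) {v : Z → ℝ} {B : ℝ} (hv : ∀ i, |v i| ≤ B)
    (x : Z × (Fin n → ℕ)) : gen (jsqRate Q lam mu) (fun x => v x.1) x = gen Q v x.1 := by
  have := gen_jsqRate_mul h v (fun _ => 1) x.1 x.2 (h.rates.summable_mul hv x.1)
  have h0 : jump lam mu x.1 x.2 (fun _ => (0 : ℝ)) = 0 := by simp [jump]
  simpa [h0] using this

lemma gen_jsqRate_snd (h : JSQBounds Q lam mu K) (g : (Fin n → ℕ) → ℝ)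
    (x : Z × (Fin n → ℕ)) : gen (jsqRate Q lam mu) (fun x => g x.2) x
      = jump lam mu x.1 x.2 fun q' => g q' - g x.2 := by
  have := gen_jsqRate_mul h (fun _ => 1) g x.1 x.2
    (h.rates.summable_mul (B := 1) (by simp) x.1)
  simpa [gen] using this

lemma map_fst_eq_of_integral {ν : Measure (Z × (Fin n → ℕ))} [IsProbabilityMeasure ν]
    (hν : ∀ (v : Z → ℝ) (B : ℝ), (∀ i, |v i| ≤ B) → ∫ x, v x.1 ∂ν = ∫ i, v i ∂p) :
    ν.map Prod.fst = p := by
  have : IsProbabilityMeasure (ν.map Prod.fst) :=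
    Measure.isProbabilityMeasure_map measurable_fst.aemeasurable
  refine Measure.ext_of_singleton fun z => ?_
  have h1 := hν (({z} : Set Z).indicator 1) 1 fun i => by
    by_cases hi : i = z <;> simp [hi]
  rw [← integral_map measurable_fst.aemeasurable Measurable.of_discrete.aestronglyMeasurable,
    integral_indicator_one (measurableSet_singleton z),
    integral_indicator_one (measurableSet_singleton z)] at h1
  exact (measureReal_eq_measureReal_iff).1 h1

/-- Laws with first marginal `p` under which functions of the queue lengths with bounded
increments have almost nonnegative drift. -/
lemma exists_almost_stationary (h : JSQBounds Q lam mu K) (hp : IsStationary Q p) :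
    ∃ (Λ : ℝ) (ν : ℕ → ProbabilityMeasure (Z × (Fin n → ℕ))), 0 < Λ ∧
      (∀ T, (ν T : Measure (Z × (Fin n → ℕ))).map Prod.fst = p) ∧
      (∀ T z, |∫ x, gen (jsqRate Q lam mu) (({z} : Set (Z × (Fin n → ℕ))).indicator 1) x
        ∂(ν T : Measure (Z × (Fin n → ℕ)))| ≤ Λ / (T + 1)) ∧
      ∀ (T : ℕ) (g : (Fin n → ℕ) → ℝ) (B : ℝ), (∀ q, 0 ≤ g q) →
        (∀ q q', Nbr q q' → |g q' - g q| ≤ B) →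
        -(Λ / (T + 1) * g 0) ≤ ∫ x : Z × (Fin n → ℕ),
          jump lam mu x.1 x.2 (fun q' => g q' - g x.2) ∂(ν T : Measure (Z × (Fin n → ℕ))) := by
  have hG := boundedRates_jsqRate h
  -- Starting with modulating law `p` keeps that marginal at all times. Starting empty makes `g 0`
  -- the only cost in the telescoped drift bound.
  let ν₀ : ProbabilityMeasure (Z × (Fin n → ℕ)) :=
    ⟨p.prod (Measure.dirac 0), inferInstance⟩
  have hν₀ : ∀ f : Z × (Fin n → ℕ) → ℝ, (∃ B, ∀ x, |f x| ≤ B) →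
      ∫ x, f x ∂(ν₀ : Measure (Z × (Fin n → ℕ))) = ∫ i, f (i, 0) ∂p := by
    rintro f ⟨B, hB⟩
    change ∫ x, f x ∂(p.prod (Measure.dirac 0)) = _
    rw [integral_prod _ (integrable_of_bounded hB)]
    simp
  obtain ⟨Λ, μ, ν, hΛ, h1, h2⟩ := exists_cesaro hG ν₀
  refine ⟨Λ, ν, hΛ, fun T => ?_, fun T z => ?_, fun T g B hg0 hg => ?_⟩
  · refine map_fst_eq_of_integral fun v B hv => ?_
    have := h2 {f | ∃ (v : Z → ℝ) (B : ℝ), (∀ i, |v i| ≤ B) ∧ f = fun x => v x.1} ?_ ?_ ?_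
      (fun x => v x.1) ⟨v, B, hv, rfl⟩ T
    · rw [this, hν₀ _ ⟨B, fun x => hv x.1⟩]
    · rintro f ⟨v, B, hv, rfl⟩
      exact ⟨B, fun x => hv x.1⟩
    · rintro f ⟨v, B, hv, rfl⟩
      exact ⟨gen Q v, K * (2 * B), h.rates.abs_gen_le hv, funext fun x => gen_jsqRate_fst h hv x⟩
    · rintro f ⟨v, B, hv, rfl⟩
      rw [hν₀ _ ⟨_, hG.abs_gen_le fun x => hv x.1⟩]
      simp_rw [gen_jsqRate_fst h hv]
      exact (hp.integral_gen h.rates (integrable_of_bounded hv)).2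
  · have hb : ∀ x, |({z} : Set (Z × (Fin n → ℕ))).indicator (1 : Z × (Fin n → ℕ) → ℝ) x| ≤ 1 :=
      fun x => by by_cases hx : x = z <;> simp [hx]
    have hz : MeasurableSet ({z} : Set (Z × (Fin n → ℕ))) := measurableSet_singleton z
    rw [h1 T _ 1 hb, integral_indicator_one hz, integral_indicator_one hz, abs_mul,
      abs_of_nonneg (by positivity)]
    refine mul_le_of_le_one_right (by positivity) ?_
    have e1 := measureReal_le_one (μ := (μ T : Measure (Z × (Fin n → ℕ)))) (s := {z})
    have e2 := measureReal_le_one (μ := (ν₀ : Measure (Z × (Fin n → ℕ)))) (s := {z})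
    have e3 := measureReal_nonneg (μ := (μ T : Measure (Z × (Fin n → ℕ)))) (s := {z})
    have e4 := measureReal_nonneg (μ := (ν₀ : Measure (Z × (Fin n → ℕ)))) (s := {z})
    rw [abs_le]
    constructor <;> linarith
  · refine ge_of_tendsto (tendsto_integral_jump_min h _ hg) (Eventually.of_forall fun M => ?_)
    have hb : ∀ x : Z × (Fin n → ℕ), |min (g x.2) (M : ℝ)| ≤ M := fun x => by
      rw [abs_of_nonneg (le_min (hg0 _) (Nat.cast_nonneg M))]
      exact min_le_right _ _
    have e1 := h1 T (fun x => min (g x.2) M) M hb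
    have e2 : ∀ x : Z × (Fin n → ℕ), gen (jsqRate Q lam mu) (fun x => min (g x.2) (M : ℝ)) x
      = jump lam mu x.1 x.2 fun q' => min (g q') M - min (g x.2) M :=
        gen_jsqRate_snd h fun q => min (g q) (M : ℝ)
    simp_rw [e2] at e1
    rw [e1, hν₀ _ ⟨M, hb⟩]
    have e3 : 0 ≤ ∫ x : Z × (Fin n → ℕ), min (g x.2) (M : ℝ) ∂(μ T : Measure _) :=
      integral_nonneg fun x => le_min (hg0 _) (Nat.cast_nonneg M)
    simp only [integral_const, probReal_univ, smul_eq_mul, one_mul]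
    have e4 : min (g 0) (M : ℝ) ≤ g 0 := min_le_left _ _
    rw [← mul_neg]
    exact mul_le_mul_of_nonneg_left (by linarith) (by positivity)

lemma perp_zero : perp (0 : Fin n → ℕ) = 1 := by
  simp [perp, perpSq, qAvg, qSum]

lemma abs_integral_sub_le_of_bounded {φ : ℝ → ℝ} (hφ : Monotone φ) {B : ℝ}
    (hB : ∀ x, |φ x| ≤ B) (a b : ℝ) :
    |(∫ x in (0 : ℝ)..b, φ x) - ∫ x in (0 : ℝ)..a, φ x| ≤ B * |b - a| := by
  rw [intervalIntegral.integral_interval_sub_left hφ.intervalIntegrable hφ.intervalIntegrable]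
  exact intervalIntegral.norm_integral_le_of_norm_le_const (f := φ) fun x _ => hB x

/-- The JSQ system has a stationary distribution when the SSC load condition holds and the mean
arrival rate is smaller than the mean service rate. -/
theorem exists_isStationary_jsqRate (h : JSQBounds Q lam mu K) (hp : IsStationary Q p)
    (hssc : ∀ i, 0 < sscGap lam mu i) (hload : 0 < ∫ i, (muTot mu i - lam i) ∂p) :
    ∃ ν : ProbabilityMeasure (Z × (Fin n → ℕ)),
      IsStationary (jsqRate Q lam mu) (ν : Measure (Z × (Fin n → ℕ))) := by
  classical
  obtain ⟨Λ, ν, hΛ, hmarg, hind, hdrift⟩ := exists_almost_stationary h hp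
  set ρ := ∫ i, (muTot mu i - lam i) ∂p with hρ
  have hn := h.servers
  have hn0 : (0 : ℝ) < n := by positivity
  have hmuTot : ∀ i, 0 ≤ muTot mu i := fun i => Finset.sum_nonneg fun j _ => h.mu_nonneg i j
  have hle : ∀ i, |muTot mu i - lam i| ≤ K := fun i => by
    rw [abs_le]
    constructor <;> linarith [h.lam_nonneg i, h.lam_le i, h.muTot_le i, hmuTot i]
  have hKρ : ρ ≤ K := by
    have := integral_mono (integrable_of_bounded (ν := p) hle) (integrable_const K)
      fun i => (le_abs_self _).trans (hle i)
    simpa using this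
  have hK : 0 < K := hload.trans_le hKρ
  -- a finite set of modulating states that carries most of the mass
  have hsum : HasSum (fun i => p.real {i}) 1 := by
    have := integral_eq_tsum_real (integrable_const (μ := p) (1 : ℝ))
    simp only [integral_const, probReal_univ, smul_eq_mul, mul_one] at this
    rw [this]
    exact (summable_real_singleton p).hasSum
  obtain ⟨F, hF⟩ : ∃ F : Finset Z, 1 - ρ / (4 * K) < ∑ i ∈ F, p.real {i} :=
    (hsum.eventually (lt_mem_nhds (sub_lt_self _ (by positivity)))).exists
  obtain ⟨d, hd, hdF⟩ : ∃ d > 0, ∀ i ∈ F, d ≤ sscGap lam mu i := by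
    rcases F.eq_empty_or_nonempty with hFe | hFn
    · exact ⟨1, one_pos, by simp [hFe]⟩
    · obtain ⟨i, hi, him⟩ := F.exists_min_image (sscGap lam mu) hFn
      exact ⟨_, hssc i, him⟩
  -- `M` makes the drift error `3 * K / M`, times the factor `K * (2 * n / d)` that converts `D`
  -- into lost capacity, cost at most `ρ / 4`.
  obtain ⟨M, hM2, hM⟩ : ∃ M : ℝ, 2 ≤ M ∧ K * (2 * n / d) * (3 * K / M) ≤ ρ / 4 := by
    refine ⟨max 2 (K * (2 * n / d) * (3 * K) / (ρ / 4)), le_max_left _ _, ?_⟩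
    have hpos : (0 : ℝ) < max 2 (K * (2 * n / d) * (3 * K) / (ρ / 4)) :=
      two_pos.trans_le (le_max_left _ _)
    rw [← mul_div_assoc, div_le_iff₀ hpos, ← div_le_iff₀' (by positivity)]
    exact le_max_right _ _
  have hM0 : 0 < M := two_pos.trans_le hM2
  -- A ramp of width `M`: its slope makes the oscillation at most `1 / M`, its boundedness gives `g`
  -- bounded increments, and its value one beyond `M` lets `D` detect large imbalance.
  let φ : ℝ → ℝ := fun x => min 1 (max x 0 / M)
  have hφ : Monotone φ := fun a b hab =>
    min_le_min le_rfl (div_le_div_of_nonneg_right (max_le_max hab le_rfl) hM0.le)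
  have hφ0 : ∀ x, 0 ≤ φ x := fun x => le_min zero_le_one (by positivity)
  have hφ1 : ∀ x, φ x ≤ 1 := fun x => min_le_left _ _
  have hφabs : ∀ x, |φ x| ≤ 1 := fun x => by rw [abs_of_nonneg (hφ0 x)]; exact hφ1 x
  have hφosc : ∀ a b, |b - a| ≤ 1 → |φ b - φ a| ≤ 1 / M := fun a b hab => by
    have e1 : |φ b - φ a| ≤ |max b 0 / M - max a 0 / M| := by
      simpa [φ, min_comm] using abs_min_sub_min_le (max b 0 / M) (max a 0 / M) 1
    have e2 : |max b 0 - max a 0| ≤ |b - a| := by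
      simpa using abs_max_sub_max_le_max b 0 a 0
    rw [← sub_div, abs_div, abs_of_pos hM0] at e1
    exact e1.trans (div_le_div_of_nonneg_right (e2.trans hab) hM0.le)
  have hφdiv : ∀ q : Fin n → ℕ, φ (perp q) / perp q ≤ 1 / M := fun q => by
    have hN := perp_pos q
    rw [div_le_iff₀ hN]
    refine (min_le_right _ _).trans (le_of_eq ?_)
    rw [max_eq_left hN.le]; ring
  let g : (Fin n → ℕ) → ℝ := fun q => ∫ x in (0 : ℝ)..perp q, φ x
  have hg0 : ∀ q, 0 ≤ g q := fun q =>
    intervalIntegral.integral_nonneg (perp_pos q).le fun x _ => hφ0 x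
  have hg : ∀ q q', Nbr q q' → |g q' - g q| ≤ 1 := fun q q' hq =>
    (abs_integral_sub_le_of_bounded hφ hφabs _ _).trans
      (by rw [one_mul]; exact abs_perp_sub_le hn hq)
  have hgz : g 0 ≤ 1 := by
    have := abs_integral_sub_le_of_bounded hφ hφabs 0 1
    simp only [intervalIntegral.integral_same, sub_zero, abs_one, mul_one] at this
    simp only [g, perp_zero]
    exact (le_abs_self _).trans this
  let D : Z × (Fin n → ℕ) → ℝ := fun x =>
    sscGap lam mu x.1 * (φ (perp x.2) / perp x.2 * qGap x.2)
  have hD0 : ∀ x, 0 ≤ D x := fun x => mul_nonneg (hssc x.1).le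
    (mul_nonneg (div_nonneg (hφ0 _) (perp_pos _).le) (qGap_nonneg hn _))
  have hgapK : ∀ i, sscGap lam mu i ≤ (1 + n) * K := fun i => by
    have hmin : muMin mu i ≤ K := by
      have : muMin mu i ≤ mu i ⟨0, hn⟩ := ciInf_le (Set.finite_range _).bddBelow _
      exact this.trans ((Finset.single_le_sum (fun j _ => h.mu_nonneg i j)
        (Finset.mem_univ _)).trans (h.muTot_le i))
    have := mul_le_mul_of_nonneg_left hmin hn0.le
    rw [sscGap]
    linarith [h.lam_le i, hmuTot i]
  have hDint : ∀ T, Integrable D (ν T : Measure (Z × (Fin n → ℕ))) := fun T =>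
    integrable_of_bounded (B := (1 + n) * K * 1) fun x => by
      rw [abs_of_nonneg (hD0 x)]
      refine mul_le_mul (hgapK _) ?_ (mul_nonneg (div_nonneg (hφ0 _) (perp_pos _).le)
        (qGap_nonneg hn _)) (by positivity)
      rw [div_mul_eq_mul_div, div_le_one (perp_pos _)]
      exact (mul_le_of_le_one_left (qGap_nonneg hn _) (hφ1 _)).trans (qGap_le_perp hn _)
  have hDle : ∀ T : ℕ, ∫ x, D x ∂(ν T : Measure (Z × (Fin n → ℕ))) ≤ 3 * K / M + Λ / (T + 1) := by
    intro T
    have e1 := hdrift T g 1 hg0 hg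
    have e2 : ∀ x : Z × (Fin n → ℕ), jump lam mu x.1 x.2 (fun q' => g q' - g x.2)
        ≤ -D x + 3 * K / M := fun x => by
      have e3 := jump_integral_perp_le h x.1 x.2 hφ (hφ0 _)
        (fun q' hq => hφosc _ _ (abs_perp_sub_le hn hq)) (by positivity)
      have e4 := mul_le_mul_of_nonneg_left (hφdiv x.2) hK.le
      have e5 : 3 * K / M = K * (1 / M) + 2 * K * (1 / M) := by ring
      simp only [g, D]
      rw [e5]
      linarith
    have hi : Integrable (fun x : Z × (Fin n → ℕ) =>
        jump lam mu x.1 x.2 (fun q' => g q' - g x.2)) (ν T : Measure (Z × (Fin n → ℕ))) :=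
      integrable_of_bounded (B := 2 * K * 1) fun x =>
        abs_jump_le h _ _ zero_le_one fun q' hq => hg _ _ hq
    have e3 := integral_mono hi ((hDint T).neg.add (integrable_const (3 * K / M))) e2
    rw [integral_add' (hDint T).neg (integrable_const _), integral_neg', integral_const,
      probReal_univ, one_smul] at e3
    have e4 : Λ / (T + 1) * g 0 ≤ Λ / (T + 1) := mul_le_of_le_one_right (by positivity) hgz
    linarith
  have huint : ∀ T, Integrable (fun x : Z × (Fin n → ℕ) => unused mu x.1 x.2)
      (ν T : Measure (Z × (Fin n → ℕ))) := fun T =>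
    integrable_of_bounded (B := K) fun x => by
      rw [abs_of_nonneg (unused_nonneg h _ _)]; exact unused_le h _ _
  have hu : ∀ T : ℕ, ρ ≤ ∫ x : Z × (Fin n → ℕ), unused mu x.1 x.2
      ∂(ν T : Measure (Z × (Fin n → ℕ))) := by
    intro T
    have e1 := hdrift T qSum 1 qSum_nonneg fun q q' hq => abs_qSum_sub_le hq
    simp_rw [jump_qSum h] at e1
    have e0 : qSum (0 : Fin n → ℕ) = 0 := by simp [qSum]
    have e2 : Integrable (fun x : Z × (Fin n → ℕ) => muTot mu x.1 - lam x.1)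
      (ν T : Measure (Z × (Fin n → ℕ))) := integrable_of_bounded fun x => hle x.1
    have e3 : ∫ x : Z × (Fin n → ℕ), (muTot mu x.1 - lam x.1)
        ∂(ν T : Measure (Z × (Fin n → ℕ))) = ρ :=
      integral_fst (hmarg T) fun i => muTot mu i - lam i
    have e4 : ∀ x : Z × (Fin n → ℕ), lam x.1 - muTot mu x.1 + unused mu x.1 x.2
      = unused mu x.1 x.2 - (muTot mu x.1 - lam x.1) := fun x => by ring
    simp_rw [e4] at e1
    rw [e0, integral_sub (huint T) e2, e3] at e1
    linarith
  let E : Finset (Z × (Fin n → ℕ)) :=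
    F ×ˢ Fintype.piFinset fun _ => Finset.range (⌈2 * M⌉₊ + 1)
  -- Lost capacity is charged to a modulating state outside `F`, to an imbalance of at least `M`
  -- (then `D ≥ d / (2 * n)`), or to `E`: with smaller imbalance and an empty queue, every queue is
  -- at most `2 * M`.
  have hpt : ∀ x : Z × (Fin n → ℕ), unused mu x.1 x.2 ≤
      K * (E : Set (Z × (Fin n → ℕ))).indicator 1 x
        + K * ((F : Set Z)ᶜ).indicator 1 x.1 + K * (2 * n / d) * D x := by
    rintro ⟨i, q⟩
    have hu := unused_le h i q
    have i1 : 0 ≤ (E : Set (Z × (Fin n → ℕ))).indicator (1 : Z × (Fin n → ℕ) → ℝ) (i, q) :=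
      indicator_nonneg (fun _ _ => zero_le_one) _
    have i2 : 0 ≤ ((F : Set Z)ᶜ).indicator (1 : Z → ℝ) i :=
      indicator_nonneg (fun _ _ => zero_le_one) _
    have i3 : 0 ≤ K * (2 * n / d) * D (i, q) := mul_nonneg (by positivity) (hD0 _)
    have j1 := mul_nonneg hK.le i1
    have j2 := mul_nonneg hK.le i2
    by_cases hi : i ∈ F
    · rcases le_or_gt M (perp q) with hMq | hMq
      · have hN := perp_pos q
        have e1 : φ (perp q) = 1 := min_eq_left (by
          rw [max_eq_left hN.le, one_le_div hM0]; exact hMq)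
        have e2 := perp_le hn q
        have e3 : 1 / (2 * n) ≤ 1 / perp q * qGap q := by
          rw [one_div_mul_eq_div, div_le_div_iff₀ (by positivity) hN]
          nlinarith
        have e4 : d * (1 / (2 * n)) ≤ D (i, q) := by
          simp only [D, e1]
          exact mul_le_mul (hdF i hi) e3 (by positivity) (hssc i).le
        have e5 : K ≤ K * (2 * n / d) * D (i, q) := by
          calc K = K * (2 * n / d) * (d * (1 / (2 * n))) := by field_simp
            _ ≤ _ := mul_le_mul_of_nonneg_left e4 (by positivity)
        simp only at *
        linarith
      · rcases (qMin_nonneg q).eq_or_lt with h0 | h0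
        · have hmem : (i, q) ∈ (E : Set (Z × (Fin n → ℕ))) := by
            rw [Finset.mem_coe, Finset.mem_product]
            refine ⟨hi, Fintype.mem_piFinset.2 fun j => ?_⟩
            rw [Finset.mem_range, Nat.lt_add_one_iff]
            have e1 := abs_sub_qAvg_le q j
            have e2 := qGap_le_perp hn q
            rw [qGap, ← h0, sub_zero] at e2
            have e3 : (q j : ℝ) ≤ 2 * M := by linarith [le_abs_self ((q j : ℝ) - qAvg q)]
            exact_mod_cast e3.trans (Nat.le_ceil _)
          rw [indicator_of_mem hmem] at *
          simp only [Pi.one_apply, mul_one] at *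
          linarith
        · rw [unused_eq_zero h0]
          positivity
    · have hmem : i ∈ (F : Set Z)ᶜ := by simpa using hi
      simp only [indicator_of_mem hmem, Pi.one_apply, mul_one] at *
      linarith
  have hFc : ∫ i, ((F : Set Z)ᶜ).indicator (1 : Z → ℝ) i ∂p ≤ ρ / (4 * K) := by
    rw [integral_indicator_one F.measurableSet.compl, probReal_compl_eq_one_sub F.measurableSet,
      ← sum_measureReal_singleton]
    linarith
  refine exists_isStationary_of_approx (boundedRates_jsqRate h) ν (c := fun T => Λ / (T + 1))
    (κ := ρ / (4 * K)) ?_ hind E (by positivity) ?_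
  · exact tendsto_const_div_atTop_nhds_zero_nat Λ |>.comp (tendsto_add_atTop_nat 1) |>.congr
      fun T => by simp
  · have ht : Tendsto (fun T : ℕ => K * (2 * n / d) * (Λ / (T + 1))) atTop (𝓝 0) := by
      have : Tendsto (fun T : ℕ => Λ / ((T : ℝ) + 1)) atTop (𝓝 0) :=
        tendsto_const_div_atTop_nhds_zero_nat Λ |>.comp (tendsto_add_atTop_nat 1) |>.congr
          fun T => by simp
      simpa using this.const_mul (K * (2 * n / d))
    -- Of the lost capacity `ρ`, modulating states outside `F`, the drift error and the finite
    -- horizon account for at most `ρ / 4` each. The remaining quarter must be carried by `E`.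
    filter_upwards [ht.eventually (gt_mem_nhds (by positivity : 0 < ρ / 4))] with T hT
    have hEint : Integrable ((E : Set (Z × (Fin n → ℕ))).indicator (1 : Z × (Fin n → ℕ) → ℝ))
        (ν T : Measure (Z × (Fin n → ℕ))) :=
      (integrable_const (1 : ℝ)).indicator E.measurableSet
    have hFint : Integrable (fun x : Z × (Fin n → ℕ) => ((F : Set Z)ᶜ).indicator (1 : Z → ℝ) x.1)
        (ν T : Measure (Z × (Fin n → ℕ))) := integrable_fst (hmarg T)
      ((integrable_const (1 : ℝ)).indicator F.measurableSet.compl)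
    have e1 := integral_mono (huint T)
      (((hEint.const_mul K).add (hFint.const_mul K)).add ((hDint T).const_mul (K * (2 * n / d))))
      hpt
    rw [integral_add' ((hEint.const_mul K).add (hFint.const_mul K))
      ((hDint T).const_mul (K * (2 * n / d))),
      integral_add' (hEint.const_mul K) (hFint.const_mul K), integral_const_mul,
      integral_const_mul, integral_const_mul, integral_indicator_one E.measurableSet,
      integral_fst (hmarg T) (((F : Set Z)ᶜ).indicator (1 : Z → ℝ))] at e1
    rw [sum_measureReal_singleton]
    have e2 := hu T
    have e3 := mul_le_mul_of_nonneg_left (hDle T) (by positivity : 0 ≤ K * (2 * n / d))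
    have e4 := mul_le_mul_of_nonneg_left hFc hK.le
    have e5 : K * (ρ / (4 * K)) = ρ / 4 := by field_simp
    rw [div_le_iff₀ (by positivity)]
    rw [mul_add] at e3
    rw [e5] at e4
    linarith

end JSQExistence

/-! ### Inequalities for powers and truncated moments -/

section Powers

/-- Bernoulli's inequality at `u / v`, multiplied by `v ^ (1 + a)`. -/
lemma rpow_one_add_sub_le {a u v : ℝ} (ha : 0 ≤ a) (hu : 0 ≤ u) (hv : 0 < v) :
    v ^ (1 + a) - u ^ (1 + a) ≤ (1 + a) * v ^ a * (v - u) := by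
  have h1 := one_add_mul_self_le_rpow_one_add (s := u / v - 1) (p := 1 + a)
    (by have := div_nonneg hu hv.le; linarith) (by linarith)
  rw [add_sub_cancel, Real.div_rpow hu hv.le, le_div_iff₀ (by positivity)] at h1
  have h2 : v ^ (1 + a) = v * v ^ a := by rw [Real.rpow_add hv, Real.rpow_one]
  have h3 : (1 + (1 + a) * (u / v - 1)) * v ^ (1 + a)
      = v ^ (1 + a) - (1 + a) * v ^ a * (v - u) := by
    rw [h2]; field_simp; ring
  linarith

/-- A Young-type inequality, by comparing `A` with `κ * y`. It absorbs errors of order `y ^ a` into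
a negative drift of order `y ^ (1 + a)`, at the price of a moment of `A`. -/
lemma mul_rpow_le_add {a A y κ : ℝ} (ha : 0 < a) (hA : 0 ≤ A) (hy : 0 < y) (hκ : 0 < κ) :
    A * y ^ a ≤ κ * y ^ (1 + a) + κ ^ (-a) * A ^ (1 + a) := by
  rcases le_or_gt A (κ * y) with h | h
  · have h1 : A * y ^ a ≤ κ * y ^ (1 + a) := by
      rw [Real.rpow_add hy, Real.rpow_one, ← mul_assoc]
      exact mul_le_mul_of_nonneg_right h (by positivity)
    have : 0 ≤ κ ^ (-a) * A ^ (1 + a) := by positivity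
    linarith
  · have hA' : 0 < A := lt_trans (by positivity) h
    have h1 : y ^ a ≤ (κ⁻¹ * A) ^ a :=
      Real.rpow_le_rpow hy.le (by rw [le_inv_mul_iff₀ hκ]; exact h.le) ha.le
    have h2 : A * (κ⁻¹ * A) ^ a = κ ^ (-a) * A ^ (1 + a) := by
      rw [Real.mul_rpow (inv_nonneg.2 hκ.le) hA, Real.rpow_add hA', Real.rpow_one,
        Real.inv_rpow hκ.le, Real.rpow_neg hκ.le]
      ring
    have h3 := mul_le_mul_of_nonneg_left h1 hA
    have : 0 ≤ κ * y ^ (1 + a) := by positivity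
    linarith

lemma rpow_le_one_add_rpow {x b c : ℝ} (hx : 0 ≤ x) (hb : 0 ≤ b) (hbc : b ≤ c) :
    x ^ b ≤ 1 + x ^ c := by
  rcases le_total x 1 with h | h
  · have := Real.rpow_le_one hx h hb
    have : 0 ≤ x ^ c := by positivity
    linarith
  · have := Real.rpow_le_rpow_of_exponent_le h hbc
    linarith

/-- Splitting bound: a nonnegative bounded variable of mean `O(ε)` times a variable with a bounded
moment of order `1 + a`. -/
lemma integral_mul_le_rpow {X : Type*} [MeasurableSpace X] {ν : Measure X} {u Y : X → ℝ}
    {a ε K M B : ℝ} (ha : 0 < a) (hε : 0 < ε) (hK : 0 ≤ K) (hu : Integrable u ν)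
    (hu0 : ∀ x, 0 ≤ u x) (huK : ∀ x, u x ≤ K) (hY0 : ∀ x, 0 ≤ Y x)
    (hY : Integrable (fun x => Y x ^ (1 + a)) ν)
    (hM : ∫ x, u x ∂ν ≤ M * ε) (hB : ∫ x, Y x ^ (1 + a) ∂ν ≤ B) :
    ∫ x, u x * Y x ∂ν ≤ (M + K * B) * ε ^ (1 - 1 / (1 + a)) := by
  set γ := ε ^ (1 - 1 / (1 + a)) with hγ
  -- The threshold that balances both parts: where `Y ≤ k` the contribution is of order `k * ε`, and
  -- where `Y > k` of order `k ^ (-a)`; both powers equal `γ`.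
  set k := ε ^ (-(1 / (1 + a))) with hk
  have hk0 : 0 < k := Real.rpow_pos_of_pos hε _
  have h1a : (1 + a) ≠ 0 := by positivity
  have e1 : k * ε = γ := by
    rw [hk, hγ]
    nth_rewrite 2 [← Real.rpow_one ε]
    rw [← Real.rpow_add hε]; congr 1; ring
  have e2 : k ^ (-a) = γ := by
    rw [hk, hγ, ← Real.rpow_mul hε.le]; congr 1; field_simp; ring
  have hpt : ∀ x, u x * Y x ≤ k * u x + K * γ * Y x ^ (1 + a) := by
    intro x
    have hγ0 : 0 ≤ K * γ * Y x ^ (1 + a) := by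
      have := hY0 x
      positivity
    rcases le_or_gt (Y x) k with h | h
    · have := mul_le_mul_of_nonneg_left h (hu0 x)
      linarith
    · have hYp : 0 < Y x := hk0.trans h
      have h2 : Y x ≤ γ * Y x ^ (1 + a) := by
        have h3 : k ^ a ≤ Y x ^ a := Real.rpow_le_rpow hk0.le h.le ha.le
        have h4 : k ^ (-a) * k ^ a = 1 := by rw [← Real.rpow_add hk0]; simp
        rw [e2] at h4
        rw [Real.rpow_add hYp, Real.rpow_one]
        have h5 : 1 ≤ γ * Y x ^ a := by
          rw [← h4]; exact mul_le_mul_of_nonneg_left h3 (by positivity)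
        nlinarith
      have h6 : u x * Y x ≤ K * (γ * Y x ^ (1 + a)) :=
        mul_le_mul (huK x) h2 hYp.le hK
      have := mul_nonneg hk0.le (hu0 x)
      linarith
  have hint : Integrable (fun x => k * u x + K * γ * Y x ^ (1 + a)) ν :=
    (hu.const_mul k).add (hY.const_mul _)
  have h1 : ∫ x, u x * Y x ∂ν ≤ ∫ x, (k * u x + K * γ * Y x ^ (1 + a)) ∂ν :=
    integral_mono_of_nonneg (ae_of_all _ fun x => mul_nonneg (hu0 x) (hY0 x)) hint
      (ae_of_all _ hpt)
  rw [integral_add (hu.const_mul k) (hY.const_mul _), integral_const_mul,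
    integral_const_mul] at h1
  have h2 := mul_le_mul_of_nonneg_left hM hk0.le
  have h3 := mul_le_mul_of_nonneg_left hB (by positivity : 0 ≤ K * γ)
  have h4 : k * (M * ε) = M * γ := by rw [← e1]; ring
  linarith

/-- Fatou's lemma; it yields integrability and the bound together, so neither has to be known
beforehand. -/
lemma integrable_of_truncated_bound {X : Type*} [MeasurableSpace X] {ν : Measure X} {f : X → ℝ}
    (hf : Measurable f) (hf0 : ∀ x, 0 ≤ f x) {F : ℕ → X → ℝ} (hF : ∀ L, Integrable (F L) ν)
    (hF0 : ∀ L x, 0 ≤ F L x) (hlim : ∀ x, Tendsto (fun L => F L x) atTop (𝓝 (f x))) {B : ℝ}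
    (hB : ∀ᶠ L in atTop, ∫ x, F L x ∂ν ≤ B) : Integrable f ν ∧ ∫ x, f x ∂ν ≤ B := by
  have h1 : ∫⁻ x, ENNReal.ofReal (f x) ∂ν ≤ ENNReal.ofReal B := by
    calc ∫⁻ x, ENNReal.ofReal (f x) ∂ν
        = ∫⁻ x, liminf (fun L => ENNReal.ofReal (F L x)) atTop ∂ν := by
          refine lintegral_congr fun x => ?_
          exact ((ENNReal.continuous_ofReal.tendsto _).comp (hlim x)).liminf_eq.symm
      _ ≤ liminf (fun L => ∫⁻ x, ENNReal.ofReal (F L x) ∂ν) atTop :=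
          lintegral_liminf_le' fun L => (hF L).aestronglyMeasurable.aemeasurable.ennreal_ofReal
      _ ≤ ENNReal.ofReal B := by
          refine (liminf_le_liminf (v := fun _ => ENNReal.ofReal B) ?_).trans
            (by rw [liminf_const])
          filter_upwards [hB] with L hL
          rw [← ofReal_integral_eq_lintegral_ofReal (hF L) (ae_of_all _ (hF0 L))]
          exact ENNReal.ofReal_le_ofReal hL
  have hi : Integrable f ν := by
    refine ⟨hf.aestronglyMeasurable, ?_⟩
    rw [hasFiniteIntegral_iff_ofReal (ae_of_all _ hf0)]
    exact h1.trans_lt ENNReal.ofReal_lt_top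
  obtain ⟨L, hL⟩ := hB.exists
  have hB0 : 0 ≤ B := (integral_nonneg (hF0 L)).trans hL
  refine ⟨hi, ?_⟩
  rw [← ENNReal.ofReal_le_ofReal_iff hB0,
    ofReal_integral_eq_lintegral_ofReal hi (ae_of_all _ hf0)]
  exact h1

end Powers

/-! ### State space collapse with a corrector on the modulating space -/

section Collapse

variable {Z : Type*} [Countable Z] [MeasurableSpace Z] [MeasurableSingletonClass Z] {n : ℕ}
  {Q : Z → Z → ℝ} {lam : Z → ℝ} {mu : Z → Fin n → ℝ} {K : ℝ} {p : Measure Z}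
  [IsProbabilityMeasure p]

/-- The mean unused capacity. -/
lemma integral_unused (h : JSQBounds Q lam mu K) {ν : Measure (Z × (Fin n → ℕ))}
    [IsProbabilityMeasure ν] (hm : ν.map Prod.fst = p)
    (hν : IsStationary (jsqRate Q lam mu) ν) :
    Integrable (fun x : Z × (Fin n → ℕ) => unused mu x.1 x.2) ν ∧
    ∫ x : Z × (Fin n → ℕ), unused mu x.1 x.2 ∂ν = ∫ i, (muTot mu i - lam i) ∂p := by
  have hmuTot : ∀ i, 0 ≤ muTot mu i := fun i => Finset.sum_nonneg fun j _ => h.mu_nonneg i j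
  have hu : Integrable (fun x : Z × (Fin n → ℕ) => unused mu x.1 x.2) ν :=
    integrable_of_bounded (B := K) fun x => by
      rw [abs_of_nonneg (unused_nonneg h _ _)]; exact unused_le h _ _
  have hh : Integrable (fun x : Z × (Fin n → ℕ) => muTot mu x.1 - lam x.1) ν :=
    integrable_of_bounded (B := K) fun x => by
      rw [abs_le]
      constructor <;>
        linarith [h.lam_nonneg x.1, h.lam_le x.1, h.muTot_le x.1, hmuTot x.1]
  refine ⟨hu, ?_⟩
  have h1 := integral_jump_eq_zero h hm hν qSum_nonneg fun q q' hq => abs_qSum_sub_le hq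
  simp_rw [jump_qSum h] at h1
  have h2 : ∀ x : Z × (Fin n → ℕ), lam x.1 - muTot mu x.1 + unused mu x.1 x.2
    = unused mu x.1 x.2 - (muTot mu x.1 - lam x.1) := fun x => by ring
  simp_rw [h2] at h1
  rw [integral_sub hu hh, integral_fst hm fun i => muTot mu i - lam i] at h1
  linarith

/-- State space collapse: a moment bound for the distance of the queue lengths from the
diagonal. The drift condition only has to hold after adding a correction `gen Q H`. -/
theorem integral_perp_rpow_le (h : JSQBounds Q lam mu K) {ν : Measure (Z × (Fin n → ℕ))}
    [IsProbabilityMeasure ν] (hm : ν.map Prod.fst = p)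
    (hν : IsStationary (jsqRate Q lam mu) ν) {H A : Z → ℝ} {a c : ℝ} (ha : 0 < a) (ha1 : a ≤ 1)
    (hc : 0 < c) (hK : 0 < K) (hH : Integrable H p)
    (hs : ∀ i, Summable fun i' => offDiag Q i i' * H i') (hHA : ∀ i, 1 + |H i| ≤ A i)
    (hA : Integrable (fun i => A i ^ (1 + a)) p) (hdrift : ∀ i, c ≤ sscGap lam mu i + gen Q H i) :
    Integrable (fun x : Z × (Fin n → ℕ) => perp x.2 ^ (1 + a)) ν ∧
    ∫ x : Z × (Fin n → ℕ), perp x.2 ^ (1 + a) ∂ν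
      ≤ 2 * n / c * ((c / n + 14 * K) *
        ((c / (2 * n * (c / n + 14 * K))) ^ (-a) * ∫ i, A i ^ (1 + a) ∂p)) := by
  have hn := h.servers
  have hn0 : (0 : ℝ) < n := by positivity
  -- `14 * K` is `2 * K` times the factor 7 from the oscillation of `g`; it also covers the `9 * K`
  -- of the drift of `Φ`. `c / n` pays for passing from `g` to `y ^ (1 + a)`.
  set C₁ := c / n + 14 * K with hC₁
  have hC₁0 : 0 < C₁ := by positivity
  set κ := c / (2 * n * C₁) with hκ
  have hκ0 : 0 < κ := by positivity
  have hA0 : ∀ i, 0 ≤ A i := fun i => by linarith [hHA i, abs_nonneg (H i)]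
  have hHi : Integrable (fun x : Z × (Fin n → ℕ) => |H x.1|) ν := integrable_fst hm hH.abs
  have hAi : Integrable (fun x : Z × (Fin n → ℕ) => A x.1 ^ (1 + a)) ν :=
    integrable_fst hm (v := fun i => A i ^ (1 + a)) hA
  refine integrable_of_truncated_bound Measurable.of_discrete
    (fun x => Real.rpow_nonneg (perp_pos _).le _)
    (F := fun (L : ℕ) x => (min (perp x.2) L) ^ (1 + a))
    (fun L => integrable_of_bounded (B := (L : ℝ) ^ (1 + a)) fun x => ?_)
    (fun L x => Real.rpow_nonneg (le_min (perp_pos _).le (Nat.cast_nonneg L)) _) (fun x => ?_) ?_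
  · have h0 : 0 ≤ min (perp x.2) (L : ℝ) := le_min (perp_pos _).le (Nat.cast_nonneg L)
    rw [abs_of_nonneg (Real.rpow_nonneg h0 _)]
    exact Real.rpow_le_rpow h0 (min_le_right _ _) (by positivity)
  · exact (tendsto_min_natCast _).rpow_const (Or.inr (by positivity))
  filter_upwards [eventually_ge_atTop 1] with L hL
  have hL1 : (1 : ℝ) ≤ L := by exact_mod_cast hL
  -- Truncation at `L` gives `Φ` bounded increments and makes `g` bounded, so both balance
  -- identities apply without prior moments. The final bound does not involve `L`.
  let φ : ℝ → ℝ := fun x => (min (max x 0) L) ^ (1 + a)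
  have hb0 : ∀ x : ℝ, 0 ≤ min (max x 0) (L : ℝ) := fun x => le_min (le_max_right _ _) (by positivity)
  have hφ : Monotone φ := fun x y hxy =>
    Real.rpow_le_rpow (hb0 x) (min_le_min (max_le_max hxy le_rfl) le_rfl) (by positivity)
  have hφ0 : ∀ x, 0 ≤ φ x := fun x => Real.rpow_nonneg (hb0 x) _
  have hφL : ∀ x, φ x ≤ (L : ℝ) ^ (1 + a) := fun x =>
    Real.rpow_le_rpow (hb0 x) (min_le_right _ _) (by positivity)
  have hφabs : ∀ x, |φ x| ≤ (L : ℝ) ^ (1 + a) := fun x => by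
    rw [abs_of_nonneg (hφ0 x)]; exact hφL x
  let y : (Fin n → ℕ) → ℝ := fun q => min (perp q) L
  have hy1 : ∀ q, 1 ≤ y q := fun q => le_min (one_le_perp q) hL1
  have hy0 : ∀ q, 0 < y q := fun q => one_pos.trans_le (hy1 q)
  have hφy : ∀ q, φ (perp q) = y q ^ (1 + a) := fun q => by
    simp only [φ, y]; rw [max_eq_left (perp_pos q).le]
  have hyy : ∀ q q', Nbr q q' → y q' ≤ y q + 1 := fun q q' hq => by
    simp only [y]
    have := perp_le_perp_add_one hn hq
    rcases min_cases (perp q) (L : ℝ) with ⟨e, -⟩ | ⟨e, -⟩ <;> rw [e]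
    · exact (min_le_left _ _).trans this
    · exact (min_le_right _ _).trans (by linarith)
  -- The factor 4 is a product of two factors 2: one from `1 + a ≤ 2`, one from `y r ≤ 2 * y q` with
  -- `a ≤ 1`.
  have hup : ∀ q q', Nbr q q' → ∀ r, y r ≤ y q + 1 → ∀ r', |y r - y r'| ≤ 1 →
      y r ^ (1 + a) - y r' ^ (1 + a) ≤ 4 * y q ^ a := by
    intro q q' _ r hr r' hrr
    have e1 := rpow_one_add_sub_le ha.le (hy0 r').le (hy0 r)
    have e2 : y r ^ a ≤ 2 * y q ^ a := by
      calc y r ^ a ≤ (2 * y q) ^ a :=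
            Real.rpow_le_rpow (hy0 r).le (by linarith [hy1 q]) ha.le
        _ = 2 ^ a * y q ^ a := Real.mul_rpow zero_le_two (hy0 q).le
        _ ≤ 2 ^ (1 : ℝ) * y q ^ a := by
            refine mul_le_mul_of_nonneg_right ?_ (Real.rpow_nonneg (hy0 q).le _)
            exact Real.rpow_le_rpow_of_exponent_le one_le_two ha1
        _ = 2 * y q ^ a := by rw [Real.rpow_one]
    have e3 : 0 ≤ y r ^ a := Real.rpow_nonneg (hy0 r).le _
    have e4 : (1 + a) * y r ^ a * (y r - y r') ≤ (1 + a) * y r ^ a * 1 :=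
      mul_le_mul_of_nonneg_left ((le_abs_self _).trans hrr) (by positivity)
    have e5 : (1 + a) * y r ^ a ≤ 2 * y r ^ a := mul_le_mul_of_nonneg_right (by linarith) e3
    linarith
  have hosc : ∀ q q', Nbr q q' → |φ (perp q') - φ (perp q)| ≤ 4 * y q ^ a := by
    intro q q' hq
    have e0 : |y q' - y q| ≤ 1 := by
      rw [abs_le]
      constructor <;> linarith [hyy q q' hq, hyy q' q hq.symm]
    rw [hφy, hφy]
    refine abs_le'.2 ⟨hup q q' hq q' (hyy q q' hq) q e0, ?_⟩
    rw [neg_sub]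
    exact hup q q' hq q (by linarith) q' (by rwa [abs_sub_comm])
  have hdiv : ∀ q, φ (perp q) / perp q ≤ y q ^ a := fun q => by
    rw [div_le_iff₀ (perp_pos q), hφy, Real.rpow_add (hy0 q), Real.rpow_one, mul_comm]
    exact mul_le_mul_of_nonneg_left (min_le_left _ _) (Real.rpow_nonneg (hy0 q).le _)
  have hdiv0 : ∀ q : Fin n → ℕ, 0 ≤ φ (perp q) / perp q := fun q => div_nonneg (hφ0 _) (perp_pos q).le
  -- This is the coefficient of the SSC margin in the drift of `Φ`. Pairing `H` with the same
  -- function adds `gen Q H` to that margin.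
  let g : (Fin n → ℕ) → ℝ := fun q => φ (perp q) / perp q * qGap q
  have hg0 : ∀ q, 0 ≤ g q := fun q => mul_nonneg (hdiv0 q) (qGap_nonneg hn q)
  have hratio : ∀ q : Fin n → ℕ, qGap q / perp q ≤ 1 := fun q =>
    (div_le_one (perp_pos q)).2 (qGap_le_perp hn q)
  have hratio0 : ∀ q : Fin n → ℕ, 0 ≤ qGap q / perp q := fun q =>
    div_nonneg (qGap_nonneg hn q) (perp_pos q).le
  have hg_eq : ∀ q, g q = φ (perp q) * (qGap q / perp q) := fun q => by
    simp only [g]; ring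
  have hgb : ∀ q, |g q| ≤ (L : ℝ) ^ (1 + a) := fun q => by
    rw [abs_of_nonneg (hg0 q), hg_eq]
    exact (mul_le_of_le_one_right (hφ0 _) (hratio q)).trans (hφL _)
  have hg_low : ∀ q, (y q ^ (1 + a) - y q ^ a) / n ≤ g q := fun q => by
    have e1 : (perp q - 1) / n ≤ qGap q := by
      rw [div_le_iff₀ hn0]; linarith [perp_le hn q]
    have e2 := mul_le_mul_of_nonneg_left e1 (hdiv0 q)
    have e3 : φ (perp q) / perp q * ((perp q - 1) / n)
        = (y q ^ (1 + a) - φ (perp q) / perp q) / n := by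
      rw [← hφy]
      have := (perp_pos q).ne'
      field_simp
    rw [e3] at e2
    refine le_trans ?_ e2
    exact div_le_div_of_nonneg_right (by linarith [hdiv q]) hn0.le
  have hgosc : ∀ q q', Nbr q q' → |g q' - g q| ≤ 7 * y q ^ a := by
    intro q q' hq
    have hN := perp_pos q
    have hN' := perp_pos q'
    have e1 : g q' - g q = (φ (perp q') - φ (perp q)) * (qGap q' / perp q')
        + φ (perp q) / perp q * (qGap q' / perp q' * (perp q - perp q') + (qGap q' - qGap q)) := by
      simp only [g]; field_simp; ring
    have e2 : |(φ (perp q') - φ (perp q)) * (qGap q' / perp q')| ≤ 4 * y q ^ a := by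
      rw [abs_mul, abs_of_nonneg (hratio0 q')]
      exact (mul_le_of_le_one_right (abs_nonneg _) (hratio q')).trans (hosc q q' hq)
    have e3 : |qGap q' / perp q' * (perp q - perp q') + (qGap q' - qGap q)| ≤ 3 := by
      have e4 : |qGap q' / perp q' * (perp q - perp q')| ≤ 1 := by
        rw [abs_mul, abs_of_nonneg (hratio0 q'), abs_sub_comm]
        exact mul_le_one₀ (hratio q') (abs_nonneg _) (abs_perp_sub_le hn hq)
      have e5 := abs_qGap_sub_le hn hq
      linarith [abs_add_le (qGap q' / perp q' * (perp q - perp q')) (qGap q' - qGap q)]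
    have e4 : |φ (perp q) / perp q * (qGap q' / perp q' * (perp q - perp q')
        + (qGap q' - qGap q))| ≤ y q ^ a * 3 := by
      rw [abs_mul, abs_of_nonneg (hdiv0 q)]
      exact mul_le_mul (hdiv q) e3 (abs_nonneg _) (Real.rpow_nonneg (hy0 q).le _)
    rw [e1]
    linarith [abs_add_le ((φ (perp q') - φ (perp q)) * (qGap q' / perp q'))
      (φ (perp q) / perp q * (qGap q' / perp q' * (perp q - perp q') + (qGap q' - qGap q)))]
  let Φ : (Fin n → ℕ) → ℝ := fun q => ∫ x in (0 : ℝ)..perp q, φ x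
  have hΦ0 : ∀ q, 0 ≤ Φ q := fun q =>
    intervalIntegral.integral_nonneg (perp_pos q).le fun x _ => hφ0 x
  have hΦ : ∀ q q', Nbr q q' → |Φ q' - Φ q| ≤ (L : ℝ) ^ (1 + a) := fun q q' hq =>
    (abs_integral_sub_le_of_bounded hφ hφabs _ _).trans
      (mul_le_of_le_one_right (by positivity) (abs_perp_sub_le hn hq))
  have hΦint : Integrable (fun x : Z × (Fin n → ℕ) =>
      jump lam mu x.1 x.2 fun q' => Φ q' - Φ x.2) ν :=
    integrable_of_bounded (B := 2 * K * (L : ℝ) ^ (1 + a)) fun x =>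
      abs_jump_le h _ _ (by positivity) fun q' hq => hΦ _ _ hq
  have hz1 := integral_jump_eq_zero h hm hν hΦ0 hΦ
  obtain ⟨hgint, hz2⟩ := integral_gen_mul h hm hν hH hs hgb
  have hypint : Integrable (fun x : Z × (Fin n → ℕ) => y x.2 ^ (1 + a)) ν :=
    integrable_of_bounded (B := (L : ℝ) ^ (1 + a)) fun x => by
      rw [← hφy]; exact hφabs _
  -- The corrected margin is at least `c`. The jumps of `g` cost `|H|` times a multiple of `y ^ a`;
  -- `κ` is chosen so that absorbing all errors uses half of the negative drift.
  have hpt : ∀ x : Z × (Fin n → ℕ), (jump lam mu x.1 x.2 fun q' => Φ q' - Φ x.2)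
      - (g x.2 * gen Q H x.1 + H x.1 * jump lam mu x.1 x.2 fun q' => g q' - g x.2)
      ≤ C₁ * κ ^ (-a) * A x.1 ^ (1 + a) - c / (2 * n) * y x.2 ^ (1 + a) := by
    rintro ⟨i, q⟩
    simp only
    have hya : 0 ≤ y q ^ a := Real.rpow_nonneg (hy0 q).le _
    have e1 := jump_integral_perp_le h i q hφ (hφ0 _) (fun q' hq => hosc q q' hq) (by positivity)
    have e2 := abs_jump_le h i q (by positivity) (fun q' hq => hgosc q q' hq)
    have e3 : -(H i * jump lam mu i q fun q' => g q' - g q) ≤ |H i| * (2 * K * (7 * y q ^ a)) := by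
      refine (neg_le_abs _).trans ?_
      rw [abs_mul]
      exact mul_le_mul_of_nonneg_left e2 (abs_nonneg _)
    have e4 := mul_le_mul_of_nonneg_left (hdiv q) hK.le
    have e5 := mul_le_mul_of_nonneg_right (hdrift i) (hg0 q)
    have e6 := mul_le_mul_of_nonneg_left (hg_low q) hc.le
    have e7 : (1 + |H i|) * y q ^ a ≤ A i * y q ^ a := mul_le_mul_of_nonneg_right (hHA i) hya
    have e8 := mul_le_mul_of_nonneg_left (mul_rpow_le_add ha (hA0 i) (hy0 q) hκ0) hC₁0.le
    have e9 : C₁ * (κ * y q ^ (1 + a) + κ ^ (-a) * A i ^ (1 + a))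
        = c / (2 * n) * y q ^ (1 + a) + C₁ * κ ^ (-a) * A i ^ (1 + a) := by
      rw [hκ]; field_simp
    have e10 : c * ((y q ^ (1 + a) - y q ^ a) / n)
        = 2 * (c / (2 * n) * y q ^ (1 + a)) - c / n * y q ^ a := by field_simp
    have e11 : C₁ * ((1 + |H i|) * y q ^ a) ≤ C₁ * (A i * y q ^ a) :=
      mul_le_mul_of_nonneg_left e7 hC₁0.le
    have e12 : C₁ * ((1 + |H i|) * y q ^ a) = c / n * y q ^ a + 14 * K * y q ^ a
        + c / n * (|H i| * y q ^ a) + 14 * K * (|H i| * y q ^ a) := by rw [hC₁]; ring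
    have e13 : 0 ≤ c / n * (|H i| * y q ^ a) := by positivity
    have e14 : 0 ≤ K * y q ^ a := by positivity
    simp only [Φ, g] at *
    nlinarith
  have hfin := integral_mono (hΦint.sub hgint)
    ((hAi.const_mul (C₁ * κ ^ (-a))).sub (hypint.const_mul (c / (2 * n)))) hpt
  rw [integral_sub' hΦint hgint, hz1, hz2,
    integral_sub' (hAi.const_mul _) (hypint.const_mul _), integral_const_mul, integral_const_mul,
    integral_fst hm fun i => A i ^ (1 + a)] at hfin
  have e1 : ∫ x : Z × (Fin n → ℕ), y x.2 ^ (1 + a) ∂ν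
      = 2 * n / c * (c / (2 * n) * ∫ x : Z × (Fin n → ℕ), y x.2 ^ (1 + a) ∂ν) := by
    field_simp
  change ∫ x : Z × (Fin n → ℕ), y x.2 ^ (1 + a) ∂ν ≤ _
  rw [e1]
  exact mul_le_mul_of_nonneg_left (by linarith) (by positivity)

end Collapse

/-! ### The Poisson equation: linearity, uniqueness, asymptotic variance -/

section Poisson

variable {Z : Type*} [MeasurableSpace Z] {Q : Z → Z → ℝ} {K : ℝ} {p : Measure Z}
  {f f' V V' : Z → ℝ}

/-- `V` is an integrable solution of the Poisson equation for `f`, in terms of the generator. -/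
structure PoissonPair (Q : Z → Z → ℝ) (p : Measure Z) (f V : Z → ℝ) : Prop where
  integrable_left : Integrable f p
  integrable_right : Integrable V p
  summable : ∀ i, Summable fun i' => offDiag Q i i' * V i'
  gen_eq : ∀ i, gen Q V i = ∫ i', f i' ∂p - f i

lemma gen_eq_sub (hQ : BoundedRates Q K) {V : Z → ℝ} {i : Z}
    (hs : Summable fun i' => offDiag Q i i' * V i') :
    gen Q V i = ∑' i', offDiag Q i i' * V i' - exitRate Q i * V i := by
  rw [gen_eq_offDiag]
  simp_rw [mul_sub]
  rw [hs.tsum_sub ((hQ.hasSum_offDiag i).summable.mul_right _), tsum_mul_right,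
    (hQ.hasSum_offDiag i).tsum_eq]

lemma IsPoissonSolution.pair (hQ : BoundedRates Q K) (h : IsPoissonSolution Q p f V)
    (hV : Integrable V p) : PoissonPair Q p f V := by
  have hs : ∀ i, HasSum (fun i' => offDiag Q i i' * V i')
      (∑' i' : {i' : Z // i' ≠ i}, Q i i' * V i') := fun i =>
    (hasSum_ne_iff i (fun i' => Q i i' * V i') _ _ (by simp [offDiag_self])
      fun y hy => by rw [offDiag_of_ne Q hy]).1 (h.summable i).hasSum
  refine ⟨h.integrable, hV, fun i => (hs i).summable, fun i => ?_⟩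
  rw [gen_eq_sub hQ (hs i).summable, (hs i).tsum_eq, h.eqn i]
  ring

lemma PoissonPair.add (hQ : BoundedRates Q K) (h : PoissonPair Q p f V)
    (h' : PoissonPair Q p f' V') :
    PoissonPair Q p (fun i => f i + f' i) (fun i => V i + V' i) := by
  have hs : ∀ i, Summable fun i' => offDiag Q i i' * (V i' + V' i') := fun i => by
    simpa only [mul_add] using (h.summable i).add (h'.summable i)
  refine ⟨h.integrable_left.add h'.integrable_left, h.integrable_right.add h'.integrable_right,
    hs, fun i => ?_⟩
  have h1 := h.gen_eq i
  have h2 := h'.gen_eq i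
  rw [gen_eq_sub hQ (h.summable i)] at h1
  rw [gen_eq_sub hQ (h'.summable i)] at h2
  rw [gen_eq_sub hQ (hs i), integral_add h.integrable_left h'.integrable_left]
  simp_rw [mul_add]
  rw [(h.summable i).tsum_add (h'.summable i)]
  linarith

lemma PoissonPair.const_mul (hQ : BoundedRates Q K) (h : PoissonPair Q p f V) (c : ℝ) :
    PoissonPair Q p (fun i => c * f i) (fun i => c * V i) := by
  have he : ∀ i, (fun i' => offDiag Q i i' * (c * V i')) = fun i' => c * (offDiag Q i i' * V i') :=
    fun i => funext fun i' => by ring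
  have hs : ∀ i, Summable fun i' => offDiag Q i i' * (c * V i') := fun i => by
    rw [he]; exact (h.summable i).mul_left c
  refine ⟨h.integrable_left.const_mul c, h.integrable_right.const_mul c, hs, fun i => ?_⟩
  have h1 := h.gen_eq i
  rw [gen_eq_sub hQ (h.summable i)] at h1
  rw [gen_eq_sub hQ (hs i), integral_const_mul, he, tsum_mul_left]
  linear_combination c * h1

lemma PoissonPair.congr (h : PoissonPair Q p f V) (hf : ∀ i, f' i = f i) :
    PoissonPair Q p f' V := by
  rw [show f' = f from funext hf]; exact h

variable [Countable Z] [MeasurableSingletonClass Z] [IsProbabilityMeasure p]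

/-- Integrable solutions of the Poisson equation are unique up to a constant. -/
lemma PoissonPair.eq_add_const (hQ : BoundedRates Q K) (hirr : IsIrreducible Q)
    (hp : IsStationary Q p) (h : PoissonPair Q p f V) (h' : PoissonPair Q p f V') (i : Z) :
    V i = V' i + (∫ i, V i ∂p - ∫ i, V' i ∂p) := by
  have hd := h.add hQ (h'.const_mul hQ (-1))
  have hconst : ∀ j, V j + -1 * V' j = V i + -1 * V' i := fun j =>
    eq_of_gen_eq_zero hQ hirr hp hd.integrable_right hd.summable (fun x => by
      rw [hd.gen_eq]; simp) i j
  have h1 : ∫ j, V j ∂p = ∫ j, (V' j + (V i - V' i)) ∂p :=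
    integral_congr_ae (ae_of_all _ fun j => by have := hconst j; simp only; linarith)
  rw [integral_add h'.integrable_right (integrable_const _)] at h1
  simp only [integral_const, probReal_univ, smul_eq_mul, one_mul] at h1
  linarith

/-- The asymptotic variance is nonnegative. -/
lemma PoissonPair.integral_mul_nonneg (hQ : BoundedRates Q K) (hp : IsStationary Q p)
    (h : PoissonPair Q p f V) {B : ℝ} (hf : ∀ i, |f i| ≤ B) (h0 : ∫ i, f i ∂p = 0) :
    0 ≤ ∫ i, f i * V i ∂p := by
  have hlim : Tendsto (fun M : ℕ => ∫ i, f i * max (-(M : ℝ)) (min (V i) M) ∂p) atTop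
      (𝓝 (∫ i, f i * V i ∂p)) := by
    refine tendsto_integral_of_dominated_convergence (fun i => B * |V i|)
      (fun M => Measurable.of_discrete.aestronglyMeasurable)
      (h.integrable_right.abs.const_mul B) (fun M => ae_of_all _ fun i => ?_)
      (ae_of_all _ fun i => ?_)
    · rw [Real.norm_eq_abs, abs_mul]
      refine mul_le_mul (hf i) ?_ (abs_nonneg _) ((abs_nonneg _).trans (hf i))
      have hM : (0 : ℝ) ≤ M := Nat.cast_nonneg M
      rcases le_total 0 (V i) with hV | hV
      · rw [max_eq_right (by linarith [le_min hV hM]), abs_of_nonneg (le_min hV hM),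
          abs_of_nonneg hV]
        exact min_le_left _ _
      · rw [min_eq_left (hV.trans hM), abs_of_nonpos (max_le (by linarith) hV), abs_of_nonpos hV]
        exact neg_le_neg (le_max_right _ _)
    · refine Tendsto.const_mul _ (tendsto_const_nhds.congr' ?_)
      filter_upwards [eventually_ge_atTop ⌈|V i|⌉₊] with M hM
      have h1 : |V i| ≤ M := (Nat.le_ceil _).trans (by exact_mod_cast hM)
      rw [abs_le] at h1
      rw [min_eq_left h1.2, max_eq_right h1.1]
  refine ge_of_tendsto hlim (Eventually.of_forall fun M => ?_)
  have hM : (0 : ℝ) ≤ M := Nat.cast_nonneg M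
  -- `V` is merely integrable, so `V ^ 2` is not an admissible test function. The antiderivative `Ξ`
  -- of a truncation has linear growth; integrating `T V * gen V ≤ gen (Ξ V)` and using `gen V = -f`
  -- gives the sign.
  let T : ℝ → ℝ := fun x => max (-(M : ℝ)) (min x M)
  have hT : Monotone T := fun a b hab => max_le_max le_rfl (min_le_min hab le_rfl)
  have hTb : ∀ x, |T x| ≤ M := fun x =>
    abs_le.2 ⟨le_max_left _ _, max_le (by linarith) (min_le_right _ _)⟩
  let Ξ : ℝ → ℝ := fun x => ∫ y in (0 : ℝ)..x, T y
  have hL : ∀ a b, |Ξ b - Ξ a| ≤ M * |b - a| := abs_integral_sub_le_of_bounded hT hTb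
  have hint : Integrable (fun i => Ξ (V i)) p := by
    refine Integrable.mono' (h.integrable_right.abs.const_mul (M : ℝ))
      Measurable.of_discrete.aestronglyMeasurable (ae_of_all _ fun i => ?_)
    have := hL 0 (V i)
    simpa [Ξ] using this
  obtain ⟨hg, hg0⟩ := hp.integral_gen hQ hint
  have hTint : Integrable (fun i => f i * T (V i)) p :=
    integrable_of_bounded (B := B * M) fun i => by
      rw [abs_mul]
      exact mul_le_mul (hf i) (hTb _) (abs_nonneg _) ((abs_nonneg _).trans (hf i))
  have h1 := integral_mono hTint.neg hg fun i => by
    have := subgradient_mul_gen_le hQ (h.summable i) hL (integral_sub_le_of_monotone hT)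
    rw [h.gen_eq, h0] at this
    simp only [Pi.neg_apply]
    linarith
  rw [hg0, integral_neg'] at h1
  linarith

end Poisson

/-! ### Laplace transform of the scaled total queue length -/

section Laplace

variable {Z : Type*} [Countable Z] [MeasurableSpace Z] [MeasurableSingletonClass Z] {n : ℕ}
  {Q : Z → Z → ℝ} {lam : Z → ℝ} {mu : Z → Fin n → ℝ} {K : ℝ} {p : Measure Z}
  [IsProbabilityMeasure p]

/-- The factor that appears when the generator acts on `exp (-θ * qSum q)`. -/
noncomputable def expDrift (lam : Z → ℝ) (mu : Z → Fin n → ℝ) (θ : ℝ) (x : Z × (Fin n → ℕ)) : ℝ :=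
  muTot mu x.1 - lam x.1 + (1 - Real.exp (-θ)) * lam x.1 - unused mu x.1 x.2

lemma JSQBounds.muTot_nonneg (h : JSQBounds Q lam mu K) (i : Z) : 0 ≤ muTot mu i :=
  Finset.sum_nonneg fun j _ => h.mu_nonneg i j

lemma JSQBounds.abs_sub_le (h : JSQBounds Q lam mu K) (i : Z) : |muTot mu i - lam i| ≤ K := by
  rw [abs_le]
  constructor <;> linarith [h.lam_nonneg i, h.lam_le i, h.muTot_le i, h.muTot_nonneg i]

lemma unused_le_muTot (h : JSQBounds Q lam mu K) (i : Z) (q : Fin n → ℕ) :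
    unused mu i q ≤ muTot mu i :=
  Finset.sum_le_sum fun j _ => by split_ifs; exacts [le_rfl, h.mu_nonneg i j]

lemma abs_expDrift_le (h : JSQBounds Q lam mu K) {θ : ℝ} (hθ : 0 ≤ θ) (x : Z × (Fin n → ℕ)) :
    |expDrift lam mu θ x| ≤ K := by
  have h1 : Real.exp (-θ) ≤ 1 := Real.exp_le_one_iff.2 (by linarith)
  have h2 := Real.exp_pos (-θ)
  have h3 : expDrift lam mu θ x
      = muTot mu x.1 - unused mu x.1 x.2 - Real.exp (-θ) * lam x.1 := by rw [expDrift]; ring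
  have h4 := unused_le_muTot h x.1 x.2
  have h5 := unused_nonneg h x.1 x.2
  have h6 := h.muTot_le x.1
  have h7 : Real.exp (-θ) * lam x.1 ≤ K :=
    (mul_le_of_le_one_left (h.lam_nonneg _) h1).trans (h.lam_le _)
  have h8 := mul_nonneg h2.le (h.lam_nonneg x.1)
  rw [h3, abs_le]
  constructor <;> linarith

lemma exp_qSum_le_one {θ : ℝ} (hθ : 0 ≤ θ) (q : Fin n → ℕ) : Real.exp (-θ * qSum q) ≤ 1 :=
  Real.exp_le_one_iff.2 (by have := mul_nonneg hθ (qSum_nonneg q); linarith)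

lemma abs_exp_qSum_le {θ : ℝ} (hθ : 0 ≤ θ) (q : Fin n → ℕ) : |Real.exp (-θ * qSum q)| ≤ 1 := by
  rw [abs_of_nonneg (Real.exp_nonneg _)]; exact exp_qSum_le_one hθ q

lemma integral_sub_add {α : Type*} [MeasurableSpace α] {ν : Measure α} {f g k : α → ℝ}
    (hf : Integrable f ν) (hg : Integrable g ν) (hk : Integrable k ν) :
    ∫ x, (f x - g x + k x) ∂ν = ∫ x, f x ∂ν - ∫ x, g x ∂ν + ∫ x, k x ∂ν := by
  rw [← integral_sub hf hg]
  exact integral_add (hf.sub hg) hk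

lemma integral_add_sub {α : Type*} [MeasurableSpace α] {ν : Measure α} {f g k : α → ℝ}
    (hf : Integrable f ν) (hg : Integrable g ν) (hk : Integrable k ν) :
    ∫ x, (f x + g x - k x) ∂ν = ∫ x, f x ∂ν + ∫ x, g x ∂ν - ∫ x, k x ∂ν := by
  rw [← integral_add hf hg]
  exact integral_sub (hf.add hg) hk

/-- The balance identity for `V i * exp (-θ * qSum q)`, where `V` solves a Poisson equation. -/
lemma integral_exp_mul (h : JSQBounds Q lam mu K) {ν : Measure (Z × (Fin n → ℕ))}
    [IsProbabilityMeasure ν] (hm : ν.map Prod.fst = p)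
    (hν : IsStationary (jsqRate Q lam mu) ν) {f V : Z → ℝ} (hV : PoissonPair Q p f V) {θ : ℝ}
    (hθ : 0 ≤ θ) :
    ∃ R, |R| ≤ K * ∫ i, |V i| ∂p ∧
      R = ∫ x : Z × (Fin n → ℕ), Real.exp (-θ * qSum x.2) * (V x.1 * expDrift lam mu θ x) ∂ν ∧
      ∫ x : Z × (Fin n → ℕ), Real.exp (-θ * qSum x.2) * f x.1 ∂ν
        = (∫ i, f i ∂p) * ∫ x : Z × (Fin n → ℕ), Real.exp (-θ * qSum x.2) ∂ν
          + (Real.exp θ - 1) * R := by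
  obtain ⟨h1, h2⟩ := integral_gen_mul h hm hν hV.integrable_right hV.summable
    (g := fun q => Real.exp (-θ * qSum q)) (abs_exp_qSum_le hθ)
  have hVi := integrable_fst hm hV.integrable_right
  have hfi := integrable_fst hm hV.integrable_left
  have hw : Integrable (fun x : Z × (Fin n → ℕ) => Real.exp (-θ * qSum x.2)) ν :=
    integrable_of_bounded fun x => abs_exp_qSum_le hθ x.2
  have hwf : Integrable (fun x : Z × (Fin n → ℕ) => Real.exp (-θ * qSum x.2) * f x.1) ν :=
    hfi.bdd_mul (c := 1) Measurable.of_discrete.aestronglyMeasurable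
      (ae_of_all _ fun x => abs_exp_qSum_le hθ x.2)
  have hbd : ∀ x : Z × (Fin n → ℕ),
      |Real.exp (-θ * qSum x.2) * (V x.1 * expDrift lam mu θ x)| ≤ K * |V x.1| := fun x => by
    have e1 := abs_exp_qSum_le hθ x.2
    have e2 := abs_expDrift_le h hθ x
    rw [abs_mul, abs_mul]
    calc _ ≤ 1 * (|V x.1| * K) := mul_le_mul e1 (mul_le_mul_of_nonneg_left e2 (abs_nonneg _))
          (by positivity) zero_le_one
      _ = _ := by ring
  have hVψ : Integrable (fun x : Z × (Fin n → ℕ) =>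
      Real.exp (-θ * qSum x.2) * (V x.1 * expDrift lam mu θ x)) ν :=
    Integrable.mono' (hVi.abs.const_mul K) Measurable.of_discrete.aestronglyMeasurable
      (ae_of_all _ hbd)
  refine ⟨_, ?_, rfl, ?_⟩
  · rw [← integral_fst hm fun i => |V i|, ← integral_const_mul]
    exact (abs_integral_le_integral_abs).trans
      (integral_mono hVψ.abs (hVi.abs.const_mul K) hbd)
  · have h3 : ∀ x : Z × (Fin n → ℕ),
        (Real.exp (-θ * qSum x.2) * gen Q V x.1 + V x.1 * jump lam mu x.1 x.2 fun q' =>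
          Real.exp (-θ * qSum q') - Real.exp (-θ * qSum x.2))
        = (∫ i, f i ∂p) * Real.exp (-θ * qSum x.2) - Real.exp (-θ * qSum x.2) * f x.1
          + (Real.exp θ - 1) * (Real.exp (-θ * qSum x.2) * (V x.1 * expDrift lam mu θ x)) :=
      fun x => by rw [jump_exp h, hV.gen_eq, expDrift]; ring
    simp_rw [h3] at h2
    rw [integral_sub_add (hw.const_mul _) hwf (hVψ.const_mul _), integral_const_mul,
      integral_const_mul] at h2
    linarith

/-- The balance identity for `exp (-θ * qSum q)`. -/
lemma integral_exp_mul_expDrift (h : JSQBounds Q lam mu K) {ν : Measure (Z × (Fin n → ℕ))}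
    [IsProbabilityMeasure ν] (hm : ν.map Prod.fst = p)
    (hν : IsStationary (jsqRate Q lam mu) ν) {θ : ℝ} (hθ : 0 < θ) :
    ∫ x : Z × (Fin n → ℕ), Real.exp (-θ * qSum x.2) * expDrift lam mu θ x ∂ν = 0 := by
  have h2 := (integral_gen_mul h hm hν (v := fun _ => 1) (integrable_const _)
    (fun i => h.rates.summable_mul (B := 1) (by simp) i)
    (g := fun q => Real.exp (-θ * qSum q)) (abs_exp_qSum_le hθ.le)).2
  have h3 : ∀ x : Z × (Fin n → ℕ),
      (Real.exp (-θ * qSum x.2) * gen Q (fun _ => (1 : ℝ)) x.1 + 1 * jump lam mu x.1 x.2 fun q' =>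
        Real.exp (-θ * qSum q') - Real.exp (-θ * qSum x.2))
      = (Real.exp θ - 1) * (Real.exp (-θ * qSum x.2) * expDrift lam mu θ x) :=
    fun x => by rw [jump_exp h, expDrift]; simp [gen]
  simp_rw [h3] at h2
  rw [integral_const_mul] at h2
  refine (mul_eq_zero.1 h2).resolve_left ?_
  have := Real.add_one_lt_exp hθ.ne'
  linarith

/-- The algebra behind the heavy traffic limit of the Laplace transform. -/
lemma heavy_traffic_algebra {W k m K B γ s ε θ e f wh wl R₁ R₂ R₃ R₄ R₅ R₆ : ℝ}
    (hW0 : 0 ≤ W) (hW1 : W ≤ 1) (hm0 : 0 < m) (hmK : m ≤ K) (hB : 0 ≤ B)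
    (hs : 0 < s) (hε : 0 < ε) (hεγ : ε ≤ γ) (hθ : θ = s * ε)
    (he1 : |e - θ| ≤ θ ^ 2) (he2 : |e| ≤ 2 * θ) (hf1 : |f - θ| ≤ θ ^ 2) (hf2 : |f| ≤ θ)
    (hk : |k| ≤ K * B) (hR₁ : |R₁| ≤ K * B) (hR₂ : |R₂| ≤ K * B) (hR₃ : |R₃| ≤ B * γ)
    (hR₄ : |R₄| ≤ K * B) (hR₅ : |R₅| ≤ θ * (B * γ)) (hR₆ : |R₆| ≤ K * B)
    (hwh : wh = ε * m * W + e * (k * W + e * R₁ + f * R₂ - R₃))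
    (hwh' : wh = ε * m * W + e * R₆)
    (hwl : wl = m * W + e * R₄ - wh)
    (hmain : wh + f * wl = ε * m - R₅) :
    |W * (1 + s * (1 + k / m)) - 1|
      ≤ (11 * s ^ 2 * K * B + s ^ 2 * K + 3 * s * B + s * K) * γ / m := by
  have hK : 0 < K := hm0.trans_le hmK
  have hθ0 : 0 < θ := hθ ▸ mul_pos hs hε
  -- After exact cancellation every remainder is quadratic in ε or of order θγ. The finer expansion
  -- `hwh` is used for `wh` itself; the cruder `hwh'` suffices where `wh` already carries the factor
  -- `f`.
  have hid : (W * (1 + s * (1 + k / m)) - 1) * (ε * m)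
      = (θ - e) * (k * W) + (θ - f) * (m * W) - e * (e * R₁) - e * (f * R₂) + e * R₃
        - f * (e * R₄) + f * (ε * m * W) + f * (e * R₆) - R₅ := by
    have h1 : (W * (1 + s * (1 + k / m)) - 1) * (ε * m)
        = W * (ε * m + θ * k + θ * m) - ε * m := by rw [hθ]; field_simp; ring
    rw [h1]
    rw [hwl] at hmain
    linear_combination hmain - (1 : ℝ) * hwh + f * hwh'
  have hθγ : θ ^ 2 ≤ s ^ 2 * (ε * γ) := by rw [hθ]; nlinarith [mul_pos hs hs]
  have hkW : |k * W| ≤ K * B := by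
    rw [abs_mul, abs_of_nonneg hW0]
    exact (mul_le_of_le_one_right (abs_nonneg _) hW1).trans hk
  have hmW : |m * W| ≤ K := by
    rw [abs_mul, abs_of_nonneg hW0, abs_of_pos hm0]
    exact (mul_le_of_le_one_right hm0.le hW1).trans hmK
  have hKB : 0 ≤ K * B := by positivity
  have t : ∀ {x y X Y : ℝ}, |x| ≤ X → |y| ≤ Y → |x * y| ≤ X * Y := fun {x y X Y} hx hy => by
    rw [abs_mul]; exact mul_le_mul hx hy (abs_nonneg _) ((abs_nonneg _).trans hx)
  have b1 := t (by rwa [abs_sub_comm] at he1 : |θ - e| ≤ θ ^ 2) hkW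
  have b2 := t (by rwa [abs_sub_comm] at hf1 : |θ - f| ≤ θ ^ 2) hmW
  have b3 := t he2 (t he2 hR₁)
  have b4 := t he2 (t hf2 hR₂)
  have b5 := t he2 hR₃
  have b6 := t hf2 (t he2 hR₄)
  have b7 : |f * (ε * m * W)| ≤ θ * (ε * K) := by
    refine t hf2 ?_
    rw [mul_assoc, abs_mul, abs_of_pos hε]
    exact mul_le_mul_of_nonneg_left hmW hε.le
  have b8 := t hf2 (t he2 hR₆)
  have hbound : |(W * (1 + s * (1 + k / m)) - 1) * (ε * m)|
      ≤ 11 * θ ^ 2 * (K * B) + θ ^ 2 * K + 3 * θ * (B * γ) + θ * (ε * K) := by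
    rw [hid]
    have hsum : 11 * θ ^ 2 * (K * B) + θ ^ 2 * K + 3 * θ * (B * γ) + θ * (ε * K)
        = θ ^ 2 * (K * B) + θ ^ 2 * K + 2 * θ * (2 * θ * (K * B)) + 2 * θ * (θ * (K * B))
          + 2 * θ * (B * γ) + θ * (2 * θ * (K * B)) + θ * (ε * K) + θ * (2 * θ * (K * B))
          + θ * (B * γ) := by ring
    rw [hsum]
    refine (abs_sub _ _).trans (add_le_add ?_ hR₅)
    refine (abs_add_le _ _).trans (add_le_add ?_ b8)
    refine (abs_add_le _ _).trans (add_le_add ?_ b7)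
    refine (abs_sub _ _).trans (add_le_add ?_ b6)
    refine (abs_add_le _ _).trans (add_le_add ?_ b5)
    refine (abs_sub _ _).trans (add_le_add ?_ b4)
    refine (abs_sub _ _).trans (add_le_add ?_ b3)
    exact (abs_add_le _ _).trans (add_le_add b1 b2)
  have hb2 : 11 * θ ^ 2 * (K * B) + θ ^ 2 * K + 3 * θ * (B * γ) + θ * (ε * K)
      ≤ ε * ((11 * s ^ 2 * K * B + s ^ 2 * K + 3 * s * B + s * K) * γ) := by
    have c1 := mul_le_mul_of_nonneg_right hθγ (by positivity : 0 ≤ 11 * (K * B))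
    have c2 := mul_le_mul_of_nonneg_right hθγ hK.le
    have c3 : θ * (ε * K) ≤ s * ε * γ * K := by
      rw [hθ]
      have := mul_le_mul_of_nonneg_left hεγ (by positivity : 0 ≤ s * ε * K)
      linarith
    have c4 : 3 * θ * (B * γ) = 3 * s * ε * B * γ := by rw [hθ]; ring
    linarith
  rw [abs_mul, abs_of_pos (mul_pos hε hm0)] at hbound
  rw [le_div_iff₀ hm0]
  have := hbound.trans hb2
  have h3 : |W * (1 + s * (1 + k / m)) - 1| * (ε * m)
      = ε * (|W * (1 + s * (1 + k / m)) - 1| * m) := by ring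
  rw [h3] at this
  exact le_of_mul_le_mul_left this hε

/-- The Laplace transform of the scaled total queue length, with an explicit error bound. -/
theorem abs_laplace_sub_le (h : JSQBounds Q lam mu K) {ν : Measure (Z × (Fin n → ℕ))}
    [IsProbabilityMeasure ν] (hm : ν.map Prod.fst = p)
    (hν : IsStationary (jsqRate Q lam mu) ν) {V Vk Vl : Z → ℝ} {ε B γ s m : ℝ}
    (hmean : ∫ i, (muTot mu i - lam i) ∂p = ε * m) (hmu : ∫ i, muTot mu i ∂p = m)
    (hm0 : 0 < m)
    (hV : PoissonPair Q p (fun i => muTot mu i - lam i) V)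
    (hVk : PoissonPair Q p (fun i => (muTot mu i - lam i) * V i) Vk)
    (hVl : PoissonPair Q p (fun i => muTot mu i) Vl)
    (hVB : ∫ i, |V i| ∂p ≤ B) (hVkB : ∫ i, |Vk i| ∂p ≤ B) (hVlB : ∫ i, |Vl i| ∂p ≤ B)
    (hs : 0 < s) (hε : 0 < ε) (hεγ : ε ≤ γ) (hsε : s * ε ≤ 1)
    (huV : ∫ x : Z × (Fin n → ℕ), unused mu x.1 x.2 * |V x.1| ∂ν ≤ B * γ)
    (huq : ∫ x : Z × (Fin n → ℕ), unused mu x.1 x.2 * (n * perp x.2) ∂ν ≤ B * γ)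
    (hperp : Integrable (fun x : Z × (Fin n → ℕ) => perp x.2) ν) :
    |(∫ x : Z × (Fin n → ℕ), Real.exp (-(s * ε) * qSum x.2) ∂ν)
        * (1 + s * (1 + (∫ i, (muTot mu i - lam i) * V i ∂p) / m)) - 1|
      ≤ (11 * s ^ 2 * K * B + s ^ 2 * K + 3 * s * B + s * K) * γ / m := by
  set θ := s * ε with hθ
  have hθ0 : 0 < θ := mul_pos hs hε
  set w : Z × (Fin n → ℕ) → ℝ := fun x => Real.exp (-θ * qSum x.2) with hw
  have hw0 : ∀ x, 0 ≤ w x := fun x => (Real.exp_pos _).le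
  have hw1 : ∀ x, w x ≤ 1 := fun x => exp_qSum_le_one hθ0.le x.2
  have hwb : ∀ x, |w x| ≤ 1 := fun x => abs_exp_qSum_le hθ0.le x.2
  have hwi : Integrable w ν := integrable_of_bounded hwb
  have hB : 0 ≤ B := (integral_nonneg fun i => abs_nonneg _).trans hVB
  have hmK : m ≤ K := by
    rw [← hmu]
    have := integral_mono hVl.integrable_left (integrable_const K) fun i => h.muTot_le i
    simpa using this
  have hK : 0 < K := hm0.trans_le hmK
  have wint : ∀ {f : Z → ℝ}, Integrable f p → Integrable (fun x : Z × (Fin n → ℕ) => w x * f x.1) ν :=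
    fun hf => (integrable_fst hm hf).bdd_mul (c := 1) Measurable.of_discrete.aestronglyMeasurable
      (ae_of_all _ hwb)
  have hlam_i : Integrable lam p := integrable_of_bounded (B := K) fun i => by
    rw [abs_of_nonneg (h.lam_nonneg i)]; exact h.lam_le i
  have hui : Integrable (fun x : Z × (Fin n → ℕ) => unused mu x.1 x.2) ν :=
    (integral_unused h hm hν).1
  have hub : ∀ x : Z × (Fin n → ℕ), |unused mu x.1 x.2| ≤ K := fun x => by
    rw [abs_of_nonneg (unused_nonneg h _ _)]; exact unused_le h _ _
  have hwu : Integrable (fun x : Z × (Fin n → ℕ) => w x * unused mu x.1 x.2) ν :=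
    hui.bdd_mul (c := 1) Measurable.of_discrete.aestronglyMeasurable (ae_of_all _ hwb)
  have hVi := integrable_fst hm hV.integrable_right
  have hlamV : Integrable (fun i => lam i * V i) p :=
    hV.integrable_right.bdd_mul (c := K) Measurable.of_discrete.aestronglyMeasurable
      (ae_of_all _ fun i => by
        rw [Real.norm_eq_abs, abs_of_nonneg (h.lam_nonneg i)]; exact h.lam_le i)
  have hwuV : Integrable (fun x : Z × (Fin n → ℕ) => w x * (unused mu x.1 x.2 * V x.1)) ν :=
    (hVi.bdd_mul (c := K) Measurable.of_discrete.aestronglyMeasurable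
      (ae_of_all _ hub)).bdd_mul (c := 1) Measurable.of_discrete.aestronglyMeasurable
      (ae_of_all _ hwb)
  -- `V`, `Vk` and `Vl` factor the exponential out of the means of w times slack, w times slack
  -- times `V`, and w times `muTot`, respectively.
  obtain ⟨R₆, hR₆, hR₆eq, e6⟩ := integral_exp_mul h hm hν hV hθ0.le
  obtain ⟨R₁, hR₁, -, e1⟩ := integral_exp_mul h hm hν hVk hθ0.le
  obtain ⟨R₄, hR₄, -, e4⟩ := integral_exp_mul h hm hν hVl hθ0.le
  rw [hmean] at e6
  rw [hmu] at e4
  have e0 := integral_exp_mul_expDrift h hm hν hθ0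
  have t1 : ∀ x : Z × (Fin n → ℕ), Real.exp (-θ * qSum x.2) * expDrift lam mu θ x
      = w x * (muTot mu x.1 - lam x.1) + (1 - Real.exp (-θ)) * (w x * lam x.1)
        - w x * unused mu x.1 x.2 := fun x => by rw [expDrift]; ring
  simp_rw [t1] at e0
  rw [integral_add_sub (wint hV.integrable_left) ((wint hlam_i).const_mul _) hwu,
    integral_const_mul] at e0
  have t2 : ∀ x : Z × (Fin n → ℕ),
      Real.exp (-θ * qSum x.2) * (V x.1 * expDrift lam mu θ x)
      = w x * ((muTot mu x.1 - lam x.1) * V x.1) + (1 - Real.exp (-θ)) * (w x * (lam x.1 * V x.1))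
        - w x * (unused mu x.1 x.2 * V x.1) := fun x => by rw [expDrift]; ring
  simp_rw [t2] at hR₆eq
  rw [integral_add_sub (wint hVk.integrable_left) ((wint hlamV).const_mul _) hwuV,
    integral_const_mul] at hR₆eq
  have t3 : ∫ x : Z × (Fin n → ℕ), w x * lam x.1 ∂ν
      = ∫ x : Z × (Fin n → ℕ), w x * muTot mu x.1 ∂ν
        - ∫ x : Z × (Fin n → ℕ), w x * (muTot mu x.1 - lam x.1) ∂ν := by
    rw [← integral_sub (wint hVl.integrable_left) (wint hV.integrable_left)]
    exact integral_congr_ae (ae_of_all _ fun x => by simp only; ring)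
  have hu := (integral_unused h hm hν).2
  rw [hmean] at hu
  have t4 : ∫ x : Z × (Fin n → ℕ), w x * unused mu x.1 x.2 ∂ν
      = ε * m - ∫ x : Z × (Fin n → ℕ), (1 - w x) * unused mu x.1 x.2 ∂ν := by
    rw [← hu]
    have : ∀ x : Z × (Fin n → ℕ), (1 - w x) * unused mu x.1 x.2
      = unused mu x.1 x.2 - w x * unused mu x.1 x.2 := fun x => by ring
    simp_rw [this]
    rw [integral_sub hui hwu]; ring
  have huperp : Integrable (fun x : Z × (Fin n → ℕ) => unused mu x.1 x.2 * (n * perp x.2)) ν :=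
    (hperp.const_mul (n : ℝ)).bdd_mul (c := K) Measurable.of_discrete.aestronglyMeasurable
      (ae_of_all _ hub)
  -- Collapse enters here: `1 - w` is at most θ times the total length, which in the presence of
  -- lost capacity is `n * qGap`, hence at most `n * perp`.
  have hR₅ : |∫ x : Z × (Fin n → ℕ), (1 - w x) * unused mu x.1 x.2 ∂ν| ≤ θ * (B * γ) := by
    rw [abs_of_nonneg (integral_nonneg fun x =>
      mul_nonneg (sub_nonneg.2 (hw1 x)) (unused_nonneg h _ _))]
    refine le_trans ?_ (mul_le_mul_of_nonneg_left huq hθ0.le)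
    rw [← integral_const_mul]
    refine integral_mono_of_nonneg (ae_of_all _ fun x =>
      mul_nonneg (sub_nonneg.2 (hw1 x)) (unused_nonneg h _ _)) (huperp.const_mul θ)
      (ae_of_all _ fun x => ?_)
    have c1 : 1 - w x ≤ θ * qSum x.2 := by
      have := Real.add_one_le_exp (-θ * qSum x.2)
      simp only [hw]; linarith
    have c2 := mul_le_mul_of_nonneg_right c1 (unused_nonneg h x.1 x.2)
    have c3 := unused_mul_qSum h x.1 x.2
    have c4 : unused mu x.1 x.2 * (n * qGap x.2) ≤ unused mu x.1 x.2 * (n * perp x.2) :=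
      mul_le_mul_of_nonneg_left (mul_le_mul_of_nonneg_left (qGap_le_perp h.servers _)
        (Nat.cast_nonneg n)) (unused_nonneg h _ _)
    have c5 : θ * qSum x.2 * unused mu x.1 x.2 = θ * (unused mu x.1 x.2 * qSum x.2) := by ring
    simp only
    rw [c5, c3] at c2
    exact c2.trans (mul_le_mul_of_nonneg_left c4 hθ0.le)
  have hR₃ : |∫ x : Z × (Fin n → ℕ), w x * (unused mu x.1 x.2 * V x.1) ∂ν| ≤ B * γ := by
    refine (abs_integral_le_integral_abs).trans (le_trans ?_ huV)
    refine integral_mono_of_nonneg (ae_of_all _ fun x => abs_nonneg _)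
      (hVi.abs.bdd_mul (c := K) Measurable.of_discrete.aestronglyMeasurable
        (ae_of_all _ hub)) (ae_of_all _ fun x => ?_)
    simp only
    rw [abs_mul, abs_mul, abs_of_nonneg (unused_nonneg h _ _)]
    exact mul_le_of_le_one_left (mul_nonneg (unused_nonneg h _ _) (abs_nonneg _)) (hwb x)
  have hR₂ : |∫ x : Z × (Fin n → ℕ), w x * (lam x.1 * V x.1) ∂ν| ≤ K * B := by
    refine (abs_integral_le_integral_abs).trans (le_trans ?_
      (mul_le_mul_of_nonneg_left hVB hK.le))
    rw [← integral_fst hm fun i => |V i|, ← integral_const_mul]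
    refine integral_mono_of_nonneg (ae_of_all _ fun x => abs_nonneg _)
      (hVi.abs.const_mul K) (ae_of_all _ fun x => ?_)
    simp only
    rw [abs_mul, abs_mul, abs_of_nonneg (h.lam_nonneg _)]
    exact (mul_le_of_le_one_left (mul_nonneg (h.lam_nonneg _) (abs_nonneg _)) (hwb x)).trans
      (mul_le_mul_of_nonneg_right (h.lam_le _) (abs_nonneg _))
  have hk : |∫ i, (muTot mu i - lam i) * V i ∂p| ≤ K * B := by
    refine (abs_integral_le_integral_abs).trans (le_trans ?_
      (mul_le_mul_of_nonneg_left hVB hK.le))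
    rw [← integral_const_mul]
    refine integral_mono_of_nonneg (ae_of_all _ fun x => abs_nonneg _)
      (hV.integrable_right.abs.const_mul K) (ae_of_all _ fun i => ?_)
    simp only
    rw [abs_mul]
    exact mul_le_mul_of_nonneg_right (h.abs_sub_le i) (abs_nonneg _)
  have hKB : ∀ {R x : ℝ}, |R| ≤ K * x → x ≤ B → |R| ≤ K * B := fun h1 h2 =>
    h1.trans (mul_le_mul_of_nonneg_left h2 hK.le)
  have hexp1 := Real.abs_exp_sub_one_sub_id_le (x := θ) (by rwa [abs_of_pos hθ0])
  have hexp2 := Real.abs_exp_sub_one_sub_id_le (x := -θ) (by rwa [abs_neg, abs_of_pos hθ0])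
  refine heavy_traffic_algebra (θ := θ) (e := Real.exp θ - 1) (f := 1 - Real.exp (-θ))
    (wh := ∫ x : Z × (Fin n → ℕ), w x * (muTot mu x.1 - lam x.1) ∂ν)
    (wl := ∫ x : Z × (Fin n → ℕ), w x * lam x.1 ∂ν)
    (R₂ := ∫ x : Z × (Fin n → ℕ), w x * (lam x.1 * V x.1) ∂ν)
    (R₃ := ∫ x : Z × (Fin n → ℕ), w x * (unused mu x.1 x.2 * V x.1) ∂ν)
    (integral_nonneg hw0) ?_ hm0 hmK hB hs hε hεγ rfl hexp1
    ?_ ?_ ?_ hk (hKB hR₁ hVkB) hR₂ hR₃ (hKB hR₄ hVlB) hR₅ (hKB hR₆ hVB) ?_ e6 ?_ ?_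
  · have := integral_mono hwi (integrable_const (1 : ℝ)) hw1
    simpa using this
  · have := Real.abs_exp_sub_one_le (x := θ) (by rwa [abs_of_pos hθ0])
    rwa [abs_of_pos hθ0] at this
  · rw [neg_sq] at hexp2
    rw [← abs_neg]
    convert hexp2 using 2; ring
  · have c1 : Real.exp (-θ) ≤ 1 := Real.exp_le_one_iff.2 (by linarith)
    rw [abs_of_nonneg (by linarith)]
    have := Real.add_one_le_exp (-θ)
    linarith
  · rw [e1] at hR₆eq
    rw [← hR₆eq]
    exact e6
  · rw [t3, e4]
  · linarith

end Laplace

/-! ### Laplace transforms and convergence in distribution -/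

section Convergence

variable {ι : Type*} {l : Filter ι}

/-- The map `x ↦ exp (-x)` on the half-line, as a continuous map to the unit interval. -/
noncomputable def expUnit (x : ℝ) : Icc (0 : ℝ) 1 := projIcc 0 1 zero_le_one (Real.exp (-x))

lemma continuous_expUnit : Continuous expUnit := by
  unfold expUnit
  exact continuous_projIcc.comp (by fun_prop)

lemma coe_expUnit {x : ℝ} (hx : 0 ≤ x) : (expUnit x : ℝ) = Real.exp (-x) := by
  rw [expUnit, projIcc_of_mem zero_le_one
    ⟨(Real.exp_pos _).le, Real.exp_le_one_iff.2 (by linarith)⟩]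

lemma integrable_comp_expUnit (μ : ProbabilityMeasure ℝ) (g : C(Icc (0 : ℝ) 1, ℝ)) :
    Integrable (fun x => g (expUnit x)) (μ : Measure ℝ) :=
  Integrable.of_bound (g.continuous.comp continuous_expUnit).aestronglyMeasurable ‖g‖
    (ae_of_all _ fun _ => g.norm_coe_le_norm _)

/-- Convergence of Laplace transforms gives convergence of the integrals of the continuous
functions of `exp (-x)`. -/
lemma tendsto_integral_comp_expUnit {μs : ι → ProbabilityMeasure ℝ} {μ : ProbabilityMeasure ℝ}
    (h0 : ∀ᶠ i in l, ∀ᵐ x ∂(μs i : Measure ℝ), 0 ≤ x) (h0' : ∀ᵐ x ∂(μ : Measure ℝ), 0 ≤ x)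
    (h : ∀ s : ℝ, 0 < s → Tendsto (fun i => ∫ x, Real.exp (-s * x) ∂(μs i : Measure ℝ)) l
      (𝓝 (∫ x, Real.exp (-s * x) ∂(μ : Measure ℝ)))) (g : C(Icc (0 : ℝ) 1, ℝ)) :
    Tendsto (fun i => ∫ x, g (expUnit x) ∂(μs i : Measure ℝ)) l
      (𝓝 (∫ x, g (expUnit x) ∂(μ : Measure ℝ))) := by
  -- Monomials in exp(-x) integrate to Laplace transforms at natural numbers. Weierstrass
  -- approximation then reaches all continuous functions on the unit interval.
  have hpoly : ∀ P : Polynomial ℝ,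
      Tendsto (fun i => ∫ x, P.toContinuousMapOn (Icc (0 : ℝ) 1) (expUnit x) ∂(μs i : Measure ℝ)) l
        (𝓝 (∫ x, P.toContinuousMapOn (Icc (0 : ℝ) 1) (expUnit x) ∂(μ : Measure ℝ))) := by
    intro P
    induction P using Polynomial.induction_on' with
    | add P R hP hR =>
      have key : ∀ ρ : ProbabilityMeasure ℝ,
          ∫ x, (P + R).toContinuousMapOn (Icc (0 : ℝ) 1) (expUnit x) ∂(ρ : Measure ℝ)
          = ∫ x, P.toContinuousMapOn (Icc (0 : ℝ) 1) (expUnit x) ∂(ρ : Measure ℝ)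
            + ∫ x, R.toContinuousMapOn (Icc (0 : ℝ) 1) (expUnit x) ∂(ρ : Measure ℝ) := fun ρ => by
        rw [← integral_add (integrable_comp_expUnit ρ _) (integrable_comp_expUnit ρ _)]
        exact integral_congr_ae (ae_of_all _ fun x => by simp)
      simp_rw [key]
      exact hP.add hR
    | monomial k c =>
      have key : ∀ ρ : ProbabilityMeasure ℝ, (∀ᵐ x ∂(ρ : Measure ℝ), 0 ≤ x) →
          ∫ x, (Polynomial.monomial k c).toContinuousMapOn (Icc (0 : ℝ) 1) (expUnit x)
            ∂(ρ : Measure ℝ) = c * ∫ x, Real.exp (-k * x) ∂(ρ : Measure ℝ) := fun ρ hρ => by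
        rw [← integral_const_mul]
        refine integral_congr_ae (hρ.mono fun x hx => ?_)
        simp only [Polynomial.toContinuousMapOn_apply, Polynomial.toContinuousMap_apply,
          Polynomial.eval_monomial, coe_expUnit hx]
        rw [← Real.exp_nat_mul]
        ring_nf
      rw [key μ h0']
      refine Tendsto.congr' (h0.mono fun i hi => (key _ hi).symm) (Tendsto.const_mul c ?_)
      rcases Nat.eq_zero_or_pos k with rfl | hk
      · simp [tendsto_const_nhds]
      · exact h k (Nat.cast_pos.2 hk)
  rw [Metric.tendsto_nhds]
  intro δ hδ
  obtain ⟨P, hP⟩ := exists_polynomial_near_continuousMap 0 1 g (δ / 3) (by positivity)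
  have happ : ∀ ρ : ProbabilityMeasure ℝ,
      |∫ x, P.toContinuousMapOn (Icc (0 : ℝ) 1) (expUnit x) ∂(ρ : Measure ℝ)
        - ∫ x, g (expUnit x) ∂(ρ : Measure ℝ)| ≤ δ / 3 := fun ρ => by
    rw [← integral_sub (integrable_comp_expUnit ρ _) (integrable_comp_expUnit ρ _)]
    have hx : ∀ x, ‖P.toContinuousMapOn (Icc (0 : ℝ) 1) (expUnit x) - g (expUnit x)‖ ≤ δ / 3 :=
      fun x => ((P.toContinuousMapOn (Icc (0 : ℝ) 1) - g).norm_coe_le_norm (expUnit x)).trans hP.le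
    simpa using norm_integral_le_of_norm_le_const (μ := (ρ : Measure ℝ)) (ae_of_all _ hx)
  filter_upwards [Metric.tendsto_nhds.1 (hpoly P) (δ / 3) (by positivity)] with i hi
  rw [Real.dist_eq] at hi ⊢
  have h1 := abs_le.1 (happ (μs i))
  have h2 := abs_le.1 (happ μ)
  have h3 := abs_lt.1 hi
  rw [abs_lt]
  constructor <;> linarith [h1.1, h1.2, h2.1, h2.2, h3.1, h3.2]

/-- A bounded continuous function of `x`, multiplied by `1 - (1 - exp (-x)) ^ k`, is a continuous
function of `exp (-x)` on the closed unit interval. -/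
lemma continuous_log_mul (f : BoundedContinuousFunction ℝ ℝ) (k : ℕ) :
    Continuous fun y : Icc (0 : ℝ) 1 => f (-Real.log y) * (1 - (1 - (y : ℝ)) ^ k) := by
  rw [continuous_iff_continuousAt]
  intro y
  -- At zero the logarithm is discontinuous, but `f` is bounded and the other factor tends to zero.
  by_cases hy : (y : ℝ) = 0
  · have h2 : Tendsto (fun z : Icc (0 : ℝ) 1 => ‖f‖ * |1 - (1 - (z : ℝ)) ^ k|) (𝓝 y) (𝓝 0) := by
      have : Continuous fun z : Icc (0 : ℝ) 1 => ‖f‖ * |1 - (1 - (z : ℝ)) ^ k| := by fun_prop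
      have := this.tendsto y
      simpa [hy] using this
    have h3 : f (-Real.log y) * (1 - (1 - (y : ℝ)) ^ k) = 0 := by simp [hy]
    rw [ContinuousAt, h3]
    refine squeeze_zero_norm (fun z => ?_) h2
    rw [norm_mul, Real.norm_eq_abs (1 - (1 - (z : ℝ)) ^ k)]
    exact mul_le_mul_of_nonneg_right (f.norm_coe_le_norm _) (abs_nonneg _)
  · refine ContinuousAt.mul (f.continuous.continuousAt.comp ?_) (by fun_prop)
    exact ((Real.continuousAt_log hy).comp continuous_subtype_val.continuousAt).neg

/-- The continuity theorem for Laplace transforms of laws on the half-line. -/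
theorem tendsto_of_tendsto_integral_exp {μs : ι → ProbabilityMeasure ℝ} {μ : ProbabilityMeasure ℝ}
    (h0 : ∀ᶠ i in l, ∀ᵐ x ∂(μs i : Measure ℝ), 0 ≤ x) (h0' : ∀ᵐ x ∂(μ : Measure ℝ), 0 ≤ x)
    (h : ∀ s : ℝ, 0 < s → Tendsto (fun i => ∫ x, Real.exp (-s * x) ∂(μs i : Measure ℝ)) l
      (𝓝 (∫ x, Real.exp (-s * x) ∂(μ : Measure ℝ)))) :
    Tendsto μs l (𝓝 μ) := by
  rw [ProbabilityMeasure.tendsto_iff_forall_integral_tendsto]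
  intro f
  rw [Metric.tendsto_nhds]
  intro δ hδ
  -- (1 - exp(-x))^k is a tail cutoff that is itself continuous in exp(-x). Its integrals under `μs
  -- i` therefore converge, which supplies tightness.
  set r : ℕ → C(Icc (0 : ℝ) 1, ℝ) := fun k => ⟨fun y => (1 - (y : ℝ)) ^ k, by fun_prop⟩ with hr
  have hr0 : Tendsto (fun k => ∫ x, r k (expUnit x) ∂(μ : Measure ℝ)) atTop (𝓝 0) := by
    suffices Tendsto (fun k => ∫ x, r k (expUnit x) ∂(μ : Measure ℝ)) atTop
        (𝓝 (∫ _ : ℝ, (0 : ℝ) ∂(μ : Measure ℝ))) by simpa only [integral_zero] using this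
    refine tendsto_integral_of_dominated_convergence (fun _ => 1)
      (fun k => (integrable_comp_expUnit μ (r k)).aestronglyMeasurable) (integrable_const _)
      (fun k => ae_of_all _ fun x => ?_) (h0'.mono fun x hx => ?_)
    · have h1 := (expUnit x).2.1
      have h2 := (expUnit x).2.2
      simp only [hr, ContinuousMap.coe_mk]
      rw [Real.norm_eq_abs, abs_of_nonneg (pow_nonneg (by linarith) _)]
      exact pow_le_one₀ (by linarith) (by linarith)
    · simp only [hr, ContinuousMap.coe_mk, coe_expUnit hx]
      have h1 := Real.exp_pos (-x)
      have h2 : Real.exp (-x) ≤ 1 := Real.exp_le_one_iff.2 (by linarith)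
      exact tendsto_pow_atTop_nhds_zero_of_lt_one (by linarith) (by linarith)
  set M := ‖f‖ + 1 with hM
  have hM0 : 0 < M := by positivity
  obtain ⟨k, hk⟩ := (hr0.eventually_lt_const (show (0 : ℝ) < δ / (4 * M) by positivity)).exists
  set g : C(Icc (0 : ℝ) 1, ℝ) :=
    ⟨fun y => f (-Real.log y) * (1 - (1 - (y : ℝ)) ^ k), continuous_log_mul f k⟩ with hg
  have happ : ∀ ρ : ProbabilityMeasure ℝ, (∀ᵐ x ∂(ρ : Measure ℝ), 0 ≤ x) →
      |∫ x, f x ∂(ρ : Measure ℝ) - ∫ x, g (expUnit x) ∂(ρ : Measure ℝ)|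
        ≤ M * ∫ x, r k (expUnit x) ∂(ρ : Measure ℝ) := fun ρ hρ => by
    rw [← integral_sub (f.integrable _) (integrable_comp_expUnit ρ g), ← integral_const_mul,
      ← Real.norm_eq_abs]
    refine norm_integral_le_of_norm_le ((integrable_comp_expUnit ρ (r k)).const_mul M)
      (hρ.mono fun x hx => ?_)
    simp only [hr, hg, ContinuousMap.coe_mk, coe_expUnit hx, Real.log_exp, neg_neg]
    have h2 : Real.exp (-x) ≤ 1 := Real.exp_le_one_iff.2 (by linarith)
    have h3 : 0 ≤ (1 - Real.exp (-x)) ^ k := pow_nonneg (by linarith) _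
    rw [show f x - f x * (1 - (1 - Real.exp (-x)) ^ k) = f x * (1 - Real.exp (-x)) ^ k by ring,
      norm_mul, Real.norm_of_nonneg h3]
    exact mul_le_mul_of_nonneg_right ((f.norm_coe_le_norm x).trans (by linarith)) h3
  have hMd : M * (δ / (4 * M)) = δ / 4 := by field_simp
  filter_upwards [h0, (tendsto_integral_comp_expUnit h0 h0' h (r k)).eventually_lt_const hk,
    Metric.tendsto_nhds.1 (tendsto_integral_comp_expUnit h0 h0' h g) (δ / 4) (by positivity)]
    with i hi1 hi2 hi3
  have e1 := abs_le.1 ((happ _ hi1).trans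
    ((mul_le_mul_of_nonneg_left hi2.le hM0.le).trans_eq hMd))
  have e2 := abs_le.1 ((happ _ h0').trans
    ((mul_le_mul_of_nonneg_left hk.le hM0.le).trans_eq hMd))
  rw [Real.dist_eq] at hi3 ⊢
  have e3 := abs_lt.1 hi3
  rw [abs_lt]
  constructor <;> linarith [e1.1, e1.2, e2.1, e2.2, e3.1, e3.2]

/-- Random variables that are close in mean to ones converging in distribution converge to the
same limit. -/
theorem tendstoInDistribution_of_integral_dist {Ω Ω' E : Type*} [MeasurableSpace Ω]
    [MeasurableSpace Ω'] [MeasurableSpace E] [PseudoMetricSpace E] [OpensMeasurableSpace E]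
    [l.IsCountablyGenerated] {μ : ι → Measure Ω} [∀ i, IsProbabilityMeasure (μ i)]
    {μ' : Measure Ω'} [IsProbabilityMeasure μ'] {X Y : ι → Ω → E} {W : Ω' → E}
    (h : TendstoInDistribution Y l W μ μ') (hX : ∀ i, AEMeasurable (X i) (μ i)) {D : ι → Ω → ℝ}
    (hD : ∀ᶠ i in l, Integrable (D i) (μ i) ∧ ∀ ω, dist (X i ω) (Y i ω) ≤ D i ω)
    (hD0 : Tendsto (fun i => ∫ ω, D i ω ∂(μ i)) l (𝓝 0)) : TendstoInDistribution X l W μ μ' := by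
  refine ⟨hX, h.aemeasurable_limit, ?_⟩
  refine tendsto_iff_forall_lipschitz_integral_tendsto.2 ?_
  rintro F ⟨C, hC⟩ ⟨L, hL⟩
  have hY := tendsto_iff_forall_lipschitz_integral_tendsto.1 h.tendsto F ⟨C, hC⟩ ⟨L, hL⟩
  have hFm := hL.continuous.measurable
  have hFb : ∃ B, ∀ x, |F x| ≤ B := by
    by_cases hE : Nonempty E
    · obtain ⟨x₀⟩ := hE
      refine ⟨C + |F x₀|, fun x => ?_⟩
      have := hC x x₀
      rw [Real.dist_eq] at this
      have h2 := abs_sub_abs_le_abs_sub (F x) (F x₀)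
      linarith
    · exact ⟨0, fun x => (hE ⟨x⟩).elim⟩
  obtain ⟨B, hB⟩ := hFb
  simp only [ProbabilityMeasure.coe_mk] at hY ⊢
  have eY : ∀ i, ∫ x, F x ∂((μ i).map (Y i)) = ∫ ω, F (Y i ω) ∂(μ i) := fun i =>
    integral_map (h.forall_aemeasurable i) hL.continuous.measurable.aestronglyMeasurable
  have eX : ∀ i, ∫ x, F x ∂((μ i).map (X i)) = ∫ ω, F (X i ω) ∂(μ i) := fun i =>
    integral_map (hX i) hL.continuous.measurable.aestronglyMeasurable
  simp_rw [eY] at hY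
  simp_rw [eX]
  have hint : ∀ (T : ι → Ω → E), (∀ i, AEMeasurable (T i) (μ i)) → ∀ i,
      Integrable (fun ω => F (T i ω)) (μ i) := fun T hT i =>
    Integrable.of_bound (hFm.comp_aemeasurable (hT i)).aestronglyMeasurable B
      (ae_of_all _ fun ω => hB _)
  have hdiff : Tendsto (fun i => ∫ ω, F (X i ω) ∂(μ i) - ∫ ω, F (Y i ω) ∂(μ i)) l (𝓝 0) := by
    have hLD : Tendsto (fun i => (L : ℝ) * ∫ ω, D i ω ∂(μ i)) l (𝓝 0) := by
      simpa using hD0.const_mul (L : ℝ)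
    refine squeeze_zero_norm' (hD.mono fun i hi => ?_) hLD
    rw [← integral_sub (hint X hX i) (hint Y h.forall_aemeasurable i), ← integral_const_mul]
    refine norm_integral_le_of_norm_le (hi.1.const_mul _) (ae_of_all _ fun ω => ?_)
    rw [← dist_eq_norm]
    exact (hL.dist_le_mul _ _).trans (mul_le_mul_of_nonneg_left (hi.2 ω) L.2)
  simpa using hdiff.add hY

lemma expMeasure_nonneg {r : ℝ} : ∀ᵐ x ∂(expMeasure r), 0 ≤ x := by
  rw [ae_iff]
  have : {x : ℝ | ¬ 0 ≤ x} = Iio 0 := by ext; simp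
  rw [this, expMeasure, gammaMeasure, withDensity_apply _ measurableSet_Iio]
  exact lintegral_exponentialPDF_of_nonpos le_rfl

/-- The Laplace transform of the exponential distribution. -/
lemma integral_exp_expMeasure {r s : ℝ} (hr : 0 < r) (hs : 0 ≤ s) :
    ∫ x, Real.exp (-s * x) ∂(expMeasure r) = r / (r + s) := by
  have hmeas : ∀ t : ℝ, Measurable (gammaPDF 1 t) := fun t =>
    (measurable_gammaPDFReal 1 t).ennreal_ofReal
  have hden : ∀ {t : ℝ}, 0 < t → ∀ f : ℝ → ℝ,
      ∫ x, f x ∂(expMeasure t) = ∫ x, exponentialPDFReal t x * f x := fun {t} ht f => by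
    rw [expMeasure, gammaMeasure, integral_withDensity_eq_integral_toReal_smul
      (hmeas t) (ae_of_all _ fun x => ENNReal.ofReal_lt_top)]
    refine integral_congr_ae (ae_of_all _ fun x => ?_)
    simp only [smul_eq_mul]
    congr 1
    exact ENNReal.toReal_ofReal (exponentialPDFReal_nonneg ht x)
  -- Tilting the density of rate `r` by exp(-sx) gives `r / (r + s)` times the density of rate `r +
  -- s`, whose mass is one.
  have hrs : 0 < r + s := by linarith
  have h1 := hden hrs fun _ => 1
  have := isProbabilityMeasure_expMeasure hrs
  simp only [integral_const, probReal_univ, smul_eq_mul, mul_one] at h1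
  rw [hden hr, ← mul_one (r / (r + s)), h1, ← integral_const_mul]
  refine integral_congr_ae (ae_of_all _ fun x => ?_)
  simp only [exponentialPDFReal, gammaPDFReal]
  split_ifs with hx
  · simp only [Real.rpow_one, Real.Gamma_one, sub_self, Real.rpow_zero, div_one, mul_one]
    rw [mul_assoc, ← Real.exp_add, show -(r * x) + -s * x = -((r + s) * x) by ring]
    field_simp
  · simp

end Convergence

/-! ### Uniformity in ε by interpolation between two parameters -/

section Interpolation

variable {Z : Type*} [Countable Z] [MeasurableSpace Z] [MeasurableSingletonClass Z] {n : ℕ}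
  {Q : Z → Z → ℝ} {lam lam₁ lam₂ : Z → ℝ} {mu : Z → Fin n → ℝ} {K m e a : ℝ} {p : Measure Z}
  [IsProbabilityMeasure p] {V₁ V₂ K₁ K₂ K₃ Vl : Z → ℝ}

/-- Solutions of the Poisson equations at two values `e` and `2 * e` of the heavy traffic
parameter; by affinity they give solutions at every value in between and in the limit. -/
structure TwoPointData (Q : Z → Z → ℝ) (p : Measure Z) (mu : Z → Fin n → ℝ) (K m e a : ℝ)
    (lam₁ lam₂ V₁ V₂ K₁ K₂ K₃ Vl : Z → ℝ) : Prop where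
  bounds₁ : JSQBounds Q lam₁ mu K
  bounds₂ : JSQBounds Q lam₂ mu K
  m_pos : 0 < m
  e_pos : 0 < e
  a_pos : 0 < a
  a_le : a ≤ 1
  gap : ∀ i, 0 < sscGap lam₂ mu i
  mean : ∫ i, muTot mu i ∂p = m
  mean₁ : ∫ i, (muTot mu i - lam₁ i) ∂p = e * m
  mean₂ : ∫ i, (muTot mu i - lam₂ i) ∂p = 2 * e * m
  pair₁ : PoissonPair Q p (fun i => muTot mu i - lam₁ i) V₁
  pair₂ : PoissonPair Q p (fun i => muTot mu i - lam₂ i) V₂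
  pair₁₁ : PoissonPair Q p (fun i => (muTot mu i - lam₁ i) * V₁ i) K₁
  pair₂₂ : PoissonPair Q p (fun i => (muTot mu i - lam₂ i) * V₂ i) K₂
  pair₁₂ : PoissonPair Q p
    (fun i => ((muTot mu i - lam₁ i) * V₂ i + (muTot mu i - lam₂ i) * V₁ i)) K₃
  pairl : PoissonPair Q p (fun i => muTot mu i) Vl
  moment₁ : Integrable (fun i => |V₁ i| ^ (1 + a)) p
  moment₂ : Integrable (fun i => |V₂ i| ^ (1 + a)) p

/-- The affine interpolation `t * f + (1 - t) * g`. -/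
def interp (t : ℝ) (f g : Z → ℝ) (i : Z) : ℝ := t * f i + (1 - t) * g i

/-- A common envelope for the interpolated solutions. -/
def envelope (V₁ V₂ : Z → ℝ) (i : Z) : ℝ := 1 + 2 * (|V₁ i| + |V₂ i|)

lemma envelope_nonneg (i : Z) : 0 ≤ envelope V₁ V₂ i := by rw [envelope]; positivity

lemma abs_interp_le {t : ℝ} (ht1 : 1 ≤ t) (ht2 : t ≤ 2) (i : Z) :
    |interp t V₁ V₂ i| ≤ 2 * |V₁ i| + |V₂ i| := by
  rw [interp]
  refine (abs_add_le _ _).trans ?_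
  rw [abs_mul, abs_mul, abs_of_nonneg (by linarith : 0 ≤ t), abs_of_nonpos (by linarith : 1 - t ≤ 0)]
  have := abs_nonneg (V₁ i)
  have := abs_nonneg (V₂ i)
  nlinarith

lemma abs_quadratic_le {t : ℝ} (ht1 : 1 ≤ t) (ht2 : t ≤ 2) (x y z : ℝ) :
    |t ^ 2 * x + (1 - t) ^ 2 * y + t * (1 - t) * z| ≤ 4 * |x| + |y| + 2 * |z| := by
  refine (abs_add_le _ _).trans (add_le_add ((abs_add_le _ _).trans (add_le_add ?_ ?_)) ?_)
  · rw [abs_mul, abs_of_nonneg (sq_nonneg t)]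
    exact mul_le_mul_of_nonneg_right (by nlinarith) (abs_nonneg _)
  · rw [abs_mul, abs_of_nonneg (sq_nonneg _)]
    exact mul_le_of_le_one_left (abs_nonneg _) (by nlinarith)
  · rw [abs_mul]
    exact mul_le_mul_of_nonneg_right (abs_le.2 ⟨by nlinarith, by nlinarith⟩) (abs_nonneg _)

/-- Replacing the variance parameter by its limit. -/
lemma abs_sub_one_div_le {W s k k' m E F : ℝ} (hW0 : 0 ≤ W) (hW1 : W ≤ 1) (hs : 0 < s)
    (hm : 0 < m) (hk' : 0 ≤ k') (hE : |W * (1 + s * (1 + k / m)) - 1| ≤ E) (hF : |k - k'| ≤ F) :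
    |W - 1 / (1 + s * (1 + k' / m))| ≤ E + s * F / m := by
  set X := 1 + s * (1 + k' / m) with hX
  have hX1 : 1 ≤ X := by
    have : 0 ≤ s * (1 + k' / m) := by positivity
    linarith
  have e1 : W - 1 / X = (W * X - 1) / X := by field_simp
  have e2 : W * X - 1 = (W * (1 + s * (1 + k / m)) - 1) - W * (s * (k - k') / m) := by
    rw [hX]; ring
  rw [e1, abs_div, abs_of_pos (by linarith : 0 < X)]
  refine (div_le_self (abs_nonneg _) hX1).trans ?_
  rw [e2]
  refine (abs_sub _ _).trans (add_le_add hE ?_)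
  rw [abs_mul, abs_of_nonneg hW0, abs_div, abs_mul, abs_of_pos hs, abs_of_pos hm]
  exact (mul_le_of_le_one_left (by positivity) hW1).trans
    (div_le_div_of_nonneg_right (mul_le_mul_of_nonneg_left hF hs.le) hm.le)

lemma integrable_envelope_rpow {b : ℝ} (hb : 0 ≤ b) (h₁ : Integrable (fun i => |V₁ i| ^ b) p)
    (h₂ : Integrable (fun i => |V₂ i| ^ b) p) :
    Integrable (fun i => envelope V₁ V₂ i ^ b) p := by
  refine Integrable.mono' ((((integrable_const (1 : ℝ)).add h₁).add h₂).const_mul ((5 : ℝ) ^ b))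
    Measurable.of_discrete.aestronglyMeasurable (ae_of_all _ fun i => ?_)
  have u := abs_nonneg (V₁ i)
  have v := abs_nonneg (V₂ i)
  rw [Real.norm_of_nonneg (Real.rpow_nonneg (envelope_nonneg i) _)]
  set x := max 1 (max |V₁ i| |V₂ i|) with hx
  have hx1 : 1 ≤ x := le_max_left _ _
  have hx2 : |V₁ i| ≤ x := (le_max_left _ _).trans (le_max_right _ _)
  have hx3 : |V₂ i| ≤ x := (le_max_right _ _).trans (le_max_right _ _)
  calc envelope V₁ V₂ i ^ b ≤ (5 * x) ^ b :=
        Real.rpow_le_rpow (envelope_nonneg i) (by rw [envelope]; linarith) hb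
    _ = 5 ^ b * x ^ b := Real.mul_rpow (by norm_num) (by linarith)
    _ ≤ 5 ^ b * (1 + |V₁ i| ^ b + |V₂ i| ^ b) := by
        refine mul_le_mul_of_nonneg_left ?_ (by positivity)
        have p1 := Real.rpow_nonneg u b
        have p2 := Real.rpow_nonneg v b
        rcases max_choice (1 : ℝ) (max |V₁ i| |V₂ i|) with h | h
        · rw [hx, h, Real.one_rpow]; linarith
        · rcases max_choice |V₁ i| |V₂ i| with h' | h' <;> rw [hx, h, h'] <;> linarith

namespace TwoPointData

lemma K_pos
    (D : TwoPointData Q p mu K m e a lam₁ lam₂ V₁ V₂ K₁ K₂ K₃ Vl) : 0 < K := by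
  have := integral_mono D.pairl.integrable_left (integrable_const K) fun i => D.bounds₁.muTot_le i
  rw [D.mean] at this
  simp only [integral_const, probReal_univ, smul_eq_mul, one_mul] at this
  exact D.m_pos.trans_le this

lemma n_pos
    (D : TwoPointData Q p mu K m e a lam₁ lam₂ V₁ V₂ K₁ K₂ K₃ Vl) : (0 : ℝ) < n := by
  have := D.bounds₁.servers
  positivity

/-- Linearity of the Poisson equation. The weight `t = 2 - ε / e` corresponds to parameter ε, and `t
= 2` to the heavy traffic limit. -/
lemma pair_interp
    (D : TwoPointData Q p mu K m e a lam₁ lam₂ V₁ V₂ K₁ K₂ K₃ Vl) (t : ℝ) :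
    PoissonPair Q p (fun i => muTot mu i - interp t lam₁ lam₂ i) (interp t V₁ V₂) :=
  ((D.pair₁.const_mul D.bounds₁.rates t).add D.bounds₁.rates
    (D.pair₂.const_mul D.bounds₁.rates (1 - t))).congr fun i => by rw [interp]; ring

lemma mean_interp
    (D : TwoPointData Q p mu K m e a lam₁ lam₂ V₁ V₂ K₁ K₂ K₃ Vl) (t : ℝ) :
    ∫ i, (muTot mu i - interp t lam₁ lam₂ i) ∂p = (2 - t) * e * m := by
  have : ∀ i, muTot mu i - interp t lam₁ lam₂ i
    = t * (muTot mu i - lam₁ i) + (1 - t) * (muTot mu i - lam₂ i) := fun i => by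
      rw [interp]; ring
  simp_rw [this]
  rw [integral_add (D.pair₁.integrable_left.const_mul _) (D.pair₂.integrable_left.const_mul _),
    integral_const_mul, integral_const_mul, D.mean₁, D.mean₂]
  ring

/-- The solution of the second Poisson equation at the interpolated parameter. -/
lemma pair_interp_mul
    (D : TwoPointData Q p mu K m e a lam₁ lam₂ V₁ V₂ K₁ K₂ K₃ Vl) (t : ℝ) :
    PoissonPair Q p (fun i => (muTot mu i - interp t lam₁ lam₂ i) * interp t V₁ V₂ i)
      (fun i => t ^ 2 * K₁ i + (1 - t) ^ 2 * K₂ i + t * (1 - t) * K₃ i) :=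
  (((D.pair₁₁.const_mul D.bounds₁.rates (t ^ 2)).add D.bounds₁.rates
    (D.pair₂₂.const_mul D.bounds₁.rates ((1 - t) ^ 2))).add D.bounds₁.rates
      (D.pair₁₂.const_mul D.bounds₁.rates (t * (1 - t)))).congr fun i => by
        rw [interp, interp]; ring

/-- Being a quadratic polynomial in `t`, the variance parameter has a limit at `t = 2` and is
Lipschitz near it. -/
lemma integral_mul_interp
    (D : TwoPointData Q p mu K m e a lam₁ lam₂ V₁ V₂ K₁ K₂ K₃ Vl) (t : ℝ) :
    ∫ i, (muTot mu i - interp t lam₁ lam₂ i) * interp t V₁ V₂ i ∂p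
      = t ^ 2 * (∫ i, (muTot mu i - lam₁ i) * V₁ i ∂p)
        + (1 - t) ^ 2 * (∫ i, (muTot mu i - lam₂ i) * V₂ i ∂p)
        + t * (1 - t) *
          (∫ i, ((muTot mu i - lam₁ i) * V₂ i + (muTot mu i - lam₂ i) * V₁ i) ∂p) := by
  have : ∀ i, (muTot mu i - interp t lam₁ lam₂ i) * interp t V₁ V₂ i
    = t ^ 2 * ((muTot mu i - lam₁ i) * V₁ i) + (1 - t) ^ 2 * ((muTot mu i - lam₂ i) * V₂ i)
      + t * (1 - t) * ((muTot mu i - lam₁ i) * V₂ i + (muTot mu i - lam₂ i) * V₁ i) := fun i => by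
      rw [interp, interp]; ring
  simp_rw [this]
  have i₁ := D.pair₁₁.integrable_left.const_mul (t ^ 2)
  have i₂ := D.pair₂₂.integrable_left.const_mul ((1 - t) ^ 2)
  have i₃ := D.pair₁₂.integrable_left.const_mul (t * (1 - t))
  have i₁₂ : Integrable (fun i => t ^ 2 * ((muTot mu i - lam₁ i) * V₁ i)
    + (1 - t) ^ 2 * ((muTot mu i - lam₂ i) * V₂ i)) p := i₁.add i₂
  rw [integral_add i₁₂ i₃, integral_add i₁ i₂, integral_const_mul, integral_const_mul,
    integral_const_mul]

/-- The limiting variance parameter depends on the heavy traffic parameter in a Lipschitz way. -/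
lemma exists_abs_integral_mul_interp_sub_le
    (D : TwoPointData Q p mu K m e a lam₁ lam₂ V₁ V₂ K₁ K₂ K₃ Vl) :
    ∃ C, 0 ≤ C ∧ ∀ ε, 0 ≤ ε → ε ≤ e →
      |∫ i, (muTot mu i - interp (2 - ε / e) lam₁ lam₂ i) * interp (2 - ε / e) V₁ V₂ i ∂p
        - ∫ i, (muTot mu i - interp 2 lam₁ lam₂ i) * interp 2 V₁ V₂ i ∂p| ≤ C * ε := by
  simp_rw [D.integral_mul_interp]
  set x := ∫ i, (muTot mu i - lam₁ i) * V₁ i ∂p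
  set y := ∫ i, (muTot mu i - lam₂ i) * V₂ i ∂p
  set z := ∫ i, ((muTot mu i - lam₁ i) * V₂ i + (muTot mu i - lam₂ i) * V₁ i) ∂p
  have he := D.e_pos
  refine ⟨(4 * |x| + 2 * |y| + 3 * |z|) / e, by positivity, fun ε h0 h1 => ?_⟩
  set r := ε / e with hr
  have hr0 : 0 ≤ r := by positivity
  have hr1 : r ≤ 1 := (div_le_one he).2 h1
  rw [div_mul_eq_mul_div, mul_div_assoc, ← hr]
  have e1 : (2 - r) ^ 2 * x + (1 - (2 - r)) ^ 2 * y + (2 - r) * (1 - (2 - r)) * z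
      - (2 ^ 2 * x + (1 - 2) ^ 2 * y + 2 * (1 - 2) * z)
      = -(r * ((4 - r) * x + (2 - r) * y - (3 - r) * z)) := by ring
  rw [e1, abs_neg, abs_mul, abs_of_nonneg hr0, mul_comm r]
  refine mul_le_mul_of_nonneg_right ?_ hr0
  refine (abs_sub _ _).trans (add_le_add ((abs_add_le _ _).trans (add_le_add ?_ ?_)) ?_) <;>
  · rw [abs_mul, abs_of_nonneg (by linarith)]
    exact mul_le_mul_of_nonneg_right (by linarith) (abs_nonneg _)

/-- At `t = 2` the slack has mean zero, so this integral is an asymptotic variance. It is what makes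
the limiting mean positive. -/
lemma integral_mul_interp_two_nonneg
    (D : TwoPointData Q p mu K m e a lam₁ lam₂ V₁ V₂ K₁ K₂ K₃ Vl) (hp : IsStationary Q p) :
    0 ≤ ∫ i, (muTot mu i - interp 2 lam₁ lam₂ i) * interp 2 V₁ V₂ i ∂p := by
  refine (D.pair_interp 2).integral_mul_nonneg D.bounds₁.rates hp (B := 3 * K) (fun i => ?_) ?_
  · have h1 := abs_le.1 (D.bounds₁.abs_sub_le i)
    have h2 := abs_le.1 (D.bounds₂.abs_sub_le i)
    rw [interp, abs_le]
    constructor <;> linarith [h1.1, h1.2, h2.1, h2.2]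
  · rw [D.mean_interp]; ring

/-- Uniform state space collapse. -/
lemma exists_integral_perp_rpow_le
    (D : TwoPointData Q p mu K m e a lam₁ lam₂ V₁ V₂ K₁ K₂ K₃ Vl) :
    ∃ C, 0 ≤ C ∧ ∀ t, 1 ≤ t → t ≤ 2 → ∀ ν : Measure (Z × (Fin n → ℕ)), IsProbabilityMeasure ν →
      ν.map Prod.fst = p → JSQBounds Q (interp t lam₁ lam₂) mu K →
      IsStationary (jsqRate Q (interp t lam₁ lam₂) mu) ν →
      Integrable (fun x : Z × (Fin n → ℕ) => perp x.2 ^ (1 + a)) ν ∧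
      ∫ x : Z × (Fin n → ℕ), perp x.2 ^ (1 + a) ∂ν ≤ C := by
  have hc : 0 < e * m := mul_pos D.e_pos D.m_pos
  have hK := D.K_pos
  have hn0 := D.n_pos
  have hA := integrable_envelope_rpow (by linarith [D.a_pos] : 0 ≤ 1 + a) D.moment₁ D.moment₂
  refine ⟨2 * n / (e * m) * (((e * m) / n + 14 * K) *
        (((e * m) / (2 * n * ((e * m) / n + 14 * K))) ^ (-a)
          * ∫ i, envelope V₁ V₂ i ^ (1 + a) ∂p)), ?_, fun t ht1 ht2 ν _ hm hJ hν => ?_⟩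
  · have : 0 ≤ ∫ i, envelope V₁ V₂ i ^ (1 + a) ∂p :=
      integral_nonneg fun i => Real.rpow_nonneg (envelope_nonneg i) _
    positivity
  -- For `H = t * (V₂ - V₁)` one has `gen Q H = t * (e * m + lam₂ - lam₁)`. Added to the margin at
  -- parameter `t`, this gives `sscGap lam₂ mu + t * e * m`, which exceeds `e * m` since `t ≥ 1`,
  -- even if the margin has infimum zero.
  · have hH := (D.pair₂.add D.bounds₁.rates
      (D.pair₁.const_mul D.bounds₁.rates (-1))).const_mul D.bounds₁.rates t
    refine integral_perp_rpow_le hJ hm hν D.a_pos D.a_le hc hK hH.integrable_right hH.summable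
      (fun i => ?_) hA fun i => ?_
    · rw [envelope, abs_mul, abs_of_nonneg (by linarith : 0 ≤ t)]
      have h1 : |V₂ i + -1 * V₁ i| ≤ |V₁ i| + |V₂ i| := by
        rw [neg_one_mul, ← sub_eq_add_neg, add_comm]; exact abs_sub _ _
      have h2 := mul_le_mul ht2 h1 (abs_nonneg _) zero_le_two
      linarith
    · rw [hH.gen_eq, integral_const_mul,
        integral_add D.pair₂.integrable_left (D.pair₁.integrable_left.const_mul _),
        integral_const_mul, D.mean₁, D.mean₂]
      have h1 := D.gap i
      rw [sscGap] at h1 ⊢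
      rw [interp]
      have h2 := mul_le_mul_of_nonneg_right ht1 hc.le
      nlinarith

/-- The Laplace transform of the scaled total queue length, uniformly in the parameter. -/
theorem exists_abs_laplace_sub_le
    (D : TwoPointData Q p mu K m e a lam₁ lam₂ V₁ V₂ K₁ K₂ K₃ Vl) (hp : IsStationary Q p) {s : ℝ} (hs : 0 < s) :
    ∃ C, 0 ≤ C ∧ ∀ ε, 0 < ε → ε ≤ e → ε ≤ 1 → s * ε ≤ 1 → ∀ ν : Measure (Z × (Fin n → ℕ)),
      IsProbabilityMeasure ν → ν.map Prod.fst = p →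
      JSQBounds Q (interp (2 - ε / e) lam₁ lam₂) mu K →
      IsStationary (jsqRate Q (interp (2 - ε / e) lam₁ lam₂) mu) ν →
      |∫ x : Z × (Fin n → ℕ), Real.exp (-(s * ε) * qSum x.2) ∂ν
        - 1 / (1 + s * (1 +
          (∫ i, (muTot mu i - interp 2 lam₁ lam₂ i) * interp 2 V₁ V₂ i ∂p) / m))|
        ≤ C * ε ^ (1 - 1 / (1 + a)) := by
  obtain ⟨Cp, hCp0, hCp⟩ := D.exists_integral_perp_rpow_le
  obtain ⟨Ck, hCk0, hCk⟩ := D.exists_abs_integral_mul_interp_sub_le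
  have hkst := D.integral_mul_interp_two_nonneg hp
  set kst := ∫ i, (muTot mu i - interp 2 lam₁ lam₂ i) * interp 2 V₁ V₂ i ∂p with hkst'
  have hK := D.K_pos
  have hn0 := D.n_pos
  have hm0 := D.m_pos
  have ha := D.a_pos
  have hA := integrable_envelope_rpow (by linarith : 0 ≤ 1 + a) D.moment₁ D.moment₂
  set M := ∫ i, envelope V₁ V₂ i ^ (1 + a) ∂p with hM
  have hM0 : 0 ≤ M := integral_nonneg fun i => Real.rpow_nonneg (envelope_nonneg i) _
  set B₁ := ∫ i, (2 * |V₁ i| + |V₂ i|) ∂p with hB₁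
  set B₂ := ∫ i, (4 * |K₁ i| + |K₂ i| + 2 * |K₃ i|) ∂p with hB₂
  set B₃ := ∫ i, |Vl i| ∂p with hB₃
  have hB₁0 : 0 ≤ B₁ := integral_nonneg fun i => by positivity
  have hB₂0 : 0 ≤ B₂ := integral_nonneg fun i => by positivity
  have hB₃0 : 0 ≤ B₃ := integral_nonneg fun i => by positivity
  set N := (n : ℝ) ^ (1 + a) * Cp with hN
  have hN0 : 0 ≤ N := by positivity
  -- One constant, independent of ε, dominates the first moments of the three Poisson solutions and
  -- the two splitting bounds.
  set B := B₁ + B₂ + B₃ + (m + K * M) + (m + K * N) with hB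
  have hKM := mul_nonneg hK.le hM0
  have hKN := mul_nonneg hK.le hN0
  refine ⟨(11 * s ^ 2 * K * B + s ^ 2 * K + 3 * s * B + s * K) / m + s * Ck / m,
    by positivity, fun ε h0 he h1 hsε ν _ hm hJ hν => ?_⟩
  set t := 2 - ε / e with ht
  have hr0 : 0 ≤ ε / e := div_nonneg h0.le D.e_pos.le
  have hr1 : ε / e ≤ 1 := (div_le_one D.e_pos).2 he
  have ht1 : 1 ≤ t := by linarith
  have ht2 : t ≤ 2 := by linarith
  set γ := ε ^ (1 - 1 / (1 + a)) with hγ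
  have hεγ : ε ≤ γ := by
    rw [hγ]
    nth_rewrite 1 [← Real.rpow_one ε]
    refine Real.rpow_le_rpow_of_exponent_ge h0 h1 ?_
    have : 0 < 1 / (1 + a) := by positivity
    linarith
  have hmean : ∫ i, (muTot mu i - interp t lam₁ lam₂ i) ∂p = ε * m := by
    have := D.e_pos
    rw [D.mean_interp, ht]; field_simp; ring
  obtain ⟨hpi, hpb⟩ := hCp t ht1 ht2 ν inferInstance hm hJ hν
  obtain ⟨hui, hu⟩ := integral_unused hJ hm hν
  have hV := D.pair_interp t
  have hVk := D.pair_interp_mul t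
  have hVe : ∀ i, |interp t V₁ V₂ i| ≤ envelope V₁ V₂ i := fun i => by
    have := abs_interp_le (V₁ := V₁) (V₂ := V₂) ht1 ht2 i
    have := abs_nonneg (V₂ i)
    rw [envelope]; linarith
  have hVp : Integrable (fun i => |interp t V₁ V₂ i| ^ (1 + a)) p :=
    Integrable.mono' hA Measurable.of_discrete.aestronglyMeasurable (ae_of_all _ fun i => by
      rw [Real.norm_of_nonneg (by positivity)]
      exact Real.rpow_le_rpow (abs_nonneg _) (hVe i) (by linarith))
  have huV : ∫ x : Z × (Fin n → ℕ), unused mu x.1 x.2 * |interp t V₁ V₂ x.1| ∂ν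
      ≤ (m + K * M) * γ := by
    refine integral_mul_le_rpow (Y := fun x => |interp t V₁ V₂ x.1|) ha h0 hK.le hui
      (fun x => unused_nonneg hJ _ _) (fun x => unused_le hJ _ _)
      (fun x => abs_nonneg _) (integrable_fst hm (v := fun i => |interp t V₁ V₂ i| ^ (1 + a)) hVp)
      (by rw [hu, hmean, mul_comm]) ?_
    rw [integral_fst hm fun i => |interp t V₁ V₂ i| ^ (1 + a)]
    exact integral_mono hVp hA fun i =>
      Real.rpow_le_rpow (abs_nonneg _) (hVe i) (by linarith)
  have hnp : ∀ x : Z × (Fin n → ℕ), (n * perp x.2) ^ (1 + a)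
      = (n : ℝ) ^ (1 + a) * perp x.2 ^ (1 + a) := fun x =>
    Real.mul_rpow hn0.le (perp_pos _).le
  have huq : ∫ x : Z × (Fin n → ℕ), unused mu x.1 x.2 * (n * perp x.2) ∂ν
      ≤ (m + K * N) * γ := by
    refine integral_mul_le_rpow (Y := fun x : Z × (Fin n → ℕ) => n * perp x.2) ha h0 hK.le hui
      (fun x => unused_nonneg hJ _ _) (fun x => unused_le hJ _ _)
      (fun x => mul_nonneg hn0.le (perp_pos _).le) ?_ (by rw [hu, hmean, mul_comm]) ?_
    · simp_rw [hnp]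
      exact hpi.const_mul _
    · simp_rw [hnp]
      rw [integral_const_mul]
      exact mul_le_mul_of_nonneg_left hpb (by positivity)
  have hpi1 : Integrable (fun x : Z × (Fin n → ℕ) => perp x.2) ν :=
    Integrable.mono' hpi Measurable.of_discrete.aestronglyMeasurable (ae_of_all _ fun x => by
      rw [Real.norm_of_nonneg (perp_pos _).le]
      nth_rewrite 1 [← Real.rpow_one (perp x.2)]
      exact Real.rpow_le_rpow_of_exponent_le (one_le_perp _) (by linarith))
  have hγ0 : 0 ≤ γ := h0.le.trans hεγ
  have hVB : ∫ i, |interp t V₁ V₂ i| ∂p ≤ B := by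
    refine (integral_mono hV.integrable_right.abs
      ((D.pair₁.integrable_right.abs.const_mul 2).add D.pair₂.integrable_right.abs)
      (abs_interp_le ht1 ht2)).trans (?_ : B₁ ≤ B)
    linarith
  have hVkB : ∫ i, |t ^ 2 * K₁ i + (1 - t) ^ 2 * K₂ i + t * (1 - t) * K₃ i| ∂p ≤ B := by
    refine (integral_mono hVk.integrable_right.abs
      (((D.pair₁₁.integrable_right.abs.const_mul 4).add D.pair₂₂.integrable_right.abs).add
        (D.pair₁₂.integrable_right.abs.const_mul 2)) fun i => ?_).trans (?_ : B₂ ≤ B)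
    · exact abs_quadratic_le ht1 ht2 _ _ _
    · linarith
  have key := abs_laplace_sub_le hJ hm hν hmean D.mean hm0 hV hVk D.pairl hVB hVkB
    (by linarith : B₃ ≤ B) hs h0 hεγ hsε
    (huV.trans (mul_le_mul_of_nonneg_right (by linarith) hγ0))
    (huq.trans (mul_le_mul_of_nonneg_right (by linarith) hγ0)) hpi1
  have hkd := hCk ε h0.le he
  rw [← ht] at hkd
  set k := ∫ i, (muTot mu i - interp t lam₁ lam₂ i) * interp t V₁ V₂ i ∂p
  set W := ∫ x : Z × (Fin n → ℕ), Real.exp (-(s * ε) * qSum x.2) ∂ν with hW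
  have hse : 0 ≤ s * ε := by positivity
  have hW0 : 0 ≤ W := integral_nonneg fun x => Real.exp_nonneg _
  have hW1 : W ≤ 1 := by
    have := integral_mono (integrable_of_bounded (ν := ν) fun x => abs_exp_qSum_le hse x.2)
      (integrable_const (1 : ℝ)) (fun x => exp_qSum_le_one hse x.2)
    simpa only [integral_const, probReal_univ, smul_eq_mul, mul_one] using this
  refine (abs_sub_one_div_le hW0 hW1 hs hm0 hkst key
    (hkd.trans (mul_le_mul_of_nonneg_left hεγ hCk0))).trans (le_of_eq ?_)
  ring

end TwoPointData

end Interpolation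

/-! ### From the heavy traffic family to the two-point data -/

section Family

variable {Z : Type*} [Countable Z] [MeasurableSpace Z] [MeasurableSingletonClass Z] {n : ℕ}
  {Q : Z → Z → ℝ} {p : Measure Z} [IsProbabilityMeasure p] {mu : Z → Fin n → ℝ} {ε₀ : ℝ}
  {lam : ℝ → Z → ℝ}

namespace IsHeavyTrafficFamily

/-- Were the mean capacity zero, division by zero would make the load zero at every ε, so `1 - load
= ε` would fail for one of two distinct values of ε. -/
lemma muSigma_pos (h : IsHeavyTrafficFamily Q p mu ε₀ lam) (hε₀ : 0 < ε₀) :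
    0 < muSigma p mu := by
  have h0 : 0 ≤ muSigma p mu :=
    Finset.sum_nonneg fun j _ => integral_nonneg fun i => h.mu_nonneg i j
  refine h0.lt_of_ne fun hz => ?_
  have h1 := h.load_eq (ε₀ / 2) ⟨by linarith, by linarith⟩
  have h2 := h.load_eq (ε₀ / 3) ⟨by linarith, by linarith⟩
  rw [load, ← hz, div_zero] at h1 h2
  linarith

lemma exists_bounds (h : IsHeavyTrafficFamily Q p mu ε₀ lam) (hn : 1 ≤ n) :
    ∃ K, ∀ ε ∈ Ioo 0 ε₀, JSQBounds Q (lam ε) mu K := by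
  obtain ⟨C, hC⟩ := h.exit_bdd
  obtain ⟨L, hL⟩ := h.lam_bdd
  obtain ⟨M, hM⟩ := h.mu_bdd
  refine ⟨max C (max L (n * M)), fun ε hε => ⟨hn, ⟨h.rateMatrix.nonneg, h.rateMatrix.summable,
    fun i => (hC i).trans (le_max_left _ _)⟩, h.lam_nonneg ε hε,
    fun i => (hL ε hε i).le.trans ((le_max_left _ _).trans (le_max_right _ _)), h.mu_nonneg,
    fun i => ?_⟩⟩
  refine le_trans ?_ ((le_max_right _ _).trans (le_max_right _ _))
  calc muTot mu i ≤ ∑ _j : Fin n, M := Finset.sum_le_sum fun j _ => (hM i j).le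
    _ = n * M := by simp

lemma integral_muTot (h : IsHeavyTrafficFamily Q p mu ε₀ lam) :
    ∫ i, muTot mu i ∂p = muSigma p mu := by
  obtain ⟨M, hM⟩ := h.mu_bdd
  simp only [muTot, muSigma]
  exact integral_finsetSum _ fun j _ => integrable_of_bounded (B := M) fun i => by
    rw [abs_of_nonneg (h.mu_nonneg i j)]; exact (hM i j).le

lemma integral_muTot_sub (h : IsHeavyTrafficFamily Q p mu ε₀ lam) (hn : 1 ≤ n) {ε : ℝ}
    (hε : ε ∈ Ioo 0 ε₀) : ∫ i, (muTot mu i - lam ε i) ∂p = ε * muSigma p mu := by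
  obtain ⟨K, hK⟩ := h.exists_bounds hn
  have hJ := hK ε hε
  have i1 : Integrable (muTot mu) p := integrable_of_bounded (B := K) fun i => by
    rw [abs_of_nonneg (hJ.muTot_nonneg i)]; exact hJ.muTot_le i
  have i2 : Integrable (lam ε) p := integrable_of_bounded (B := K) fun i => by
    rw [abs_of_nonneg (hJ.lam_nonneg i)]; exact hJ.lam_le i
  have hm := h.muSigma_pos (hε.1.trans hε.2)
  have hl := h.load_eq ε hε
  rw [integral_sub i1 i2, h.integral_muTot]
  rw [load] at hl
  field_simp at hl
  linarith

lemma eq_interp (h : IsHeavyTrafficFamily Q p mu ε₀ lam) {ε e : ℝ} (hε : ε ∈ Ioo 0 ε₀)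
    (he : 0 < e) (he2 : 2 * e < ε₀) : lam ε = interp (2 - ε / e) (lam e) (lam (2 * e)) := by
  obtain ⟨c, d, hcd⟩ := h.lam_affine
  funext i
  rw [interp, hcd ε hε, hcd e ⟨he, by linarith⟩, hcd (2 * e) ⟨by linarith, he2⟩]
  field_simp
  ring

end IsHeavyTrafficFamily

lemma integrable_abs_rpow_of_le {V : Z → ℝ} {b c : ℝ} (hb : 0 ≤ b) (hbc : b ≤ c)
    (h : Integrable (fun i => |V i| ^ c) p) : Integrable (fun i => |V i| ^ b) p :=
  Integrable.mono' ((integrable_const (1 : ℝ)).add h) Measurable.of_discrete.aestronglyMeasurable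
    (ae_of_all _ fun i => by
      rw [Real.norm_of_nonneg (Real.rpow_nonneg (abs_nonneg _) _)]
      exact rpow_le_one_add_rpow (abs_nonneg _) hb hbc)

lemma integrable_of_moment {V : Z → ℝ} {b : ℝ} (hb : 0 < b)
    (h : Integrable (fun i => |V i| ^ (1 + b)) p) : Integrable V p := by
  have h1 := integrable_abs_rpow_of_le (V := V) zero_le_one (by linarith : (1 : ℝ) ≤ 1 + b) h
  simp only [Real.rpow_one] at h1
  exact h1.mono' Measurable.of_discrete.aestronglyMeasurable (ae_of_all _ fun i => le_rfl)

/-- The Poisson equation for a product, polarized. -/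
lemma exists_pair_polarized {K : ℝ} (hQ : BoundedRates Q K) (hirr : IsIrreducible Q)
    (hp : IsStationary Q p) {h₁ h₂ h₃ V₁ V₂ V₃ K₁ K₂ K₃ : Z → ℝ}
    (hh : ∀ i, h₃ i = 1 / 2 * (h₁ i + h₂ i)) (p₁ : PoissonPair Q p h₁ V₁)
    (p₂ : PoissonPair Q p h₂ V₂) (p₃ : PoissonPair Q p h₃ V₃)
    (q₁ : PoissonPair Q p (fun i => h₁ i * V₁ i) K₁)
    (q₂ : PoissonPair Q p (fun i => h₂ i * V₂ i) K₂)
    (q₃ : PoissonPair Q p (fun i => h₃ i * V₃ i) K₃) :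
    ∃ K', PoissonPair Q p (fun i => h₁ i * V₂ i + h₂ i * V₁ i) K' := by
  -- `V₃` is the average of `V₁` and `V₂` up to a constant `c`. So `4 * h₃ * (V₃ - c) - h₁ * V₁ - h₂
  -- * V₂` is exactly the cross term.
  have hV := p₃.eq_add_const hQ hirr hp
    (((p₁.add hQ p₂).const_mul hQ (1 / 2)).congr hh)
  set c := ∫ i, V₃ i ∂p - ∫ i, 1 / 2 * (V₁ i + V₂ i) ∂p
  refine ⟨_, (((q₃.add hQ (p₃.const_mul hQ (-c))).const_mul hQ 4).add hQ
    ((q₁.add hQ q₂).const_mul hQ (-1))).congr fun i => ?_⟩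
  rw [hV i, hh i]
  ring

/-- The two-point data of a heavy traffic family. -/
lemma IsHeavyTrafficFamily.exists_twoPointData (h : IsHeavyTrafficFamily Q p mu ε₀ lam)
    (hn : 1 ≤ n) {e : ℝ} (he : 0 < e) (he2 : 2 * e < ε₀)
    (hssc : ∀ ε ∈ Ioo 0 ε₀, SSCLoad (lam ε) mu) {Vh Vk : ℝ → Z → ℝ} {Vl : Z → ℝ}
    (hVh : ∀ ε ∈ Ioo 0 ε₀, PoissonPair Q p (fun i => muTot mu i - lam ε i) (Vh ε))
    (hVk : ∀ ε ∈ Ioo 0 ε₀, PoissonPair Q p (fun i => (muTot mu i - lam ε i) * Vh ε i) (Vk ε))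
    (hVl : PoissonPair Q p (fun i => muTot mu i) Vl) {η : ℝ} (hη : 0 < η)
    (hmom : ∀ ε ∈ Ioo 0 ε₀, Integrable (fun i => |Vh ε i| ^ (1 + η)) p) {K : ℝ}
    (hK : ∀ ε ∈ Ioo 0 ε₀, JSQBounds Q (lam ε) mu K) :
    ∃ K', TwoPointData Q p mu K (muSigma p mu) e (min 1 η) (lam e) (lam (2 * e)) (Vh e)
      (Vh (2 * e)) (Vk e) (Vk (2 * e)) K' Vl := by
  have m1 : e ∈ Ioo 0 ε₀ := ⟨he, by linarith⟩
  have m2 : 2 * e ∈ Ioo 0 ε₀ := ⟨by linarith, he2⟩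
  -- The midpoint of `e` and `2 * e`, as polarization requires.
  have m3 : 3 / 2 * e ∈ Ioo 0 ε₀ := ⟨by linarith, by linarith⟩
  have hQ := (hK e m1).rates
  obtain ⟨K', hK'⟩ := exists_pair_polarized hQ h.irreducible h.stationary (fun i => by
    rw [h.eq_interp m3 he he2, interp]; field_simp; ring) (hVh _ m1) (hVh _ m2) (hVh _ m3)
      (hVk _ m1) (hVk _ m2) (hVk _ m3)
  have hmin : 0 < min 1 η := lt_min one_pos hη
  have hle : 1 + min 1 η ≤ 1 + η := by linarith [min_le_right 1 η]
  exact ⟨K',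
    { bounds₁ := hK _ m1
      bounds₂ := hK _ m2
      m_pos := h.muSigma_pos (m1.1.trans m1.2)
      e_pos := he
      a_pos := hmin
      a_le := min_le_left _ _
      gap := fun i => by have := hssc _ m2 i; rw [sscGap]; linarith
      mean := h.integral_muTot
      mean₁ := h.integral_muTot_sub hn m1
      mean₂ := h.integral_muTot_sub hn m2
      pair₁ := hVh _ m1
      pair₂ := hVh _ m2
      pair₁₁ := hVk _ m1
      pair₂₂ := hVk _ m2
      pair₁₂ := hK'
      pairl := hVl
      moment₁ := integrable_abs_rpow_of_le (by linarith) hle (hmom _ m1)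
      moment₂ := integrable_abs_rpow_of_le (by linarith) hle (hmom _ m2) }⟩

lemma IsHeavyTrafficFamily.exists_isStationary (h : IsHeavyTrafficFamily Q p mu ε₀ lam)
    (hn : 1 ≤ n) (hssc : ∀ ε ∈ Ioo 0 ε₀, SSCLoad (lam ε) mu) {ε : ℝ} (hε : ε ∈ Ioo 0 ε₀) :
    ∃ ν : ProbabilityMeasure (Z × (Fin n → ℕ)),
      IsStationary (jsqRate Q (lam ε) mu) (ν : Measure (Z × (Fin n → ℕ))) := by
  obtain ⟨K, hK⟩ := h.exists_bounds hn
  refine exists_isStationary_jsqRate (hK ε hε) h.stationary (fun i => ?_) ?_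
  · have := hssc ε hε i
    rw [sscGap]; linarith
  · rw [h.integral_muTot_sub hn hε]
    exact mul_pos hε.1 (h.muSigma_pos (hε.1.trans hε.2))

namespace TwoPointData

variable {K m e a : ℝ} {V₁ V₂ K₁ K₂ K₃ Vl : Z → ℝ}

/-- The limit of `∫ h * V_h`. -/
lemma tendsto_integral_mul
    (D : TwoPointData Q p mu K m e a (lam e) (lam (2 * e)) V₁ V₂ K₁ K₂ K₃ Vl)
    (h : IsHeavyTrafficFamily Q p mu ε₀ lam) (hn : 1 ≤ n) (he2 : 2 * e < ε₀) {Vh : ℝ → Z → ℝ}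
    (hVh : ∀ ε ∈ Ioo 0 ε₀, PoissonPair Q p (fun i => muTot mu i - lam ε i) (Vh ε))
    (hconst : ∃ C, ∀ ε ∈ Ioo 0 ε₀, |∫ i, Vh ε i ∂p| ≤ C) :
    Tendsto (fun ε => ∫ i, (muTot mu i - lam ε i) * Vh ε i ∂p) (𝓝[>] 0)
      (𝓝 (∫ i, (muTot mu i - interp 2 (lam e) (lam (2 * e)) i) * interp 2 V₁ V₂ i ∂p)) := by
  obtain ⟨C, hC⟩ := hconst
  obtain ⟨Ck, hCk0, hCk⟩ := D.exists_abs_integral_mul_interp_sub_le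
  have he := D.e_pos
  have hm := h.muSigma_pos (by linarith)
  rw [tendsto_iff_norm_sub_tendsto_zero]
  set B := 2 * ∫ i, |V₁ i| ∂p + ∫ i, |V₂ i| ∂p with hB
  have hlim : Tendsto (fun ε : ℝ => (Ck + (C + B) * muSigma p mu) * ε) (𝓝[>] 0) (𝓝 0) := by
    have : Tendsto (fun ε : ℝ => (Ck + (C + B) * muSigma p mu) * ε) (𝓝 0)
        (𝓝 ((Ck + (C + B) * muSigma p mu) * 0)) := tendsto_id.const_mul _
    rw [mul_zero] at this
    exact this.mono_left nhdsWithin_le_nhds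
  refine squeeze_zero' (Eventually.of_forall fun _ => norm_nonneg _) ?_ hlim
  filter_upwards [Ioo_mem_nhdsGT he] with ε hε
  have hε' : ε ∈ Ioo 0 ε₀ := ⟨hε.1, by linarith [hε.2]⟩
  have hlam := h.eq_interp hε' he he2
  have hpair := D.pair_interp (2 - ε / e)
  have hr0 : 0 ≤ ε / e := div_nonneg hε.1.le he.le
  have hr1 : ε / e ≤ 1 := (div_le_one he).2 hε.2.le
  have hV := fun i => (hVh ε hε').eq_add_const D.bounds₁.rates h.irreducible h.stationary
    (hpair.congr fun i => by rw [hlam]) i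
  set t := 2 - ε / e with ht
  set c := ∫ i, Vh ε i ∂p - ∫ i, interp t V₁ V₂ i ∂p with hc
  have hcb : |c| ≤ C + B := by
    refine (abs_sub _ _).trans (add_le_add (hC ε hε') ?_)
    refine abs_integral_le_integral_abs.trans ?_
    rw [hB, ← integral_const_mul,
      ← integral_add (D.pair₁.integrable_right.abs.const_mul 2) D.pair₂.integrable_right.abs]
    exact integral_mono hpair.integrable_right.abs
      ((D.pair₁.integrable_right.abs.const_mul 2).add D.pair₂.integrable_right.abs)
      (abs_interp_le (by linarith) (by linarith))
  -- The given solution and the interpolated one differ by `c`, which shifts the integral by `c`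
  -- times the mean slack, hence by O(ε). Boundedness of the normalizing constants enters only here.
  have e1 : ∫ i, (muTot mu i - lam ε i) * Vh ε i ∂p
      = ∫ i, (muTot mu i - interp t (lam e) (lam (2 * e)) i) * interp t V₁ V₂ i ∂p
        + c * (ε * muSigma p mu) := by
    rw [← h.integral_muTot_sub hn hε', ← integral_const_mul,
      ← integral_add (D.pair_interp_mul t).integrable_left ((hVh ε hε').integrable_left.const_mul _)]
    refine integral_congr_ae (ae_of_all _ fun i => ?_)
    simp only
    rw [hV i, ← hlam]
    ring
  rw [e1, add_sub_right_comm]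
  refine (norm_add_le _ _).trans ?_
  rw [add_mul]
  refine add_le_add (hCk ε hε.1.le hε.2.le) ?_
  rw [norm_mul, Real.norm_eq_abs, Real.norm_of_nonneg (mul_pos hε.1 hm).le, mul_assoc,
    mul_comm (muSigma p mu)]
  exact mul_le_mul_of_nonneg_right hcb (mul_pos hε.1 hm).le

lemma exists_integral_perp_le
    (D : TwoPointData Q p mu K m e a (lam e) (lam (2 * e)) V₁ V₂ K₁ K₂ K₃ Vl)
    (h : IsHeavyTrafficFamily Q p mu ε₀ lam) (he2 : 2 * e < ε₀)
    (hK : ∀ ε ∈ Ioo 0 ε₀, JSQBounds Q (lam ε) mu K)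
    {ν : ℝ → ProbabilityMeasure (Z × (Fin n → ℕ))}
    (hν : ∀ ε ∈ Ioo 0 ε₀,
      IsStationary (jsqRate Q (lam ε) mu) (ν ε : Measure (Z × (Fin n → ℕ)))) :
    ∃ C, 0 ≤ C ∧ ∀ᶠ ε in 𝓝[>] (0 : ℝ),
      Integrable (fun x : Z × (Fin n → ℕ) => perp x.2) (ν ε : Measure (Z × (Fin n → ℕ))) ∧
      ∫ x : Z × (Fin n → ℕ), perp x.2 ∂(ν ε : Measure (Z × (Fin n → ℕ))) ≤ C := by
  obtain ⟨C, hC0, hC⟩ := D.exists_integral_perp_rpow_le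
  refine ⟨C, hC0, ?_⟩
  have he := D.e_pos
  filter_upwards [Ioo_mem_nhdsGT he] with ε hε
  have hε' : ε ∈ Ioo 0 ε₀ := ⟨hε.1, by linarith [hε.2]⟩
  have hlam := h.eq_interp hε' he he2
  have hr0 : 0 ≤ ε / e := div_nonneg hε.1.le he.le
  have hr1 : ε / e ≤ 1 := (div_le_one he).2 hε.2.le
  obtain ⟨h1, h2⟩ := hC (2 - ε / e) (by linarith) (by linarith) (ν ε) inferInstance
    (map_fst_eq (hK ε hε') h.irreducible h.stationary (hν ε hε')) (hlam ▸ hK ε hε')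
    (hlam ▸ hν ε hε')
  have hle : ∀ x : Z × (Fin n → ℕ), perp x.2 ≤ perp x.2 ^ (1 + a) := fun x => by
    nth_rewrite 1 [← Real.rpow_one (perp x.2)]
    exact Real.rpow_le_rpow_of_exponent_le (one_le_perp _) (by linarith [D.a_pos])
  have hi : Integrable (fun x : Z × (Fin n → ℕ) => perp x.2)
      (ν ε : Measure (Z × (Fin n → ℕ))) :=
    h1.mono' Measurable.of_discrete.aestronglyMeasurable (ae_of_all _ fun x => by
      rw [Real.norm_of_nonneg (perp_pos _).le]; exact hle x)
  exact ⟨hi, (integral_mono hi h1 hle).trans h2⟩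

/-- The Laplace transform of a single scaled queue length. -/
lemma exists_abs_laplace_single_sub_le
    (D : TwoPointData Q p mu K m e a (lam e) (lam (2 * e)) V₁ V₂ K₁ K₂ K₃ Vl)
    (h : IsHeavyTrafficFamily Q p mu ε₀ lam) (he2 : 2 * e < ε₀)
    (hK : ∀ ε ∈ Ioo 0 ε₀, JSQBounds Q (lam ε) mu K)
    {ν : ℝ → ProbabilityMeasure (Z × (Fin n → ℕ))}
    (hν : ∀ ε ∈ Ioo 0 ε₀,
      IsStationary (jsqRate Q (lam ε) mu) (ν ε : Measure (Z × (Fin n → ℕ)))) (j : Fin n) {s : ℝ}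
    (hs : 0 < s) :
    ∃ C, ∀ᶠ ε in 𝓝[>] (0 : ℝ),
      |∫ x, Real.exp (-s * ε * (x.2 j : ℝ)) ∂(ν ε : Measure (Z × (Fin n → ℕ)))
        - 1 / (1 + s / n * (1 +
          (∫ i, (muTot mu i - interp 2 (lam e) (lam (2 * e)) i) * interp 2 V₁ V₂ i ∂p) / m))|
        ≤ C * ε ^ (1 - 1 / (1 + a)) := by
  have hn0 := D.n_pos
  have he := D.e_pos
  have hsn : 0 < s / n := div_pos hs hn0
  obtain ⟨C, hC0, hC⟩ := D.exists_abs_laplace_sub_le h.stationary hsn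
  obtain ⟨Cp, hCp0, hCp⟩ := D.exists_integral_perp_le h he2 hK hν
  refine ⟨s * Cp + C, ?_⟩
  filter_upwards [Ioo_mem_nhdsGT he, Ioo_mem_nhdsGT one_pos, Ioo_mem_nhdsGT (one_div_pos.2 hsn),
    hCp] with ε hε h1 h2 ⟨h3, h4⟩
  have hε0 := hε.1
  have hε' : ε ∈ Ioo 0 ε₀ := ⟨hε.1, by linarith [hε.2]⟩
  have hlam := h.eq_interp hε' he he2
  have key := hC ε hε0 hε.2.le h1.2.le (by
      have := h2.2
      rw [lt_div_iff₀ hsn] at this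
      linarith) (ν ε) inferInstance
    (map_fst_eq (hK ε hε') h.irreducible h.stationary (hν ε hε')) (hlam ▸ hK ε hε')
    (hlam ▸ hν ε hε')
  have hγ : ε ≤ ε ^ (1 - 1 / (1 + a)) := by
    nth_rewrite 1 [← Real.rpow_one ε]
    refine Real.rpow_le_rpow_of_exponent_ge hε0 h1.2.le ?_
    have := D.a_pos
    have : 0 < 1 / (1 + a) := by positivity
    linarith
  have hθ : 0 ≤ s / n * ε := by positivity
  have b1 : ∀ y : ℝ, 0 ≤ y → |Real.exp (-y)| ≤ 1 := fun y hy => by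
    rw [abs_of_nonneg (Real.exp_nonneg _)]; exact Real.exp_le_one_iff.2 (by linarith)
  have hq : ∀ x : Z × (Fin n → ℕ), 0 ≤ s * ε * (x.2 j : ℝ) := fun x => by positivity
  have i1 : Integrable (fun x : Z × (Fin n → ℕ) => Real.exp (-s * ε * (x.2 j : ℝ)))
      (ν ε : Measure (Z × (Fin n → ℕ))) := integrable_of_bounded (B := 1) fun x => by
    rw [show -s * ε * (x.2 j : ℝ) = -(s * ε * x.2 j) by ring]; exact b1 _ (hq x)
  have i2 : Integrable (fun x : Z × (Fin n → ℕ) => Real.exp (-(s / n * ε) * qSum x.2))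
      (ν ε : Measure (Z × (Fin n → ℕ))) :=
    integrable_of_bounded fun x => abs_exp_qSum_le hθ x.2
  -- Each queue is within `perp` of the average and exp(-x) is 1-Lipschitz on the half-line.
  -- Replacing one queue by the total, taken at `s / n`, thus costs O(ε).
  have hd : |∫ x, Real.exp (-s * ε * (x.2 j : ℝ)) ∂(ν ε : Measure (Z × (Fin n → ℕ)))
      - ∫ x : Z × (Fin n → ℕ), Real.exp (-(s / n * ε) * qSum x.2)
        ∂(ν ε : Measure (Z × (Fin n → ℕ)))| ≤ s * Cp * ε := by
    rw [← integral_sub i1 i2]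
    refine abs_integral_le_integral_abs.trans (le_trans ?_
      (le_of_le_of_eq (mul_le_mul_of_nonneg_left h4 (by positivity : 0 ≤ s * ε)) (by ring)))
    rw [← integral_const_mul]
    refine integral_mono (i1.sub i2).abs (h3.const_mul _) fun x => ?_
    have e1 : s * ε * (x.2 j : ℝ) - s / n * ε * qSum x.2 = s * ε * ((x.2 j : ℝ) - qAvg x.2) := by
      rw [qAvg]; field_simp
    have e2 := mul_le_mul_of_nonneg_left (abs_sub_qAvg_le x.2 j) (by positivity : 0 ≤ s * ε)
    have e3 : ∀ y z : ℝ, 0 ≤ y → 0 ≤ z → |Real.exp (-y) - Real.exp (-z)| ≤ |y - z| := by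
      have : ∀ y z : ℝ, 0 ≤ y → y ≤ z → |Real.exp (-y) - Real.exp (-z)| ≤ |y - z| :=
        fun y z hy hyz => by
          have f1 : Real.exp (-z) = Real.exp (-y) * Real.exp (-(z - y)) := by
            rw [← Real.exp_add]; ring_nf
          have f2 := Real.add_one_le_exp (-(z - y))
          have f3 : Real.exp (-(z - y)) ≤ 1 := Real.exp_le_one_iff.2 (by linarith)
          rw [f1, ← mul_one_sub, abs_mul, abs_of_nonneg (by linarith : 0 ≤ 1 - Real.exp (-(z - y))),
            abs_of_nonpos (by linarith : y - z ≤ 0)]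
          exact (mul_le_of_le_one_left (by linarith) (b1 y hy)).trans (by linarith)
      intro y z hy hz
      rcases le_total y z with hyz | hyz
      · exact this y z hy hyz
      · rw [abs_sub_comm, abs_sub_comm y]; exact this z y hz hyz
    have e4 := e3 (s * ε * (x.2 j : ℝ)) (s / n * ε * qSum x.2) (hq x)
      (mul_nonneg hθ (qSum_nonneg _))
    rw [e1, abs_mul, abs_of_nonneg (by positivity : 0 ≤ s * ε)] at e4
    rw [show -s * ε * (x.2 j : ℝ) = -(s * ε * x.2 j) by ring,
      show -(s / n * ε) * qSum x.2 = -(s / n * ε * qSum x.2) by ring]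
    exact e4.trans e2
  refine (abs_sub_le _ _ _).trans (le_trans (add_le_add hd key) ?_)
  rw [add_mul]
  exact add_le_add (mul_le_mul_of_nonneg_left hγ (by positivity)) le_rfl

end TwoPointData

end Family

/-! ### Marginal and joint convergence in distribution -/

section Limit

variable {Z : Type*} [Countable Z] [MeasurableSpace Z] [MeasurableSingletonClass Z] {n : ℕ}

lemma tendsto_rpow_heavy_traffic {a : ℝ} (ha : 0 < a) :
    Tendsto (fun ε : ℝ => ε ^ (1 - 1 / (1 + a))) (𝓝[>] 0) (𝓝 0) := by
  have h1 : 0 < 1 - 1 / (1 + a) := by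
    rw [sub_pos, div_lt_one (by linarith)]; linarith
  have h2 := (Real.continuousAt_rpow_const 0 (1 - 1 / (1 + a)) (Or.inr h1.le)).tendsto
  rw [Real.zero_rpow h1.ne'] at h2
  exact h2.mono_left nhdsWithin_le_nhds

/-- Convergence of the Laplace transforms of a scaled queue length gives convergence in
distribution to an exponential random variable. -/
lemma tendstoInDistribution_single {ν : ℝ → ProbabilityMeasure (Z × (Fin n → ℕ))} {j : Fin n}
    {mean : ℝ} (hmean : 0 < mean)
    (h : ∀ s : ℝ, 0 < s → Tendsto
      (fun ε : ℝ => ∫ x, Real.exp (-s * ε * (x.2 j : ℝ)) ∂(ν ε : Measure (Z × (Fin n → ℕ))))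
      (𝓝[>] 0) (𝓝 (1 / (1 + s * mean)))) :
    TendstoInDistribution (fun (ε : ℝ) (x : Z × (Fin n → ℕ)) => ε * (x.2 j : ℝ)) (𝓝[>] 0)
      (fun y : ℝ => y) (fun ε => (ν ε : Measure (Z × (Fin n → ℕ))))
      (expLaw mean hmean : Measure ℝ) := by
  have hmeas : ∀ ε : ℝ, AEMeasurable (fun x : Z × (Fin n → ℕ) => ε * (x.2 j : ℝ))
      (ν ε : Measure (Z × (Fin n → ℕ))) := fun ε => Measurable.of_discrete.aemeasurable
  refine ⟨hmeas, aemeasurable_id', ?_⟩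
  have hlim : ∀ s : ℝ, 0 < s → ∫ x, Real.exp (-s * x)
      ∂((expLaw mean hmean : Measure ℝ).map fun y => y) = 1 / (1 + s * mean) := fun s hs => by
    rw [Measure.map_id']
    have := integral_exp_expMeasure (inv_pos.2 hmean) hs.le
    rw [expLaw, ProbabilityMeasure.coe_mk, this]
    field_simp
  refine tendsto_of_tendsto_integral_exp ?_ ?_ fun s hs => ?_
  · filter_upwards [self_mem_nhdsWithin] with ε hε
    rw [ProbabilityMeasure.coe_mk, ae_map_iff (hmeas ε) measurableSet_Ici]
    exact ae_of_all _ fun x => mul_nonneg (le_of_lt hε) (Nat.cast_nonneg _)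
  · rw [ProbabilityMeasure.coe_mk, Measure.map_id']
    exact expMeasure_nonneg
  · simp only [ProbabilityMeasure.coe_mk]
    rw [hlim s hs]
    refine (h s hs).congr fun ε => ?_
    rw [integral_map (hmeas ε) (by fun_prop)]
    simp only [mul_assoc]

/-- State space collapse turns convergence of one scaled queue length into joint convergence. -/
lemma tendstoInDistribution_joint {ν : ℝ → ProbabilityMeasure (Z × (Fin n → ℕ))} {j : Fin n}
    {mean : ℝ} {hmean : 0 < mean}
    (h : TendstoInDistribution (fun (ε : ℝ) (x : Z × (Fin n → ℕ)) => ε * (x.2 j : ℝ)) (𝓝[>] 0)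
      (fun y : ℝ => y) (fun ε => (ν ε : Measure (Z × (Fin n → ℕ))))
      (expLaw mean hmean : Measure ℝ)) {C : ℝ}
    (hC : ∀ᶠ ε in 𝓝[>] (0 : ℝ),
      Integrable (fun x : Z × (Fin n → ℕ) => perp x.2) (ν ε : Measure (Z × (Fin n → ℕ))) ∧
      ∫ x : Z × (Fin n → ℕ), perp x.2 ∂(ν ε : Measure (Z × (Fin n → ℕ))) ≤ C) :
    TendstoInDistribution
      (fun (ε : ℝ) (x : Z × (Fin n → ℕ)) (l : Fin n) => ε * (x.2 l : ℝ)) (𝓝[>] 0)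
      (fun (y : ℝ) (_ : Fin n) => y) (fun ε => (ν ε : Measure (Z × (Fin n → ℕ))))
      (expLaw mean hmean : Measure ℝ) := by
  have hdiag : Continuous fun (y : ℝ) (_ : Fin n) => y := by fun_prop
  -- In sup distance, the scaled vector is within `ε * (2 * perp)` of the diagonal point over its
  -- `j`-th coordinate, and this has mean O(ε).
  refine tendstoInDistribution_of_integral_dist (h.continuous_comp hdiag)
    (fun ε => Measurable.of_discrete.aemeasurable)
    (D := fun ε x => ε * (2 * perp x.2)) ?_ ?_
  · filter_upwards [hC, self_mem_nhdsWithin] with ε h1 hε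
    have hε0 : 0 ≤ ε := le_of_lt hε
    refine ⟨(h1.1.const_mul 2).const_mul ε, fun x => ?_⟩
    have hp := perp_pos x.2
    refine (dist_pi_le_iff (by positivity)).2 fun l => ?_
    simp only [Function.comp_apply]
    rw [Real.dist_eq, ← mul_sub, abs_mul, abs_of_nonneg hε0]
    refine mul_le_mul_of_nonneg_left ?_ hε0
    have h2 := abs_sub_le (x.2 l : ℝ) (qAvg x.2) (x.2 j)
    rw [abs_sub_comm (qAvg x.2)] at h2
    linarith [abs_sub_qAvg_le x.2 l, abs_sub_qAvg_le x.2 j]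
  · have hlim : Tendsto (fun ε : ℝ => ε * (2 * C)) (𝓝[>] 0) (𝓝 0) := by
      have : Tendsto (fun ε : ℝ => ε * (2 * C)) (𝓝 0) (𝓝 (0 * (2 * C))) :=
        tendsto_id.mul_const _
      rw [zero_mul] at this
      exact this.mono_left nhdsWithin_le_nhds
    refine squeeze_zero' ?_ ?_ hlim
    · filter_upwards [self_mem_nhdsWithin] with ε hε
      exact integral_nonneg fun x =>
        mul_nonneg (le_of_lt hε) (mul_nonneg zero_le_two (perp_pos _).le)
    · filter_upwards [hC, self_mem_nhdsWithin] with ε h1 hε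
      rw [integral_const_mul, integral_const_mul]
      exact mul_le_mul_of_nonneg_left (mul_le_mul_of_nonneg_left h1.2 zero_le_two) (le_of_lt hε)

end Limit

end MMJSQ

/-! ### The heavy traffic limit -/

theorem theorem1 {Z : Type*} [Countable Z] [MeasurableSpace Z] [MeasurableSingletonClass Z]
    (n : ℕ) (hn : 1 ≤ n)
    (Q : Z → Z → ℝ) (p : Measure Z) [IsProbabilityMeasure p]
    (mu : Z → Fin n → ℝ) (ε₀ : ℝ) (hε₀ : 0 < ε₀) (lam : ℝ → Z → ℝ)
    (hmodel : MMJSQ.IsHeavyTrafficFamily Q p mu ε₀ lam)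
    (hssc : ∀ ε ∈ Ioo 0 ε₀, MMJSQ.SSCLoad (lam ε) mu)
    (Vh Vk : ℝ → Z → ℝ) (Vl : Z → ℝ)
    (hVh : ∀ ε ∈ Ioo 0 ε₀,
      MMJSQ.IsPoissonSolution Q p (fun i => MMJSQ.muTot mu i - lam ε i) (Vh ε))
    (hVk : ∀ ε ∈ Ioo 0 ε₀,
      MMJSQ.IsPoissonSolution Q p (fun i => (MMJSQ.muTot mu i - lam ε i) * Vh ε i) (Vk ε))
    (hVl : MMJSQ.IsPoissonSolution Q p (fun i => MMJSQ.muTot mu i) Vl)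
    (η ζ β : ℝ) (hη : 0 < η) (hζ : 0 < ζ) (hβ : 0 < β)
    (hVh_moment : ∀ ε ∈ Ioo 0 ε₀, Integrable (fun i => |Vh ε i| ^ (1 + η)) p)
    (hVk_moment : ∀ ε ∈ Ioo 0 ε₀, Integrable (fun i => |Vk ε i| ^ (1 + ζ)) p)
    (hVl_moment : Integrable (fun i => |Vl i| ^ (1 + β)) p)
    -- the free additive constant in `Vh ε` stays bounded as `ε` varies
    (hVh_const : ∃ C, ∀ ε ∈ Ioo 0 ε₀, |∫ i, Vh ε i ∂p| ≤ C) :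
    -- the JSQ system has a stationary distribution
    (∀ ε ∈ Ioo 0 ε₀, ∃ ν : ProbabilityMeasure (Z × (Fin n → ℕ)),
      MMJSQ.IsStationary (MMJSQ.jsqRate Q (lam ε) mu) (ν : Measure (Z × (Fin n → ℕ)))) ∧
    -- the limit `k*` exists
    ∃ kstar : ℝ,
      Tendsto (fun ε => ∫ i, (MMJSQ.muTot mu i - lam ε i) * Vh ε i ∂p) (𝓝[>] 0) (𝓝 kstar) ∧
      ∃ hmean : 0 < 1 / (n : ℝ) * (1 + kstar / MMJSQ.muSigma p mu),
        ∀ ν : ℝ → ProbabilityMeasure (Z × (Fin n → ℕ)),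
          (∀ ε ∈ Ioo 0 ε₀, MMJSQ.IsStationary (MMJSQ.jsqRate Q (lam ε) mu)
            (ν ε : Measure (Z × (Fin n → ℕ)))) →
          -- Laplace transform of each scaled queue length, with rate
          (∀ j : Fin n, ∀ s : ℝ, 0 < s →
            (fun ε : ℝ => (∫ x, Real.exp (-s * ε * (x.2 j : ℝ)) ∂(ν ε : Measure (Z × (Fin n → ℕ))))
                - 1 / (1 + s / (n : ℝ) * (1 + kstar / MMJSQ.muSigma p mu)))
              =O[𝓝[>] 0] fun ε : ℝ => ε ^ (1 - 1 / (1 + min 1 η))) ∧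
          -- convergence in distribution of each scaled queue length
          (∀ j : Fin n, TendstoInDistribution
            (fun (ε : ℝ) (x : Z × (Fin n → ℕ)) => ε * (x.2 j : ℝ)) (𝓝[>] 0) (fun y : ℝ => y)
            (fun ε => (ν ε : Measure (Z × (Fin n → ℕ))))
            (MMJSQ.expLaw _ hmean : Measure ℝ)) ∧
          -- joint convergence in distribution to `Υ • 1`
          TendstoInDistribution
            (fun (ε : ℝ) (x : Z × (Fin n → ℕ)) (j : Fin n) => ε * (x.2 j : ℝ)) (𝓝[>] 0)
            (fun (y : ℝ) (_ : Fin n) => y)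
            (fun ε => (ν ε : Measure (Z × (Fin n → ℕ))))
            (MMJSQ.expLaw _ hmean : Measure ℝ) := by
  refine ⟨fun ε hε => hmodel.exists_isStationary hn hssc hε, ?_⟩
  obtain ⟨K, hK⟩ := hmodel.exists_bounds hn
  -- Any positive base point `e` with `2 * e < ε₀` would do; `3 / 2 * e` then lies in the parameter
  -- range as well.
  have he : 0 < ε₀ / 4 := by linarith
  have he2 : 2 * (ε₀ / 4) < ε₀ := by linarith
  have hQ := (hK (ε₀ / 4) ⟨he, by linarith⟩).rates
  have pVh := fun ε hε => (hVh ε hε).pair hQ (MMJSQ.integrable_of_moment hη (hVh_moment ε hε))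
  have pVk := fun ε hε => (hVk ε hε).pair hQ (MMJSQ.integrable_of_moment hζ (hVk_moment ε hε))
  have pVl := hVl.pair hQ (MMJSQ.integrable_of_moment hβ hVl_moment)
  obtain ⟨K', D⟩ := hmodel.exists_twoPointData hn he he2 hssc pVh pVk pVl hη hVh_moment hK
  have hm := hmodel.muSigma_pos hε₀
  have hk0 := D.integral_mul_interp_two_nonneg hmodel.stationary
  refine ⟨_, D.tendsto_integral_mul hmodel hn he2 pVh hVh_const, ?_⟩
  set kstar := ∫ i, (MMJSQ.muTot mu i
    - MMJSQ.interp 2 (lam (ε₀ / 4)) (lam (2 * (ε₀ / 4))) i)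
      * MMJSQ.interp 2 (Vh (ε₀ / 4)) (Vh (2 * (ε₀ / 4))) i ∂p with hkstar
  have hn0 := D.n_pos
  have hmean : 0 < 1 / (n : ℝ) * (1 + kstar / MMJSQ.muSigma p mu) := by positivity
  refine ⟨hmean, fun ν hν => ?_⟩
  have hlap := fun (j : Fin n) {s : ℝ} (hs : 0 < s) =>
    D.exists_abs_laplace_single_sub_le hmodel he2 hK hν j hs
  have hO : ∀ j : Fin n, ∀ s : ℝ, 0 < s →
      (fun ε : ℝ => (∫ x, Real.exp (-s * ε * (x.2 j : ℝ)) ∂(ν ε : Measure (Z × (Fin n → ℕ))))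
          - 1 / (1 + s / (n : ℝ) * (1 + kstar / MMJSQ.muSigma p mu)))
        =O[𝓝[>] 0] fun ε : ℝ => ε ^ (1 - 1 / (1 + min 1 η)) := fun j s hs => by
    obtain ⟨C, hC⟩ := hlap j hs
    refine Asymptotics.IsBigO.of_bound C ?_
    filter_upwards [hC, self_mem_nhdsWithin] with ε h1 hε
    rwa [Real.norm_eq_abs, Real.norm_of_nonneg (Real.rpow_nonneg (le_of_lt hε) _)]
  have hsingle : ∀ j : Fin n, TendstoInDistribution
      (fun (ε : ℝ) (x : Z × (Fin n → ℕ)) => ε * (x.2 j : ℝ)) (𝓝[>] 0) (fun y : ℝ => y)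
      (fun ε => (ν ε : Measure (Z × (Fin n → ℕ)))) (MMJSQ.expLaw _ hmean : Measure ℝ) :=
    fun j => MMJSQ.tendstoInDistribution_single hmean fun s hs => by
      have h1 := (hO j s hs).trans_tendsto (MMJSQ.tendsto_rpow_heavy_traffic D.a_pos)
      have h2 := h1.add_const (1 / (1 + s / (n : ℝ) * (1 + kstar / MMJSQ.muSigma p mu)))
      simp only [sub_add_cancel, zero_add] at h2
      rwa [show s * (1 / (n : ℝ) * (1 + kstar / MMJSQ.muSigma p mu))
        = s / n * (1 + kstar / MMJSQ.muSigma p mu) by ring]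
  obtain ⟨C, -, hC⟩ := D.exists_integral_perp_le hmodel he2 hK hν
  exact ⟨hO, hsingle, MMJSQ.tendstoInDistribution_joint (hsingle ⟨0, hn⟩) hC⟩
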